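/- **Theorem (Perfect Knowledge Thermal State Preparation).** *Setting.* Let $d=\dim_S\ge 2$ and let $H_S=\sum_{i=1}^{d}\lambda_S(i)\,|i\rangle\langle i|$ be a Hermitian $d\times d$ matrix with no degenerate eigenvalues, $\lambda_S(1)<\dots<\lambda_S(d)$, where $|1\rangle,\dots,|d\rangle$ is an orthonormal eigenbasis. Put $\Delta_S(i,j)=\lambda_S(i)-\lambda_S(j)$, $$\delta_{\min}=\min_{\Delta_S(i,j)\ne\Delta_S(k,l)}|\Delta_S(i,j)-\Delta_S(k,l)|,\qquad \eta_\Delta(i,j)=\#\{(k,l): k>l,\ \Delta_S(k,l)=\Delta_S(i,j)\}\quad(i>j).$$ For $\beta\in[0,\infty)$ the thermal state of a Hamiltonian $K$ is $e^{-\beta K}/\operatorname{Tr}e^{-\beta K}$, and for $\beta=\infty$ it is the limit of these states as $\beta\to\infty$; $\rho_S(\beta)$ is the thermal state of $H_S$. *Channel.* For $\gamma>0$ let $H_E=\operatorname{diag}(0,\gamma)$ on one qubit, $\rho_E(\beta)=q_\gamma(0)|0\rangle\langle0|+q_\gamma(1)|1\rangle\langle1|$ its thermal state, $H=H_S\otimes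 1+1\otimes H_E$, and $$\Phi_\gamma(\rho)=\operatorname{Tr}_{E}\,\mathbb E_G\!\left[e^{i(H+\alpha G)t}\,(\rho\otimes\rho_E(\beta))\,e^{-i(H+\alpha G)t}\right],\qquad G=UDU^\dagger,$$ where $U$ is a Haar-random unitary on $\mathbb C^d\otimes\mathbb C^2$ and $D$ is an independent diagonal matrix with i.i.d. standard normal entries. Let $\gamma$ be random with $\Pr[\gamma=\Delta_S(i,j)]=\eta_\Delta(i,j)/\binom d2$ (for $i>j$). *On-resonance chain.* With $\widetilde\alpha^2=\alpha^2t^2/(2d+1)$ let $T_\gamma$ be the real $d\times d$ matrix whose entry for the transition $i\to j$ (row $j$, column $i$), $j\neq i$, is $$\widetilde\alpha^2\Big(q_\gamma(0)\,\mathbf I[|\Delta_S(i,j)-\gamma|<\delta_{\min}]\operatorname{sinc}^2\tfrac{(\Delta_S(i,j)-\gamma)t}{2}+q_\gamma(1)\,\mathbf I[|\Delta_S(i,j)+\gamma|<\delta_{\min}]\operatorname{sinc}^2\tfrac{(\Delta_S(i,j)+\gamma)t}{2}\Big),$$ and whose columns sum to zero. Let $\mathbb E_\gamma\mathcal T^{(\gamma)}_{\rm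 on}$ be the map that acts by $\mathbb E_\gamma T_\gamma$ on the populations of states diagonal in the basis $|i\rangle$. Let $\widetilde\lambda_\star(\beta)$ be the spectral gap of the rescaled matrix $\mathbb E_\gamma T_\gamma\cdot\binom d2/\widetilde\alpha^2$, i.e. the least modulus of its eigenvalues (with algebraic multiplicity) after one eigenvalue $0$ is removed. *Notation.* $f\in\widetilde O(g)$ means $|f|\le C\,g\,\big(1+\log d+|\log\epsilon|+|\log\widetilde\lambda_\star(\beta)|\big)^{k}$ with universal constants $C,k$, independent of $H_S$, $d$, $\beta$, $\epsilon$ and $\rho$. *Claims.* 1. For every $\beta\in[0,\infty]$, $\widetilde\lambda_\star(\beta)$ does not depend on $\alpha,t>0$ and is positive. For all $\alpha,t>0$ the thermal state $\rho_S(\beta)$ is the unique fixed point of $\mathds 1+\mathbb E_\gamma\mathcal T^{(\gamma)}_{\rm on}$ among the density matrices that commute with $H_S$. 2. For every $\beta\in[0,\infty]$ and $\epsilon\in(0,2]$, with $$\alpha=\frac{\delta_{\min}\,\epsilon^{1.5}\,\widetilde\lambda_\star(\beta)^{1.5}}{d^{7}},\qquad t=\frac{d^{2}}{\delta_{\min}\,\epsilon^{0.5}\,\widetilde\lambda_\star(\beta)^{0.5}}$$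 and $$L=\Big\lceil c\,\frac{d^{14}}{\epsilon^{2}\widetilde\lambda_\star(\beta)^{3}}\big(1+\log d+|\log\epsilon|+|\log\widetilde\lambda_\star(\beta)|\big)^{k}\Big\rceil\in\widetilde O\!\left(\frac{d^{14}}{\epsilon^{2}\,\widetilde\lambda_\star(\beta)^{3}}\right)$$ for suitable universal constants $c>0$ and $k$, every density matrix $\rho$ that commutes with $H_S$ satisfies $$\big\|\rho_S(\beta)-(\mathbb E_\gamma\Phi_\gamma)^{\circ L}(\rho)\big\|_1\in\widetilde O(\epsilon),\qquad\text{and}\qquad L\cdot t\in\widetilde O\!\left(\frac{d^{16}}{\delta_{\min}\,\epsilon^{2.5}\,\widetilde\lambda_\star(\beta)^{3.5}}\right).$$ 3. In the ground state limit, $\lim_{\beta\to\infty}\rho_S(\beta)=\rho_S(\infty)=|1\rangle\langle1|$ and $$\lim_{\beta\to\infty}\widetilde\lambda_\star(\beta)=\widetilde\lambda_\star(\infty)=\min_{i>1}\sum_{j<i}\eta_\Delta(i,j)\ \ge\ 1 .$$ -/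

import Mathlib

open MeasureTheory ProbabilityTheory Filter Topology
open scoped Matrix Kronecker ENNReal NNReal ComplexOrder

noncomputable section

namespace ThermalPrep

/-! ### The Haar measure on the unitary group -/

section Haar

variable (n : Type) [Fintype n] [DecidableEq n]

instance unitaryMeasurableSpace : MeasurableSpace (Matrix.unitaryGroup n ℂ) := borel _

instance unitaryBorelSpace : BorelSpace (Matrix.unitaryGroup n ℂ) := ⟨rfl⟩

instance unitaryCompactSpace : CompactSpace (Matrix.unitaryGroup n ℂ) := by
  have hK : IsCompact (Set.univ.pi fun _ : n => Set.univ.pi fun _ : n =>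
      Metric.closedBall (0 : ℂ) 1) :=
    isCompact_univ_pi fun _ => isCompact_univ_pi fun _ => isCompact_closedBall 0 1
  have hcl : IsClosed ((Matrix.unitaryGroup n ℂ : Set (Matrix n n ℂ))) := isClosed_unitary
  refine isCompact_iff_compactSpace.mp (hK.of_isClosed_subset hcl ?_)
  intro U hU i _ j _
  simpa using entry_norm_bound_of_unitary hU i j

/-- The Haar probability measure on the unitary group. -/
def haarUnitary : Measure (Matrix.unitaryGroup n ℂ) := Measure.haarMeasure ⊤

/-- The law of the pair `(U, D)`: a Haar random unitary and, independently of it, i.i.d. standard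
normal eigenvalues. -/
def interactionLaw : Measure (Matrix.unitaryGroup n ℂ × (n → ℝ)) :=
  (haarUnitary n).prod (Measure.pi fun _ => gaussianReal 0 1)

end Haar

section Channel

variable {n : Type} [Fintype n] [DecidableEq n]

/-- The interaction `G = U D U†`. -/
def interaction (p : Matrix.unitaryGroup n ℂ × (n → ℝ)) : Matrix n n ℂ :=
  (p.1 : Matrix n n ℂ) * Matrix.diagonal (fun i => (p.2 i : ℂ)) * (p.1 : Matrix n n ℂ)ᴴ

/-- The entrywise expectation over the random interaction. -/
def interactionExpectation (F : Matrix n n ℂ → Matrix n n ℂ) : Matrix n n ℂ :=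
  Matrix.of fun i j => ∫ p, F (interaction p) i j ∂(interactionLaw n)

/-- The Gibbs state `e^{-bH} / tr e^{-bH}` at a real inverse temperature. -/
def gibbsState (H : Matrix n n ℂ) (b : ℝ) : Matrix n n ℂ :=
  (NormedSpace.exp (-(b : ℂ) • H)).trace⁻¹ • NormedSpace.exp (-(b : ℂ) • H)

open Classical in
/-- The thermal state at inverse temperature `β ∈ [0, ∞]`; at `β = ∞` it is the limit of the
Gibbs states. -/
def thermalState (H : Matrix n n ℂ) (β : ℝ≥0∞) : Matrix n n ℂ :=
  if β = ⊤ then limUnder atTop (gibbsState H) else gibbsState H β.toReal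

/-- A density matrix. -/
def IsState (ρ : Matrix n n ℂ) : Prop := ρ.PosSemidef ∧ ρ.trace = 1

/-- The Schatten `1`-norm: the sum of the singular values. -/
def traceNorm (X : Matrix n n ℂ) : ℝ :=
  ∑ i, Real.sqrt ((Matrix.isHermitian_conjTranspose_mul_self X).eigenvalues i)

/-- The partial trace over the second factor. -/
def traceEnv {m : Type} [Fintype m] (X : Matrix (n × m) (n × m) ℂ) : Matrix n n ℂ :=
  Matrix.of fun i j => ∑ a, X (i, a) (j, a)

/-- The Hamiltonian `diag(0, γ)` of the single environment qubit. -/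
def envHamiltonian (γ : ℝ) : Matrix (Fin 2) (Fin 2) ℂ := !![0, 0; 0, (γ : ℂ)]

/-- `H_S ⊗ 1 + 1 ⊗ H_E`. -/
def totalHamiltonian (H : Matrix n n ℂ) (γ : ℝ) : Matrix (n × Fin 2) (n × Fin 2) ℂ :=
  H ⊗ₖ (1 : Matrix (Fin 2) (Fin 2) ℂ) + (1 : Matrix n n ℂ) ⊗ₖ envHamiltonian γ

/-- The evolution `e^{i(H + αG)t} X e^{-i(H + αG)t}` of the system and the environment. -/
def evolve (H : Matrix n n ℂ) (γ α t : ℝ) (X G : Matrix (n × Fin 2) (n × Fin 2) ℂ) :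
    Matrix (n × Fin 2) (n × Fin 2) ℂ :=
  NormedSpace.exp ((Complex.I * (t : ℂ)) • (totalHamiltonian H γ + (α : ℂ) • G)) * X *
    NormedSpace.exp (-(Complex.I * (t : ℂ)) • (totalHamiltonian H γ + (α : ℂ) • G))

/-- The thermalizing channel `Φ_γ`. -/
def thermalChannel (H : Matrix n n ℂ) (β : ℝ≥0∞) (α t γ : ℝ) (ρ : Matrix n n ℂ) :
    Matrix n n ℂ :=
  traceEnv (interactionExpectation
    (evolve H γ α t (ρ ⊗ₖ thermalState (envHamiltonian γ) β)))

end Channel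

/-! ### Eigenvalue differences

The system energies are `E 0 < E 1 < ⋯ < E (d - 1)`. -/

section Gaps

variable {d : ℕ}

/-- `Δ_S(i, j)`. -/
def gap (E : Fin d → ℝ) (i j : Fin d) : ℝ := E i - E j

/-- `δ_min`: the least distance between two distinct eigenvalue differences (a minimum over a
finite set, nonempty for `d ≥ 2` and distinct energies). -/
def deltaMin (E : Fin d → ℝ) : ℝ :=
  sInf {x | ∃ i j k l, gap E i j ≠ gap E k l ∧ x = |gap E i j - gap E k l|}

open Classical in
/-- The number of pairs of levels whose energy difference is `x`. -/
def gapMultiplicity (E : Fin d → ℝ) (x : ℝ) : ℕ :=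
  (Finset.univ.filter fun p : Fin d × Fin d => p.2 < p.1 ∧ gap E p.1 p.2 = x).card

open Classical in
/-- The set of the distinct positive eigenvalue differences. -/
def gapSet (E : Fin d → ℝ) : Finset ℝ :=
  (Finset.univ.filter fun p : Fin d × Fin d => p.2 < p.1).image fun p => gap E p.1 p.2

/-- The expectation over `γ` with `P(γ = x) = (multiplicity of x) / (d choose 2)`. -/
def gapExpectation {M : Type} [AddCommMonoid M] [Module ℝ M] (E : Fin d → ℝ) (f : ℝ → M) : M :=
  ∑ x ∈ gapSet E, ((gapMultiplicity E x : ℝ) / (d.choose 2 : ℝ)) • f x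

/-- The averaged channel `E_γ Φ_γ`. -/
def averagedChannel (H : Matrix (Fin d) (Fin d) ℂ) (E : Fin d → ℝ) (β : ℝ≥0∞) (α t : ℝ)
    (ρ : Matrix (Fin d) (Fin d) ℂ) : Matrix (Fin d) (Fin d) ℂ :=
  gapExpectation E fun γ => thermalChannel H β α t γ ρ

/-! ### The on-resonance Markov chain -/

/-- The population of level `m` of the environment qubit in its thermal state. -/
def envPopulation (β : ℝ≥0∞) (γ : ℝ) (m : Fin 2) : ℝ :=
  (thermalState (envHamiltonian γ) β m m).re

/-- `α̃² = α² t² / (dim + 1)`, where `dim = 2 d`. -/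
def alphaTildeSq (d : ℕ) (α t : ℝ) : ℝ := (α * t / Real.sqrt (2 * d + 1)) ^ 2

open Classical in
/-- The on-resonance transition weight from level `i` to a level `j ≠ i`. -/
def onWeight (E : Fin d → ℝ) (β : ℝ≥0∞) (α t γ : ℝ) (j i : Fin d) : ℝ :=
  alphaTildeSq d α t *
    ((if |gap E i j - γ| < deltaMin E then
        envPopulation β γ 0 * Real.sinc ((gap E i j - γ) * t / 2) ^ 2 else 0) +
     (if |gap E i j + γ| < deltaMin E then
        envPopulation β γ 1 * Real.sinc ((gap E i j + γ) * t / 2) ^ 2 else 0))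

/-- The on-resonance transition matrix `T_γ`; column `i` holds the transitions out of level `i`,
and the columns sum to zero. -/
def onMatrix (E : Fin d → ℝ) (β : ℝ≥0∞) (α t γ : ℝ) : Matrix (Fin d) (Fin d) ℝ :=
  Matrix.of fun j i =>
    if j = i then -∑ k ∈ Finset.univ.erase i, onWeight E β α t γ k i
    else onWeight E β α t γ j i

/-- `E_γ T_γ`. -/
def averagedOnMatrix (E : Fin d → ℝ) (β : ℝ≥0∞) (α t : ℝ) : Matrix (Fin d) (Fin d) ℝ :=
  gapExpectation E fun γ => onMatrix E β α t γ

/-- The rescaled transition matrix `E_γ T_γ · (d choose 2) / α̃²`. -/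
def rescaledMatrix (E : Fin d → ℝ) (β : ℝ≥0∞) (α t : ℝ) : Matrix (Fin d) (Fin d) ℝ :=
  ((d.choose 2 : ℝ) / alphaTildeSq d α t) • averagedOnMatrix E β α t

open Classical in
/-- The spectral gap of a matrix whose columns sum to zero: the least modulus among its complex
eigenvalues, counted with algebraic multiplicity, after removal of one eigenvalue `0`. -/
def spectralGap (R : Matrix (Fin d) (Fin d) ℝ) : ℝ :=
  sInf {x | ∃ μ ∈ ((R.map (algebraMap ℝ ℂ)).charpoly.roots).erase 0, x = ‖μ‖}

/-- The projection on the `i`-th column of `V`. -/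
def eigenprojection (V : Matrix.unitaryGroup (Fin d) ℂ) (i : Fin d) : Matrix (Fin d) (Fin d) ℂ :=
  (V : Matrix (Fin d) (Fin d) ℂ) * Matrix.single i i 1 * (V : Matrix (Fin d) (Fin d) ℂ)ᴴ

/-- The map `E_γ 𝒯_on` on states that are diagonal in the eigenbasis given by the columns
of `V`: `X ↦ ∑ i j, (E_γ T_γ)_{ji} ⟨i|X|i⟩ |j⟩⟨j|`. -/
def averagedOnMap (V : Matrix.unitaryGroup (Fin d) ℂ) (E : Fin d → ℝ) (β : ℝ≥0∞) (α t : ℝ)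
    (X : Matrix (Fin d) (Fin d) ℂ) : Matrix (Fin d) (Fin d) ℂ :=
  ∑ i, ∑ j, ((averagedOnMatrix E β α t j i : ℂ) *
    ((V : Matrix (Fin d) (Fin d) ℂ)ᴴ * X * (V : Matrix (Fin d) (Fin d) ℂ)) i i) •
      eigenprojection V j

end Gaps

/-! ### Parameters -/

/-- `α = δ ε^{3/2} λ^{3/2} / d^7`. -/
def couplingParam (d : ℕ) (δ ε lam : ℝ) : ℝ :=
  δ * ε ^ (3 / 2 : ℝ) * lam ^ (3 / 2 : ℝ) / (d : ℝ) ^ 7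

/-- `t = d^2 / (δ ε^{1/2} λ^{1/2})`. -/
def timeParam (d : ℕ) (δ ε lam : ℝ) : ℝ :=
  (d : ℝ) ^ 2 / (δ * ε ^ (1 / 2 : ℝ) * lam ^ (1 / 2 : ℝ))

/-- The logarithmic factor whose powers the notation `Õ` suppresses. -/
def logFactor (d : ℕ) (ε lam : ℝ) : ℝ := 1 + Real.log d + |Real.log ε| + |Real.log lam|

/-- `L = ⌈c · d^14 / (ε^2 λ^3) · (logarithmic factor)^k⌉`. -/
def stepsParam (c : ℝ) (k : ℕ) (d : ℕ) (ε lam : ℝ) : ℕ :=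
  ⌈c * ((d : ℝ) ^ 14 / (ε ^ 2 * lam ^ 3)) * logFactor d ε lam ^ k⌉₊

end ThermalPrep

end

/-!
Averaged over `γ`, the channel is a small step of a Markov chain on the energy levels, up to an
error of third order in the coupling and an off-resonant error; the chain has the Gibbs weights as
its stationary vector and mixes at the rate given by its spectral gap.

*The chain.* A difference `γ` of the spectrum is resonant with a transition `i → j` only if
`|E i - E j| = γ`, since all other differences are at least `δ_min` away. Averaging over `γ` turns
the transition matrix into `α̃² / (d choose 2)` times a generator `rateMatrix` that does not involve
`α` and `t` (`averagedOnMatrix_eq`). Because the ratio of the qubit populations is `e^{-βγ}`, it is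
in detailed balance with the Gibbs weights (`detailedBalance`), and every level decays to the ground
state at rate at least `1 / 2`, at every temperature (`rateMatrix_isDoeblin`). By this Doeblin
condition the generator has algebraically simple eigenvalue `0`, all other eigenvalues have modulus
at least `1 / 2`, and the stationary state is unique (`IsDoeblin`, `fixedPoint_iff`). At zero
temperature the generator is triangular, so the gap is the least exit rate
(`isLeast_spectralGap_top`), and the gap is continuous in the temperature because the
characteristic polynomial is (`IsDoeblin.tendsto_spectralGap`).

*Mixing.* The eigenvalues are real, by detailed balance or, at zero temperature, by triangularity.
The vectors of sum zero are killed by the product of `R - μ` over the `d - 1` nonzero eigenvalues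
`μ`, and splitting off one factor at a time shows, without diagonalizing, that they decay like
`(4 / g) ^ (d - 1) (1 - g / 2) ^ n` for a gap `g` of a step (`l1_pow_mulVec_le`). The prefactor
costs `d log (1 / g)` steps divided by `g`, which accounts for `d ^ 14 = d ^ 13 · d` in the number
of steps.

*The channel.* The law of the interaction is invariant under unitary conjugation, so the channel is
covariant (`thermalChannel_conj`): it preserves diagonal states and acts on the populations by a
stochastic matrix (`thermalChannel_diagonal`). Its columns sum to one, so only the entries off the
diagonal have to be estimated, and for these the second-order term of `|⟨k| e^{i(H + αG)t} |l⟩|²`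
is the squared first Dyson term. The Dyson remainder is bounded in operator norm and summed over
`k` by Cauchy–Schwarz (`sum_abs_transition_sub_le`). The mean of `|G k l|²` is `1 / (2d + 1)`:
invariance under permutations, phases and the mixing of two levels relates the second moments, and
the traces of `D` and `D²` fix them (`secondMoment_offdiag`). Off resonance `sinc²` is at most
`4 / (δ_min t)²` (`sinc_sq_le`). A step thus deviates from the chain by
`O(d (αt)³ + (α / δ_min)²)`, and the deviations of contractions add up (`l1_pow_sub_pow_le`,
`traceNorm_iterate_le`); the choice of `α`, `t` and `L` makes the sum `Õ(ε)`.
-/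

noncomputable section

namespace ThermalPrep

/-! ### Generators of finite Markov chains -/

section Markov

variable {d : ℕ}

/-- The `ℓ¹` norm of a complex vector. -/
def l1 (v : Fin d → ℂ) : ℝ := ∑ i, ‖v i‖

lemma l1_nonneg (v : Fin d → ℂ) : 0 ≤ l1 v := Finset.sum_nonneg fun _ _ => norm_nonneg _

lemma l1_pos {v : Fin d → ℂ} (hv : v ≠ 0) : 0 < l1 v := by
  obtain ⟨i, hi⟩ := Function.ne_iff.mp hv
  exact Finset.sum_pos' (fun _ _ => norm_nonneg _) ⟨i, Finset.mem_univ _, norm_pos_iff.mpr hi⟩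

lemma l1_smul (c : ℂ) (v : Fin d → ℂ) : l1 (c • v) = ‖c‖ * l1 v := by
  simp [l1, Finset.mul_sum]

lemma l1_add_le (v w : Fin d → ℂ) : l1 (v + w) ≤ l1 v + l1 w := by
  rw [l1, l1, l1, ← Finset.sum_add_distrib]
  exact Finset.sum_le_sum fun i _ => norm_add_le _ _

/-- The complexification of a real matrix. -/
def complexify (R : Matrix (Fin d) (Fin d) ℝ) : Matrix (Fin d) (Fin d) ℂ :=
  R.map (algebraMap ℝ ℂ)

@[simp] lemma complexify_apply (R : Matrix (Fin d) (Fin d) ℝ) (i j : Fin d) :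
    complexify R i j = (R i j : ℂ) := rfl

lemma l1_mulVec_le {M : Matrix (Fin d) (Fin d) ℝ} {B : ℝ} (h0 : ∀ i j, 0 ≤ M i j)
    (hB : ∀ j, ∑ i, M i j = B) (v : Fin d → ℂ) :
    l1 (complexify M *ᵥ v) ≤ B * l1 v := by
  calc l1 (complexify M *ᵥ v) ≤ ∑ i, ∑ j, M i j * ‖v j‖ := by
        refine Finset.sum_le_sum fun i _ => ?_
        rw [Matrix.mulVec, dotProduct]
        refine (norm_sum_le _ _).trans_eq ?_
        refine Finset.sum_congr rfl fun j _ => ?_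
        simp [abs_of_nonneg (h0 i j)]
    _ = ∑ j, (∑ i, M i j) * ‖v j‖ := by
        rw [Finset.sum_comm]; simp_rw [Finset.sum_mul]
    _ = B * l1 v := by simp_rw [hB, l1, Finset.mul_sum]

lemma sum_mulVec (M : Matrix (Fin d) (Fin d) ℂ) {c : ℂ} (hc : ∀ j, ∑ i, M i j = c)
    (v : Fin d → ℂ) : ∑ i, (M *ᵥ v) i = c * ∑ i, v i := by
  simp only [Matrix.mulVec, dotProduct]
  rw [Finset.sum_comm, Finset.mul_sum]
  simp_rw [← Finset.sum_mul, hc]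

/-- A generator of a Markov chain (column `i` holds the rates out of state `i`) with exit rates at
most `B`, from every state of which the state `o` is reached at rate at least `m > 0`. -/
structure IsDoeblin (R : Matrix (Fin d) (Fin d) ℝ) (o : Fin d) (m B : ℝ) : Prop where
  sum_col : ∀ j, ∑ i, R i j = 0
  nonneg : ∀ i j, i ≠ j → 0 ≤ R i j
  exit_le : ∀ i, -R i i ≤ B
  pos : 0 < m
  le_rate : ∀ i, i ≠ o → m ≤ R o i
  bound_nonneg : 0 ≤ B

namespace IsDoeblin

variable {R : Matrix (Fin d) (Fin d) ℝ} {o : Fin d} {m B : ℝ}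

/-- Doeblin's minorization: the rates into `o` make the chain contract vectors of sum zero. -/
lemma norm_eigenvalue_le (h : IsDoeblin R o m B) {μ : ℂ} {v : Fin d → ℂ}
    (hv : complexify R *ᵥ v = μ • v) (hs : ∑ i, v i = 0) (hv0 : v ≠ 0) : ‖(B + m : ℂ) + μ‖ ≤ B := by
  -- On vectors of sum zero, `R + (B + m)` agrees with this entrywise nonnegative matrix of
  -- column sums `B`.
  let M : Matrix (Fin d) (Fin d) ℝ := Matrix.of fun i j =>
    R i j + (if i = j then B + m else 0) - (if i = o then m else 0)
  have hM0 : ∀ i j, 0 ≤ M i j := by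
    intro i j
    have h1 := h.exit_le i
    have h2 := h.pos
    by_cases hij : i = j
    · subst hij
      by_cases hio : i = o <;> simp [M, hio] <;> (try subst hio) <;> linarith
    · have h3 := h.nonneg i j hij
      by_cases hio : i = o
      · have h4 := h.le_rate j (fun hj => hij (hio.trans hj.symm))
        subst hio
        simp [M, hij]; linarith
      · simpa [M, hij, hio] using h3
  have hMB : ∀ j, ∑ i, M i j = B := by
    intro j
    simp only [M, Matrix.of_apply, Finset.sum_sub_distrib, Finset.sum_add_distrib, h.sum_col]
    simp
  have hMv : complexify M *ᵥ v = ((B + m : ℂ) + μ) • v := by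
    ext i
    have e := congrFun hv i
    simp only [Matrix.mulVec, dotProduct, complexify_apply, Pi.smul_apply, smul_eq_mul] at e ⊢
    have : ∀ j, (M i j : ℂ) * v j = (R i j : ℂ) * v j + (if i = j then ((B + m : ℂ)) * v j else 0)
        - (if i = o then (m : ℂ) else 0) * v j := by
      intro j
      simp only [M, Matrix.of_apply]
      split_ifs <;> push_cast <;> ring
    simp_rw [this, Finset.sum_sub_distrib, Finset.sum_add_distrib, e, ← Finset.mul_sum, hs]
    simp
    ring
  have := l1_mulVec_le hM0 hMB v
  rw [hMv, l1_smul] at this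
  exact le_of_mul_le_mul_right this (l1_pos hv0)

lemma sum_complexify_col (h : IsDoeblin R o m B) (j : Fin d) :
    ∑ i, complexify R i j = 0 := by
  simp only [complexify_apply]
  exact_mod_cast h.sum_col j

lemma sum_mulVec_eq_zero (h : IsDoeblin R o m B) (v : Fin d → ℂ) :
    ∑ i, (complexify R *ᵥ v) i = 0 := by
  rw [sum_mulVec _ h.sum_complexify_col, zero_mul]

lemma norm_ofReal_bound (h : IsDoeblin R o m B) : ‖(B + m : ℂ)‖ = B + m := by
  rw [← Complex.ofReal_add, Complex.norm_real, Real.norm_of_nonneg]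
  linarith [h.pos, h.bound_nonneg]

/-- A stationary vector of sum zero vanishes. -/
lemma eq_zero_of_mulVec_eq_zero (h : IsDoeblin R o m B) {v : Fin d → ℂ}
    (hv : complexify R *ᵥ v = 0) (hs : ∑ i, v i = 0) : v = 0 := by
  by_contra hv0
  have := h.norm_eigenvalue_le (μ := 0) (by simpa using hv) hs hv0
  rw [add_zero, h.norm_ofReal_bound] at this
  linarith [h.pos]

end IsDoeblin

lemma exists_eigenvector {A : Matrix (Fin d) (Fin d) ℂ} {μ : ℂ} (h : A.charpoly.IsRoot μ) :
    ∃ v ≠ 0, A *ᵥ v = μ • v := by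
  rw [Polynomial.IsRoot.def, Matrix.eval_charpoly] at h
  obtain ⟨v, hv, e⟩ := Matrix.exists_mulVec_eq_zero_iff.mpr h
  refine ⟨v, hv, ?_⟩
  rw [Matrix.sub_mulVec, sub_eq_zero] at e
  rw [← e]
  ext i
  simp [Matrix.scalar_apply, Matrix.mulVec_diagonal]

/-- The eigenvalues of `R` with multiplicity, after one eigenvalue `0` is removed. -/
def nonzeroSpectrum (R : Matrix (Fin d) (Fin d) ℝ) : Multiset ℂ :=
  (complexify R).charpoly.roots.erase 0

lemma spectralGap_eq (R : Matrix (Fin d) (Fin d) ℝ) :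
    spectralGap R = sInf {x | ∃ μ ∈ nonzeroSpectrum R, x = ‖μ‖} := by
  unfold spectralGap nonzeroSpectrum complexify
  congr! 5

lemma isRoot_of_mem_nonzeroSpectrum {R : Matrix (Fin d) (Fin d) ℝ} {μ : ℂ}
    (hμ : μ ∈ nonzeroSpectrum R) : (complexify R).charpoly.IsRoot μ :=
  (Polynomial.mem_roots'.mp (Multiset.mem_of_mem_erase hμ)).2

namespace IsDoeblin

variable {R : Matrix (Fin d) (Fin d) ℝ} {o : Fin d} {m B : ℝ}

lemma zero_mem_roots (h : IsDoeblin R o m B) : (0 : ℂ) ∈ (complexify R).charpoly.roots := by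
  rw [Polynomial.mem_roots (Matrix.charpoly_monic _).ne_zero, Polynomial.IsRoot.def,
    Matrix.eval_charpoly]
  refine Matrix.exists_vecMul_eq_zero_iff.mp ⟨fun _ => 1, ?_, ?_⟩
  · exact Function.ne_iff.mpr ⟨o, one_ne_zero⟩
  · ext j
    simpa [Matrix.vecMul, dotProduct] using h.sum_complexify_col j

lemma mulVec_eq_zero_of_pow (h : IsDoeblin R o m B) (k : ℕ) {v : Fin d → ℂ}
    (hv : (complexify R ^ k) *ᵥ v = 0) : complexify R *ᵥ v = 0 := by
  induction k with
  | zero => simp at hv; simp [hv]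
  | succ k ih =>
    cases k with
    | zero => simpa using hv
    | succ k =>
      refine ih (h.eq_zero_of_mulVec_eq_zero ?_ ?_)
      · rwa [Matrix.mulVec_mulVec, ← pow_succ']
      · rw [pow_succ', ← Matrix.mulVec_mulVec]
        exact h.sum_mulVec_eq_zero _

/-- The eigenvalue `0` is algebraically simple: the generalized kernel is the kernel, on which the
sum of the entries is injective. -/
lemma rootMultiplicity_zero_le (h : IsDoeblin R o m B) :
    (complexify R).charpoly.rootMultiplicity 0 ≤ 1 := by
  rw [← Matrix.charpoly_toLin', ← LinearMap.finrank_maxGenEigenspace_eq]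
  let f : (Fin d → ℂ) →ₗ[ℂ] ℂ := ∑ i, LinearMap.proj i
  have hf : ∀ v, f v = ∑ i, v i := fun v => by simp [f]
  have hinj : Function.Injective
      (f.comp (Module.End.maxGenEigenspace (Matrix.toLin' (complexify R)) 0).subtype) := by
    rw [← LinearMap.ker_eq_bot, LinearMap.ker_eq_bot']
    rintro ⟨v, hv⟩ hfv
    obtain ⟨k, hk⟩ := Module.End.mem_maxGenEigenspace _ _ _ |>.mp hv
    simp only [LinearMap.comp_apply, Submodule.subtype_apply, hf] at hfv
    have hk' : (complexify R ^ k) *ᵥ v = 0 := by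
      rw [zero_smul, sub_zero, ← Matrix.toLin'_pow, Matrix.toLin'_apply] at hk
      exact hk
    exact Subtype.ext (h.eq_zero_of_mulVec_eq_zero (h.mulVec_eq_zero_of_pow k hk') hfv)
  simpa using LinearMap.finrank_le_finrank_of_injective hinj

lemma zero_notMem (h : IsDoeblin R o m B) : (0 : ℂ) ∉ nonzeroSpectrum R := by
  classical
  rw [← Multiset.count_eq_zero, nonzeroSpectrum, Multiset.count_erase_self, Polynomial.count_roots]
  have := h.rootMultiplicity_zero_le
  omega

lemma card_nonzeroSpectrum (h : IsDoeblin R o m B) :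
    (nonzeroSpectrum R).card = d - 1 := by
  rw [nonzeroSpectrum, Multiset.card_erase_of_mem h.zero_mem_roots,
    IsAlgClosed.card_roots_eq_natDegree, Matrix.charpoly_natDegree_eq_dim]
  simp

lemma charpoly_eq (h : IsDoeblin R o m B) : (complexify R).charpoly =
    Polynomial.X * ((nonzeroSpectrum R).map fun μ => Polynomial.X - Polynomial.C μ).prod := by
  conv_lhs => rw [(IsAlgClosed.splits (complexify R).charpoly).eq_prod_roots_of_monic
    (Matrix.charpoly_monic _), ← Multiset.cons_erase h.zero_mem_roots]
  simp [nonzeroSpectrum]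

lemma mem_nonzeroSpectrum_iff (h : IsDoeblin R o m B) {μ : ℂ} :
    μ ∈ nonzeroSpectrum R ↔ μ ≠ 0 ∧ (complexify R).charpoly.IsRoot μ := by
  constructor
  · intro hμ
    exact ⟨fun h0 => h.zero_notMem (h0 ▸ hμ), isRoot_of_mem_nonzeroSpectrum hμ⟩
  · rintro ⟨h0, hr⟩
    rw [nonzeroSpectrum, Multiset.mem_erase_of_ne h0]
    exact (Polynomial.mem_roots (Matrix.charpoly_monic _).ne_zero).mpr hr

lemma exists_eigenvector_of_mem (h : IsDoeblin R o m B) {μ : ℂ} (hμ : μ ∈ nonzeroSpectrum R) :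
    ∃ v ≠ 0, complexify R *ᵥ v = μ • v ∧ ∑ i, v i = 0 := by
  obtain ⟨h0, hr⟩ := h.mem_nonzeroSpectrum_iff.mp hμ
  obtain ⟨v, hv, e⟩ := exists_eigenvector hr
  refine ⟨v, hv, e, ?_⟩
  have := h.sum_mulVec_eq_zero v
  rw [e] at this
  simp only [Pi.smul_apply, smul_eq_mul, ← Finset.mul_sum] at this
  exact (mul_eq_zero.mp this).resolve_left h0

lemma norm_add_le_of_mem (h : IsDoeblin R o m B) {μ : ℂ} (hμ : μ ∈ nonzeroSpectrum R) :
    ‖(B + m : ℂ) + μ‖ ≤ B := by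
  obtain ⟨v, hv, e, hs⟩ := h.exists_eigenvector_of_mem hμ
  exact h.norm_eigenvalue_le e hs hv

lemma le_norm_of_mem (h : IsDoeblin R o m B) {μ : ℂ} (hμ : μ ∈ nonzeroSpectrum R) :
    m ≤ ‖μ‖ := by
  have h1 := h.norm_add_le_of_mem hμ
  have h2 := norm_sub_le ((B + m : ℂ) + μ) μ
  rw [add_sub_cancel_right, h.norm_ofReal_bound] at h2
  linarith

lemma norm_le_of_mem (h : IsDoeblin R o m B) {μ : ℂ} (hμ : μ ∈ nonzeroSpectrum R) :
    ‖μ‖ ≤ 2 * B + m := by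
  have h1 := h.norm_add_le_of_mem hμ
  have h2 := norm_sub_le ((B + m : ℂ) + μ) (B + m : ℂ)
  rw [add_sub_cancel_left, h.norm_ofReal_bound] at h2
  linarith

lemma exists_mem (h : IsDoeblin R o m B) (hd : 2 ≤ d) : ∃ μ, μ ∈ nonzeroSpectrum R := by
  refine Multiset.card_pos_iff_exists_mem.mp ?_
  rw [h.card_nonzeroSpectrum]
  omega

lemma spectralGap_isLeast (h : IsDoeblin R o m B) (hd : 2 ≤ d) :
    IsLeast {x | ∃ μ ∈ nonzeroSpectrum R, x = ‖μ‖} (spectralGap R) := by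
  have hfin : {x | ∃ μ ∈ nonzeroSpectrum R, x = ‖μ‖}.Finite := by
    classical
    refine ((nonzeroSpectrum R).toFinset.image fun μ => ‖μ‖).finite_toSet.subset ?_
    rintro x ⟨μ, hμ, rfl⟩
    simp only [Finset.coe_image, Set.mem_image, Finset.mem_coe, Multiset.mem_toFinset]
    exact ⟨μ, hμ, rfl⟩
  obtain ⟨μ, hμ⟩ := h.exists_mem hd
  rw [spectralGap_eq]
  exact ⟨Set.Nonempty.csInf_mem ⟨_, μ, hμ, rfl⟩ hfin, fun x hx => csInf_le hfin.bddBelow hx⟩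

lemma le_spectralGap (h : IsDoeblin R o m B) (hd : 2 ≤ d) : m ≤ spectralGap R := by
  obtain ⟨μ, hμ, e⟩ := (h.spectralGap_isLeast hd).1
  exact e ▸ h.le_norm_of_mem hμ

lemma spectralGap_le (h : IsDoeblin R o m B) (hd : 2 ≤ d) : spectralGap R ≤ 2 * B + m := by
  obtain ⟨μ, hμ, e⟩ := (h.spectralGap_isLeast hd).1
  exact e ▸ h.norm_le_of_mem hμ

lemma eval_charpoly (h : IsDoeblin R o m B) (z : ℂ) : (complexify R).charpoly.eval z =
    z * ((nonzeroSpectrum R).map fun μ => z - μ).prod := by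
  rw [h.charpoly_eq, Polynomial.eval_mul, Polynomial.eval_X, Polynomial.eval_multiset_prod,
    Multiset.map_map]
  simp

end IsDoeblin

end Markov

/-! ### Mixing time and continuity of the spectral gap -/

section Mixing

variable {d : ℕ}

/-- If `∏ (R - μ)` kills `v` and the eigenvalues `1 + κ μ` of the stochastic matrix
`P = 1 + κ R` have modulus at most `1 - g`, the iterates of `v` decay at rate `g / 2`, whether or
not `P` is diagonalizable. Along the list, `P ^ (n + 1) v = P ^ n (P - ν) v + ν P ^ n v`. -/
lemma l1_pow_mulVec_le {R P : Matrix (Fin d) (Fin d) ℂ} {κ g : ℝ} (hP : P = 1 + (κ : ℂ) • R)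
    (hl : ∀ v, l1 (P *ᵥ v) ≤ l1 v) (hg : 0 < g) (hg1 : g ≤ 1) (s : List ℂ)
    (hs : ∀ μ ∈ s, ‖1 + κ * μ‖ ≤ 1 - g) :
    ∀ v : Fin d → ℂ,
      (Polynomial.aeval R (s.map fun μ => Polynomial.X - Polynomial.C μ).prod) *ᵥ v = 0 →
      ∀ n : ℕ, l1 ((P ^ n) *ᵥ v) ≤ (4 / g) ^ s.length * (1 - g / 2) ^ n * l1 v := by
  induction s with
  | nil =>
    intro v hv n
    have : v = 0 := by simpa using hv
    subst this
    simp [l1]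
  | cons μ s ih =>
    intro v hv n
    have hy : 1 ≤ 4 / g := by rw [le_div_iff₀ hg]; linarith
    have hlv := l1_nonneg v
    have hν := hs μ (by simp)
    set w := P *ᵥ v - (1 + κ * μ : ℂ) • v with hw
    have hwR : w = (κ : ℂ) • (R *ᵥ v - μ • v) := by
      rw [hw, hP, Matrix.add_mulVec, Matrix.one_mulVec, Matrix.smul_mulVec]
      module
    have hw0 : (Polynomial.aeval R
        (s.map fun μ => Polynomial.X - Polynomial.C μ).prod) *ᵥ w = 0 := by
      rw [List.map_cons, List.prod_cons, mul_comm, map_mul, ← Matrix.mulVec_mulVec] at hv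
      rw [hwR, Matrix.mulVec_smul]
      have : (Polynomial.aeval R (Polynomial.X - Polynomial.C μ)) *ᵥ v = R *ᵥ v - μ • v := by
        rw [map_sub, Polynomial.aeval_X, Polynomial.aeval_C, Matrix.sub_mulVec,
          Algebra.algebraMap_eq_smul_one, Matrix.smul_mulVec, Matrix.one_mulVec]
      rw [this] at hv
      rw [hv, smul_zero]
    have hw2 : l1 w ≤ 2 * l1 v := by
      have h1 := l1_add_le (P *ᵥ v) (-(1 + κ * μ : ℂ) • v)
      rw [l1_smul, norm_neg] at h1
      have h2 : w = P *ᵥ v + -(1 + κ * μ : ℂ) • v := by rw [hw]; module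
      rw [h2]
      have h3 := hl v
      have h4 : ‖(1 + κ * μ : ℂ)‖ * l1 v ≤ 1 * l1 v := by gcongr; linarith
      linarith
    have hih := ih (fun a ha => hs a (by simp [ha])) w hw0
    induction n with
    | zero =>
      simp only [pow_zero, Matrix.one_mulVec, mul_one]
      exact le_mul_of_one_le_left hlv (one_le_pow₀ hy)
    | succ n ihn =>
      have e : (P ^ (n + 1)) *ᵥ v = (P ^ n) *ᵥ w + (1 + κ * μ : ℂ) • ((P ^ n) *ᵥ v) := by
        rw [pow_succ, ← Matrix.mulVec_mulVec, ← Matrix.mulVec_smul, ← Matrix.mulVec_add, hw,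
          sub_add_cancel]
      have hθ : 0 ≤ 1 - g / 2 := by linarith
      calc l1 ((P ^ (n + 1)) *ᵥ v)
          ≤ l1 ((P ^ n) *ᵥ w) + ‖(1 + κ * μ : ℂ)‖ * l1 ((P ^ n) *ᵥ v) := by
            rw [e, ← l1_smul]; exact l1_add_le _ _
        _ ≤ (4 / g) ^ s.length * (1 - g / 2) ^ n * (2 * l1 v) +
            (1 - g) * ((4 / g) ^ (s.length + 1) * (1 - g / 2) ^ n * l1 v) := by
            gcongr
            · exact (hih n).trans (by gcongr)
            · exact l1_nonneg _
            · simpa using ihn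
        _ = (4 / g) ^ (μ :: s).length * (1 - g / 2) ^ (n + 1) * l1 v := by
            rw [List.length_cons, pow_succ (4 / g), pow_succ (1 - g / 2)]
            field_simp
            ring

namespace IsDoeblin

variable {R : Matrix (Fin d) (Fin d) ℝ} {o : Fin d} {m B : ℝ}

lemma sum_sub_mulVec_eq_zero (h : IsDoeblin R o m B) (s : List ℂ) :
    ∀ v : Fin d → ℂ, ∑ i, v i = 0 → ∑ i, ((Polynomial.aeval (complexify R)
      (s.map fun μ => Polynomial.X - Polynomial.C μ).prod) *ᵥ v) i = 0 := by
  induction s with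
  | nil => intro v hv; simpa using hv
  | cons μ s ih =>
    intro v hv
    rw [List.map_cons, List.prod_cons, map_mul, ← Matrix.mulVec_mulVec]
    rw [map_sub, Polynomial.aeval_X, Polynomial.aeval_C, Matrix.sub_mulVec,
          Algebra.algebraMap_eq_smul_one, Matrix.smul_mulVec, Matrix.one_mulVec]
    simp only [Pi.sub_apply, Finset.sum_sub_distrib, h.sum_mulVec_eq_zero, Pi.smul_apply,
      smul_eq_mul, ← Finset.mul_sum, ih v hv, mul_zero, sub_zero]

/-- The product of `R - μ` over the nonzero eigenvalues kills the vectors of sum zero, by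
Cayley–Hamilton and the injectivity of `R` on them. -/
lemma aeval_mulVec_eq_zero (h : IsDoeblin R o m B) {v : Fin d → ℂ} (hv : ∑ i, v i = 0) :
    (Polynomial.aeval (complexify R)
      ((nonzeroSpectrum R).toList.map fun μ => Polynomial.X - Polynomial.C μ).prod) *ᵥ v = 0 := by
  refine h.eq_zero_of_mulVec_eq_zero ?_ (h.sum_sub_mulVec_eq_zero _ v hv)
  have hc := Matrix.aeval_self_charpoly (complexify R)
  rw [h.charpoly_eq, ← Multiset.coe_toList (nonzeroSpectrum R), Multiset.map_coe,
    Multiset.prod_coe, map_mul, Polynomial.aeval_X] at hc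
  rw [Matrix.mulVec_mulVec, hc, Matrix.zero_mulVec]

/-- The eigenvalues are real. -/
def RealSpectrum (R : Matrix (Fin d) (Fin d) ℝ) : Prop := ∀ μ ∈ nonzeroSpectrum R, μ.im = 0

lemma norm_one_add_le (h : IsDoeblin R o m B) (hd : 2 ≤ d) (hR : RealSpectrum R) {κ : ℝ}
    (hκ : 0 ≤ κ) (hκB : κ * (2 * B + m) ≤ 1) {μ : ℂ} (hμ : μ ∈ nonzeroSpectrum R) :
    ‖1 + κ * μ‖ ≤ 1 - κ * spectralGap R := by
  obtain ⟨x, rfl⟩ : ∃ x : ℝ, μ = x :=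
    ⟨μ.re, Complex.ext (by simp) (by simpa using hR μ hμ)⟩
  have h1 := h.norm_add_le_of_mem hμ
  have h2 := h.norm_le_of_mem hμ
  have h3 := (h.spectralGap_isLeast hd).2 ⟨_, hμ, rfl⟩
  have h4 := h.pos
  rw [← Complex.ofReal_add, ← Complex.ofReal_add, Complex.norm_real, Real.norm_eq_abs] at h1
  rw [Complex.norm_real, Real.norm_eq_abs] at h2 h3
  have hx : x < 0 := by linarith [(abs_le.mp h1).2]
  rw [abs_of_neg hx] at h2 h3
  rw [← Complex.ofReal_mul, ← Complex.ofReal_one, ← Complex.ofReal_add, Complex.norm_real,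
    Real.norm_eq_abs, abs_le]
  have h5 := mul_le_mul_of_nonneg_left h2 hκ
  have h6 := mul_le_mul_of_nonneg_left h3 hκ
  have h7 := mul_le_mul_of_nonneg_left (h.spectralGap_le hd) hκ
  constructor <;> linarith

lemma l1_one_add_mulVec_le (h : IsDoeblin R o m B) {κ : ℝ} (hκ : 0 ≤ κ)
    (hκB : κ * B ≤ 1) (v : Fin d → ℂ) : l1 ((1 + (κ : ℂ) • complexify R) *ᵥ v) ≤ l1 v := by
  have e : (1 + (κ : ℂ) • complexify R) = complexify (1 + κ • R) := by
    ext i j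
    by_cases hij : i = j <;> simp [hij]
  rw [e]
  refine (l1_mulVec_le (B := 1) ?_ ?_ v).trans_eq (one_mul _)
  · intro i j
    by_cases hij : i = j
    · subst hij
      simp only [Matrix.add_apply, Matrix.one_apply_eq, Matrix.smul_apply, smul_eq_mul]
      nlinarith [h.exit_le i]
    · simpa [Matrix.one_apply, hij] using mul_nonneg hκ (h.nonneg i j hij)
  · intro j
    simp only [Matrix.add_apply, Matrix.smul_apply, smul_eq_mul, Finset.sum_add_distrib,
      ← Finset.mul_sum, h.sum_col j, Matrix.one_apply]
    simp

/-- The distance to stationarity of a chain with real spectrum, in terms of its spectral gap. -/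
lemma l1_pow_le (h : IsDoeblin R o m B) (hd : 2 ≤ d) (hR : RealSpectrum R) {κ : ℝ}
    (hκ : 0 < κ) (hκB : κ * (2 * B + m) ≤ 1) {v : Fin d → ℂ} (hv : ∑ i, v i = 0) (n : ℕ) :
    l1 (((1 + (κ : ℂ) • complexify R) ^ n) *ᵥ v) ≤
      (4 / (κ * spectralGap R)) ^ (d - 1) * (1 - κ * spectralGap R / 2) ^ n * l1 v := by
  have h0 := h.le_spectralGap hd
  have h1 := h.pos
  have h2 := h.bound_nonneg
  have h7 := mul_le_mul_of_nonneg_left (h.spectralGap_le hd) hκ.le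
  have := l1_pow_mulVec_le (R := complexify R) (κ := κ) (g := κ * spectralGap R) rfl
    (h.l1_one_add_mulVec_le hκ.le (by nlinarith)) (by nlinarith [mul_pos hκ h1]) (by linarith)
    (nonzeroSpectrum R).toList
    (fun μ hμ => h.norm_one_add_le hd hR hκ.le hκB (Multiset.mem_toList.mp hμ)) v
    (h.aeval_mulVec_eq_zero hv) n
  rwa [Multiset.length_toList, h.card_nonzeroSpectrum] at this

/-- A chain in detailed balance with a positive vector is self-adjoint for a weighted inner
product. -/
lemma realSpectrum_of_detailedBalance {π : Fin d → ℝ} (hπ : ∀ i, 0 < π i)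
    (hb : ∀ i j, R j i * π i = R i j * π j) : RealSpectrum R := by
  intro μ hμ
  obtain ⟨v, hv, e⟩ := exists_eigenvector (isRoot_of_mem_nonzeroSpectrum hμ)
  let N : ℝ := ∑ j, Complex.normSq (v j) / π j
  have hN : 0 < N := by
    obtain ⟨i, hi⟩ := Function.ne_iff.mp hv
    refine Finset.sum_pos' (fun i _ => div_nonneg (Complex.normSq_nonneg _) (hπ i).le)
      ⟨i, Finset.mem_univ _, div_pos (Complex.normSq_pos.mpr hi) (hπ i)⟩
  let q : ℂ := ∑ j, ∑ i, (starRingEnd ℂ) (v j) * (R j i / π j : ℂ) * v i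
  have hq : q = μ * N := by
    simp only [q, N]
    push_cast
    rw [Finset.mul_sum]
    refine Finset.sum_congr rfl fun j _ => ?_
    have ej := congrFun e j
    simp only [Matrix.mulVec, dotProduct, complexify_apply, Pi.smul_apply, smul_eq_mul] at ej
    have : ∑ i, (starRingEnd ℂ) (v j) * (R j i / π j : ℂ) * v i =
        (starRingEnd ℂ) (v j) / π j * ∑ i, (R j i : ℂ) * v i := by
      rw [Finset.mul_sum]
      exact Finset.sum_congr rfl fun i _ => by ring
    rw [this, ej, Complex.normSq_eq_conj_mul_self]
    ring
  have hqc : (starRingEnd ℂ) q = q := by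
    simp only [q, map_sum, map_mul, map_div₀, Complex.conj_conj, Complex.conj_ofReal]
    rw [Finset.sum_comm]
    refine Finset.sum_congr rfl fun j _ => Finset.sum_congr rfl fun i _ => ?_
    have h1 : (R i j : ℂ) / π i = R j i / π j := by
      rw [div_eq_div_iff (by exact_mod_cast (hπ i).ne') (by exact_mod_cast (hπ j).ne')]
      exact_mod_cast hb j i
    rw [h1]; ring
  have him : q.im = 0 := Complex.conj_eq_iff_im.mp hqc
  rw [hq, Complex.im_mul_ofReal] at him
  exact (mul_eq_zero.mp him).resolve_right hN.ne'

lemma charpoly_of_upper (hU : R.IsUpperTriangular) : (complexify R).charpoly =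
    ∏ i, (Polynomial.X - Polynomial.C (R i i : ℂ)) :=
  Matrix.charpoly_of_isUpperTriangular _ (fun i j hij => by simp [hU hij])

lemma realSpectrum_of_upper (hU : R.IsUpperTriangular) : RealSpectrum R := by
  intro μ hμ
  have := isRoot_of_mem_nonzeroSpectrum hμ
  rw [charpoly_of_upper hU, Polynomial.IsRoot.def, Polynomial.eval_prod,
    Finset.prod_eq_zero_iff] at this
  obtain ⟨i, -, hi⟩ := this
  rw [Polynomial.eval_sub, Polynomial.eval_X, Polynomial.eval_C, sub_eq_zero] at hi
  simp [hi]

lemma mem_nonzeroSpectrum_of_upper (h : IsDoeblin R o m B) (hU : R.IsUpperTriangular) {μ : ℂ} :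
    μ ∈ nonzeroSpectrum R ↔ μ ≠ 0 ∧ ∃ i, μ = R i i := by
  rw [h.mem_nonzeroSpectrum_iff, charpoly_of_upper hU, Polynomial.IsRoot.def,
    Polynomial.eval_prod, Finset.prod_eq_zero_iff]
  simp [sub_eq_zero]

/-- Continuity of the spectral gap. An eigenvalue of the limit is approached because the
characteristic polynomial is the product of the distances to the eigenvalues; conversely the
eigenvalues stay away from a compact set free of eigenvalues of the limit. -/
lemma tendsto_spectralGap {ι : Type*} {l : Filter ι} {S : ι → Matrix (Fin d) (Fin d) ℝ}
    (hd : 2 ≤ d) (h : IsDoeblin R o m B) (hS : ∀ b, IsDoeblin (S b) o m B)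
    (hlim : Tendsto S l (𝓝 R)) :
    Tendsto (fun b => spectralGap (S b)) l (𝓝 (spectralGap R)) := by
  have hdet : Continuous fun p : Matrix (Fin d) (Fin d) ℝ × ℂ =>
      (complexify p.1).charpoly.eval p.2 := by
    simp_rw [Matrix.eval_charpoly, Matrix.scalar_apply]
    unfold complexify
    exact (((continuous_pi fun _ => continuous_snd).matrix_diagonal).sub
      (continuous_fst.matrix_map Complex.continuous_ofReal)).matrix_det
  rw [Metric.tendsto_nhds]
  intro ε hε
  obtain ⟨μ, hμ, hμe⟩ := (h.spectralGap_isLeast hd).1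
  obtain ⟨hμ0, hμr⟩ := h.mem_nonzeroSpectrum_iff.mp hμ
  have upper : ∀ᶠ b in l, spectralGap (S b) < spectralGap R + ε := by
    have ht : Tendsto (fun b => ‖(complexify (S b)).charpoly.eval μ‖) l (𝓝 0) := by
      have := ((hdet.tendsto (R, μ)).comp (hlim.prodMk_nhds tendsto_const_nhds)).norm
      simpa [hμr.eq_zero, Function.comp_def] using this
    have hpos : 0 < ‖μ‖ * ε ^ (d - 1) := mul_pos (norm_pos_iff.mpr hμ0) (pow_pos hε _)
    filter_upwards [ht.eventually_lt_const hpos] with b hb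
    by_contra! hcon
    refine absurd hb (not_lt.mpr ?_)
    rw [(hS b).eval_charpoly, norm_mul]
    gcongr
    have hall : ∀ ν ∈ nonzeroSpectrum (S b), ε ≤ ‖μ - ν‖ := by
      intro ν hν
      have h1 := ((hS b).spectralGap_isLeast hd).2 ⟨ν, hν, rfl⟩
      have h2 := norm_sub_norm_le ν μ
      rw [norm_sub_rev] at h2
      linarith
    rw [← (hS b).card_nonzeroSpectrum]
    generalize nonzeroSpectrum (S b) = M at hall
    induction M using Multiset.induction_on with
    | empty => simp
    | cons a M ih =>
      rw [Multiset.map_cons, Multiset.prod_cons, norm_mul, Multiset.card_cons, pow_succ']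
      exact mul_le_mul (hall a (by simp)) (ih fun ν hν => hall ν (by simp [hν]))
        (by positivity) (norm_nonneg _)
  have lower : ∀ᶠ b in l, spectralGap R - ε < spectralGap (S b) := by
    let K : Set ℂ := {z | m ≤ ‖z‖} ∩ Metric.closedBall 0 (spectralGap R - ε)
    have hK : IsCompact K := (isCompact_closedBall _ _).inter_left
      (isClosed_le continuous_const continuous_norm)
    have hev := hK.eventually_forall_of_forall_eventually (x₀ := R)
      (P := fun A z => (complexify A).charpoly.eval z ≠ 0) (by
        rintro z ⟨hz1, hz2⟩
        refine (hdet.tendsto (R, z)).eventually_ne ?_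
        intro h0
        have hz : z ∈ nonzeroSpectrum R := h.mem_nonzeroSpectrum_iff.mpr
          ⟨fun h00 => by
            have := h.pos
            rw [h00] at hz1
            simp at hz1
            linarith, h0⟩
        have := (h.spectralGap_isLeast hd).2 ⟨z, hz, rfl⟩
        rw [mem_closedBall_zero_iff] at hz2
        linarith)
    filter_upwards [hlim.eventually hev] with b hb
    by_contra! hcon
    obtain ⟨ν, hν, hνe⟩ := ((hS b).spectralGap_isLeast hd).1
    refine hb ν ⟨(hS b).le_norm_of_mem hν, ?_⟩ ((hS b).mem_nonzeroSpectrum_iff.mp hν).2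
    rw [mem_closedBall_zero_iff]
    linarith
  filter_upwards [upper, lower] with b h1 h2
  rw [Real.dist_eq, abs_lt]
  constructor <;> linarith

end IsDoeblin

end Mixing

/-! ### Thermal states and the trace norm in an eigenbasis -/

section Thermal

variable {d : ℕ}

/-- The matrix with eigenvalues `v` on the columns of `V`. -/
def conjDiag (V : Matrix.unitaryGroup (Fin d) ℂ) (v : Fin d → ℂ) : Matrix (Fin d) (Fin d) ℂ :=
  (V : Matrix (Fin d) (Fin d) ℂ) * Matrix.diagonal v * (V : Matrix (Fin d) (Fin d) ℂ)ᴴ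

lemma unitary_conjTranspose_mul {n : Type} [Fintype n] [DecidableEq n]
    (V : Matrix.unitaryGroup n ℂ) : (V : Matrix n n ℂ)ᴴ * (V : Matrix n n ℂ) = 1 :=
  Matrix.mem_unitaryGroup_iff'.mp V.2

lemma unitary_mul_conjTranspose {n : Type} [Fintype n] [DecidableEq n]
    (V : Matrix.unitaryGroup n ℂ) : (V : Matrix n n ℂ) * (V : Matrix n n ℂ)ᴴ = 1 :=
  Matrix.mem_unitaryGroup_iff.mp V.2

lemma exp_unitary_conj {n : Type} [Fintype n] [DecidableEq n] (V : Matrix.unitaryGroup n ℂ)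
    (A : Matrix n n ℂ) : NormedSpace.exp ((V : Matrix n n ℂ) * A * (V : Matrix n n ℂ)ᴴ) =
      (V : Matrix n n ℂ) * NormedSpace.exp A * (V : Matrix n n ℂ)ᴴ := by
  have hinv : (V : Matrix n n ℂ)ᴴ = (V : Matrix n n ℂ)⁻¹ :=
    (Matrix.inv_eq_left_inv (unitary_conjTranspose_mul V)).symm
  have hu : IsUnit (V : Matrix n n ℂ) :=
    ⟨⟨V, (V : Matrix n n ℂ)ᴴ, unitary_mul_conjTranspose V, unitary_conjTranspose_mul V⟩, rfl⟩
  rw [hinv, Matrix.exp_conj _ _ hu]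

lemma smul_conjDiag (c : ℂ) (V : Matrix.unitaryGroup (Fin d) ℂ) (v : Fin d → ℂ) :
    c • conjDiag V v = conjDiag V (c • v) := by
  simp [conjDiag, Matrix.diagonal_smul]

lemma exp_conjDiag (V : Matrix.unitaryGroup (Fin d) ℂ) (v : Fin d → ℂ) :
    NormedSpace.exp (conjDiag V v) = conjDiag V fun i => Complex.exp (v i) := by
  rw [conjDiag, exp_unitary_conj, Matrix.exp_diagonal, conjDiag]
  congr 3
  ext i
  rw [Pi.coe_exp, Complex.exp_eq_exp_ℂ]

lemma trace_conjDiag (V : Matrix.unitaryGroup (Fin d) ℂ) (v : Fin d → ℂ) :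
    (conjDiag V v).trace = ∑ i, v i := by
  rw [conjDiag, Matrix.trace_mul_comm, ← Matrix.mul_assoc, unitary_conjTranspose_mul,
    Matrix.one_mul, Matrix.trace_diagonal]

/-- The Gibbs weights at a real inverse temperature. -/
def gibbsReal (E : Fin d → ℝ) (b : ℝ) (i : Fin d) : ℝ :=
  Real.exp (-b * E i) / ∑ j, Real.exp (-b * E j)

lemma gibbsState_conjDiag (V : Matrix.unitaryGroup (Fin d) ℂ) (E : Fin d → ℝ) (b : ℝ) :
    gibbsState (conjDiag V fun i => (E i : ℂ)) b = conjDiag V fun i => (gibbsReal E b i : ℂ) := by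
  rw [gibbsState, smul_conjDiag, exp_conjDiag, trace_conjDiag, smul_conjDiag]
  congr 1
  ext i
  simp only [gibbsReal, Pi.smul_apply, smul_eq_mul]
  push_cast
  rw [div_eq_inv_mul]

/-- The Gibbs weights of the levels `E 0 < E 1 < ⋯` at inverse temperature `β ∈ [0, ∞]`. -/
def gibbsWeight (E : Fin d → ℝ) (β : ℝ≥0∞) (i : Fin d) : ℝ :=
  if β = ⊤ then (if (i : ℕ) = 0 then 1 else 0) else gibbsReal E β.toReal i

lemma tendsto_gibbsReal {E : Fin d → ℝ} (hE : StrictMono E) (i : Fin d) :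
    Tendsto (fun b => gibbsReal E b i) atTop (𝓝 (gibbsWeight E ⊤ i)) := by
  have hd : 0 < d := i.pos
  let o : Fin d := ⟨0, hd⟩
  have h1 : ∀ j : Fin d, Tendsto (fun b => Real.exp (-b * (E j - E o))) atTop
      (𝓝 (if (j : ℕ) = 0 then 1 else 0)) := by
    intro j
    by_cases hj : (j : ℕ) = 0
    · have : j = o := Fin.ext hj
      subst this
      simp [o]
    · have hlt : E o < E j := hE (Fin.lt_def.mpr (Nat.pos_of_ne_zero hj))
      simp only [hj, if_false]
      refine Real.tendsto_exp_atBot.comp ?_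
      exact tendsto_neg_atTop_atBot.atBot_mul_const (sub_pos.mpr hlt)
  have h2 := tendsto_finsetSum Finset.univ fun j _ => h1 j
  have hsum : (∑ j : Fin d, if (j : ℕ) = 0 then (1 : ℝ) else 0) = 1 := by
    rw [Finset.sum_eq_single o]
    · simp [o]
    · intro j _ hj
      rw [if_neg fun h => hj (Fin.ext h)]
    · simp
  have h3 := (h1 i).div h2 (by rw [hsum]; exact one_ne_zero)
  rw [hsum, div_one] at h3
  simp only [gibbsWeight, if_true]
  refine h3.congr fun b => ?_
  have e : ∀ j, Real.exp (-b * (E j - E o)) = Real.exp (-b * E j) * Real.exp (b * E o) := by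
    intro j; rw [← Real.exp_add]; ring_nf
  simp only [Pi.div_apply, e, gibbsReal]
  rw [← Finset.sum_mul, mul_div_mul_right _ _ (Real.exp_pos _).ne']

lemma continuous_conjDiag (V : Matrix.unitaryGroup (Fin d) ℂ) : Continuous (conjDiag V) := by
  unfold conjDiag
  fun_prop

lemma tendsto_gibbsState (V : Matrix.unitaryGroup (Fin d) ℂ) {E : Fin d → ℝ}
    (hE : StrictMono E) : Tendsto (gibbsState (conjDiag V fun i => (E i : ℂ))) atTop
      (𝓝 (conjDiag V fun i => (gibbsWeight E ⊤ i : ℂ))) := by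
  have h := ((continuous_conjDiag V).tendsto (fun i => (gibbsWeight E ⊤ i : ℂ))).comp
    (f := fun (b : ℝ) i => (gibbsReal E b i : ℂ)) (x := atTop)
    (tendsto_pi_nhds.mpr fun i =>
      (Complex.continuous_ofReal.tendsto _).comp (tendsto_gibbsReal hE i))
  refine h.congr fun b => ?_
  rw [gibbsState_conjDiag]
  rfl

lemma thermalState_conjDiag (V : Matrix.unitaryGroup (Fin d) ℂ) {E : Fin d → ℝ}
    (hE : StrictMono E) (β : ℝ≥0∞) : thermalState (conjDiag V fun i => (E i : ℂ)) β =
      conjDiag V fun i => (gibbsWeight E β i : ℂ) := by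
  by_cases hβ : β = ⊤
  · subst hβ
    rw [thermalState, if_pos rfl]
    exact (tendsto_gibbsState V hE).limUnder_eq
  · rw [thermalState, if_neg hβ, gibbsState_conjDiag]
    simp [gibbsWeight, hβ]

lemma gibbsReal_pos (E : Fin d → ℝ) (b : ℝ) (i : Fin d) : 0 < gibbsReal E b i :=
  div_pos (Real.exp_pos _) (Finset.sum_pos (fun _ _ => Real.exp_pos _) ⟨i, Finset.mem_univ _⟩)

lemma gibbsWeight_pos (E : Fin d → ℝ) {β : ℝ≥0∞} (hβ : β ≠ ⊤) (i : Fin d) :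
    0 < gibbsWeight E β i := by
  simpa [gibbsWeight, hβ] using gibbsReal_pos E _ i

lemma gibbsWeight_nonneg (E : Fin d → ℝ) (β : ℝ≥0∞) (i : Fin d) : 0 ≤ gibbsWeight E β i := by
  by_cases hβ : β = ⊤
  · simp only [gibbsWeight, hβ, if_true]
    split_ifs <;> norm_num
  · exact (gibbsWeight_pos E hβ i).le

lemma sum_gibbsWeight (E : Fin d → ℝ) (β : ℝ≥0∞) (hd : 0 < d) :
    ∑ i, gibbsWeight E β i = 1 := by
  by_cases hβ : β = ⊤
  · simp only [gibbsWeight, hβ, if_true]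
    rw [Finset.sum_eq_single ⟨0, hd⟩]
    · simp
    · intro j _ hj
      rw [if_neg fun h => hj (Fin.ext h)]
    · simp
  · simp only [gibbsWeight, hβ, if_false, gibbsReal]
    rw [← Finset.sum_div, div_self]
    exact (Finset.sum_pos (fun _ _ => Real.exp_pos _) ⟨⟨0, hd⟩, Finset.mem_univ _⟩).ne'

lemma strictMono_qubit {γ : ℝ} (hγ : 0 < γ) : StrictMono (![0, γ] : Fin 2 → ℝ) := by
  rw [Fin.strictMono_iff_lt_succ]
  intro i
  fin_cases i
  simpa using hγ

lemma thermalState_envHamiltonian {γ : ℝ} (hγ : 0 < γ) (β : ℝ≥0∞) :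
    thermalState (envHamiltonian γ) β =
      Matrix.diagonal fun m => (gibbsWeight ![0, γ] β m : ℂ) := by
  have e : envHamiltonian γ = conjDiag 1 fun i => ((![0, γ] : Fin 2 → ℝ) i : ℂ) := by
    ext i j
    fin_cases i <;> fin_cases j <;> simp [envHamiltonian, conjDiag]
  rw [e, thermalState_conjDiag 1 (strictMono_qubit hγ)]
  simp [conjDiag]

lemma envPopulation_eq {γ : ℝ} (hγ : 0 < γ) (β : ℝ≥0∞) (m : Fin 2) :
    envPopulation β γ m = gibbsWeight ![0, γ] β m := by
  simp [envPopulation, thermalState_envHamiltonian hγ]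

lemma thermalState_env {γ : ℝ} (hγ : 0 < γ) (β : ℝ≥0∞) : thermalState (envHamiltonian γ) β =
    Matrix.diagonal fun m => (envPopulation β γ m : ℂ) := by
  simp_rw [envPopulation_eq hγ]
  exact thermalState_envHamiltonian hγ β

lemma charpoly_conjDiag (V : Matrix.unitaryGroup (Fin d) ℂ) (v : Fin d → ℂ) :
    (conjDiag V v).charpoly = ∏ i, (Polynomial.X - Polynomial.C (v i)) := by
  rw [conjDiag, Matrix.mul_assoc, Matrix.charpoly_mul_comm, Matrix.mul_assoc,
    unitary_conjTranspose_mul, Matrix.mul_one, Matrix.charpoly_diagonal]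

lemma conjTranspose_conjDiag (V : Matrix.unitaryGroup (Fin d) ℂ) (v : Fin d → ℂ) :
    (conjDiag V v)ᴴ = conjDiag V (star v) := by
  simp [conjDiag, Matrix.conjTranspose_mul, Matrix.diagonal_conjTranspose, Matrix.mul_assoc]

lemma conjDiag_mul (V : Matrix.unitaryGroup (Fin d) ℂ) (v w : Fin d → ℂ) :
    conjDiag V v * conjDiag V w = conjDiag V (v * w) := by
  calc conjDiag V v * conjDiag V w = (V : Matrix (Fin d) (Fin d) ℂ) * Matrix.diagonal v *
      ((V : Matrix (Fin d) (Fin d) ℂ)ᴴ * (V : Matrix (Fin d) (Fin d) ℂ)) * Matrix.diagonal w *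
        (V : Matrix (Fin d) (Fin d) ℂ)ᴴ := by simp only [conjDiag, Matrix.mul_assoc]
    _ = _ := by
      rw [unitary_conjTranspose_mul, Matrix.mul_one, conjDiag,
        Matrix.mul_assoc (V : Matrix (Fin d) (Fin d) ℂ), Matrix.diagonal_mul_diagonal]
      rfl

lemma conjDiag_sub (V : Matrix.unitaryGroup (Fin d) ℂ) (v w : Fin d → ℂ) :
    conjDiag V v - conjDiag V w = conjDiag V (v - w) := by
  rw [conjDiag, conjDiag, conjDiag, ← Matrix.sub_mul, ← Matrix.mul_sub,
    Matrix.diagonal_sub]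
  rfl

lemma conjDiag_add (V : Matrix.unitaryGroup (Fin d) ℂ) (v w : Fin d → ℂ) :
    conjDiag V v + conjDiag V w = conjDiag V (v + w) := by
  rw [conjDiag, conjDiag, conjDiag, ← Matrix.add_mul, ← Matrix.mul_add,
    Matrix.diagonal_add]
  rfl

lemma traceNorm_conjDiag (V : Matrix.unitaryGroup (Fin d) ℂ) (v : Fin d → ℂ) :
    traceNorm (conjDiag V v) = l1 v := by
  have hX : (conjDiag V v)ᴴ * conjDiag V v = conjDiag V fun i => ((‖v i‖ ^ 2 : ℝ) : ℂ) := by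
    rw [conjTranspose_conjDiag, conjDiag_mul]
    congr 1
    ext i
    simp only [Pi.mul_apply, Pi.star_apply, RCLike.star_def]
    rw [← Complex.normSq_eq_conj_mul_self, Complex.normSq_eq_norm_sq]
  have hr :=
    (Matrix.isHermitian_conjTranspose_mul_self (conjDiag V v)).roots_charpoly_eq_eigenvalues
  have hc : ((conjDiag V v)ᴴ * conjDiag V v).charpoly.roots =
      (Finset.univ : Finset (Fin d)).val.map fun i => ((‖v i‖ ^ 2 : ℝ) : ℂ) := by
    rw [hX, charpoly_conjDiag]
    exact Polynomial.roots_multiset_prod_X_sub_C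
      ((Finset.univ : Finset (Fin d)).val.map fun i => ((‖v i‖ ^ 2 : ℝ) : ℂ)) ▸ by
        rw [Multiset.map_map]; rfl
  rw [hc] at hr
  have := congrArg (fun s => (s.map fun z : ℂ => Real.sqrt z.re).sum) hr
  simp only [Multiset.map_map, Function.comp_def, Complex.ofReal_re,
    Real.sqrt_sq (norm_nonneg _)] at this
  unfold traceNorm l1
  exact this.symm

lemma conjDiag_apply_col (V : Matrix.unitaryGroup (Fin d) ℂ) (v : Fin d → ℂ) :
    (V : Matrix (Fin d) (Fin d) ℂ)ᴴ * conjDiag V v * (V : Matrix (Fin d) (Fin d) ℂ) =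
      Matrix.diagonal v := by
  calc _ = ((V : Matrix (Fin d) (Fin d) ℂ)ᴴ * (V : Matrix (Fin d) (Fin d) ℂ)) *
      Matrix.diagonal v * ((V : Matrix (Fin d) (Fin d) ℂ)ᴴ * (V : Matrix (Fin d) (Fin d) ℂ)) := by
        simp only [conjDiag, Matrix.mul_assoc]
    _ = _ := by rw [unitary_conjTranspose_mul, Matrix.one_mul, Matrix.mul_one]

lemma conjDiag_injective (V : Matrix.unitaryGroup (Fin d) ℂ) :
    Function.Injective (conjDiag V) := by
  intro v w h
  have := conjDiag_apply_col V v
  rw [h, conjDiag_apply_col] at this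
  exact (Matrix.diagonal_injective this).symm

lemma eigenprojection_eq (V : Matrix.unitaryGroup (Fin d) ℂ) (i : Fin d) :
    eigenprojection V i = conjDiag V (Pi.single i 1) := by
  rw [eigenprojection, conjDiag, Matrix.diagonal_single]

/-- A matrix commuting with a Hamiltonian of nondegenerate spectrum is diagonal in its
eigenbasis. -/
lemma exists_conjDiag_of_commute (V : Matrix.unitaryGroup (Fin d) ℂ) {E : Fin d → ℝ}
    (hE : StrictMono E) {X : Matrix (Fin d) (Fin d) ℂ}
    (h : Commute X (conjDiag V fun i => (E i : ℂ))) : ∃ v, X = conjDiag V v := by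
  set W : Matrix (Fin d) (Fin d) ℂ := (V : Matrix (Fin d) (Fin d) ℂ)
  have hWW : W * Wᴴ = 1 := unitary_mul_conjTranspose V
  have hWW' : Wᴴ * W = 1 := unitary_conjTranspose_mul V
  set Y := Wᴴ * X * W with hY
  have hX : X = W * Y * Wᴴ := by
    calc X = (W * Wᴴ) * X * (W * Wᴴ) := by rw [hWW, Matrix.one_mul, Matrix.mul_one]
      _ = _ := by simp only [hY, Matrix.mul_assoc]
  have hc : Y * Matrix.diagonal (fun i => (E i : ℂ)) =
      Matrix.diagonal (fun i => (E i : ℂ)) * Y := by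
    have e := congrArg (fun Z => Wᴴ * Z * W) h.eq
    rw [← conjDiag_apply_col V fun i => (E i : ℂ)]
    calc _ = Wᴴ * X * (W * Wᴴ) * conjDiag V (fun i => (E i : ℂ)) * W := by
          simp only [hY, Matrix.mul_assoc, W]
      _ = Wᴴ * (X * conjDiag V (fun i => (E i : ℂ))) * W := by
          rw [hWW, Matrix.mul_one]; simp only [Matrix.mul_assoc]
      _ = Wᴴ * (conjDiag V (fun i => (E i : ℂ)) * X) * W := e
      _ = Wᴴ * conjDiag V (fun i => (E i : ℂ)) * (W * Wᴴ) * X * W := by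
          rw [hWW, Matrix.mul_one]; simp only [Matrix.mul_assoc]
      _ = _ := by simp only [hY, Matrix.mul_assoc, W]
  refine ⟨fun i => Y i i, ?_⟩
  rw [hX, conjDiag]
  congr 2
  ext i j
  by_cases hij : i = j
  · subst hij; simp
  · rw [Matrix.diagonal_apply_ne _ hij]
    have := congrFun (congrFun hc i) j
    rw [Matrix.mul_diagonal, Matrix.diagonal_mul, mul_comm, ← sub_eq_zero, ← sub_mul] at this
    refine (mul_eq_zero.mp this).resolve_left ?_
    rw [sub_eq_zero]
    exact_mod_cast fun h => hij (hE.injective h).symm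

lemma isState_conjDiag_iff (V : Matrix.unitaryGroup (Fin d) ℂ) (v : Fin d → ℂ) :
    IsState (conjDiag V v) ↔ (∀ i, 0 ≤ v i) ∧ ∑ i, v i = 1 := by
  rw [IsState, trace_conjDiag]
  refine and_congr_left fun _ => ?_
  constructor
  · intro h
    have := h.conjTranspose_mul_mul_same (V : Matrix (Fin d) (Fin d) ℂ)
    rw [conjDiag_apply_col] at this
    exact Matrix.posSemidef_diagonal_iff.mp this
  · intro h
    exact (Matrix.posSemidef_diagonal_iff.mpr h).mul_mul_conjTranspose_same _

end Thermal

/-! ### The law of the random interaction -/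

section Law

open scoped Matrix.Norms.L2Operator

variable {n : Type} [Fintype n] [DecidableEq n]

instance : (haarUnitary n).IsMulLeftInvariant := by unfold haarUnitary; infer_instance

instance : IsProbabilityMeasure (haarUnitary n) :=
  ⟨Measure.haarMeasure_self
    (K₀ := (⊤ : TopologicalSpace.PositiveCompacts (Matrix.unitaryGroup n ℂ)))⟩

instance : IsProbabilityMeasure (interactionLaw n) := by unfold interactionLaw; infer_instance

lemma norm_unitary_conj (U : Matrix.unitaryGroup n ℂ) (A : Matrix n n ℂ) :
    ‖(U : Matrix n n ℂ) * A * (U : Matrix n n ℂ)ᴴ‖ = ‖A‖ := by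
  rw [← Matrix.star_eq_conjTranspose, ← Unitary.coe_star, CStarRing.norm_mul_coe_unitary,
    CStarRing.norm_coe_unitary_mul]

lemma norm_interaction (p : Matrix.unitaryGroup n ℂ × (n → ℝ)) :
    ‖interaction p‖ = ‖p.2‖ := by
  rw [interaction, norm_unitary_conj, Matrix.l2_opNorm_diagonal]
  simp [Pi.norm_def]

lemma interaction_isHermitian (p : Matrix.unitaryGroup n ℂ × (n → ℝ)) :
    (interaction p).IsHermitian := by
  have : (Matrix.diagonal fun i => (p.2 i : ℂ)).IsHermitian := by
    rw [Matrix.isHermitian_diagonal_iff]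
    intro i
    simp [IsSelfAdjoint]
  unfold interaction
  exact Matrix.isHermitian_mul_mul_conjTranspose _ this

lemma continuous_interaction : Continuous (interaction (n := n)) := by
  unfold interaction
  fun_prop

instance : SecondCountableTopology (Matrix.unitaryGroup n ℂ) := by
  have : SecondCountableTopology (Matrix n n ℂ) :=
    inferInstanceAs (SecondCountableTopology (n → n → ℂ))
  infer_instance

instance : OpensMeasurableSpace (Matrix.unitaryGroup n ℂ × (n → ℝ)) :=
  Prod.opensMeasurableSpace

lemma integrable_abs_pow_gaussian (k : ℕ) :
    Integrable (fun x : ℝ => |x| ^ k) (gaussianReal 0 1) := by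
  simpa using (memLp_id_gaussianReal (μ := 0) (v := 1) k).integrable_norm_pow'

lemma integrable_abs_pow (k : ℕ) (i : n) :
    Integrable (fun p => |p.2 i| ^ k) (interactionLaw n) :=
  ((measurePreserving_eval (fun _ : n => gaussianReal 0 1) i).integrable_comp_of_integrable
    (integrable_abs_pow_gaussian k)).comp_snd _

lemma integral_abs_pow (k : ℕ) (i : n) :
    ∫ p, |p.2 i| ^ k ∂(interactionLaw n) = ∫ x, |x| ^ k ∂(gaussianReal 0 1) := by
  unfold interactionLaw
  rw [integral_fun_snd (fun D : n → ℝ => |D i| ^ k), probReal_univ, one_smul]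
  have h := measurePreserving_eval (fun _ : n => gaussianReal 0 1) i
  conv_rhs => rw [← h.map_eq, integral_map h.measurable.aemeasurable
    (Continuous.aestronglyMeasurable (by fun_prop))]

lemma norm_pow_le_sum {n : Type} [Fintype n] [Nonempty n] (D : n → ℝ) (k : ℕ) :
    ‖D‖ ^ k ≤ ∑ i, |D i| ^ k := by
  obtain ⟨i, hi⟩ := Finite.exists_max fun i => ‖D i‖
  have : ‖D‖ = |D i| := le_antisymm ((pi_norm_le_iff_of_nonneg (norm_nonneg _)).mpr hi)
    (norm_le_pi_norm D i)
  rw [this]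
  exact Finset.single_le_sum (f := fun i => |D i| ^ k) (fun _ _ => by positivity)
    (Finset.mem_univ i)

lemma integrable_norm_pow [Nonempty n] (k : ℕ) :
    Integrable (fun p => ‖interaction p‖ ^ k) (interactionLaw n) := by
  refine (integrable_finsetSum Finset.univ fun i _ => integrable_abs_pow k i).mono'
    (Continuous.aestronglyMeasurable (continuous_interaction.norm.pow k)) ?_
  refine Eventually.of_forall fun p => ?_
  rw [Real.norm_of_nonneg (by positivity), norm_interaction]
  exact norm_pow_le_sum p.2 k

/-- The `k`-th absolute moment of a standard normal variable. -/
def gaussianMoment (k : ℕ) : ℝ := ∫ x, |x| ^ k ∂(gaussianReal 0 1)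

lemma gaussianMoment_nonneg (k : ℕ) : 0 ≤ gaussianMoment k :=
  integral_nonneg fun _ => by positivity

lemma integral_norm_pow_le [Nonempty n] (k : ℕ) :
    ∫ p, ‖interaction p‖ ^ k ∂(interactionLaw n) ≤ Fintype.card n * gaussianMoment k := by
  calc ∫ p, ‖interaction p‖ ^ k ∂(interactionLaw n)
      ≤ ∫ p, ∑ i, |p.2 i| ^ k ∂(interactionLaw n) := by
        refine integral_mono (integrable_norm_pow k)
          (integrable_finsetSum Finset.univ fun i _ => integrable_abs_pow k i) fun p => ?_
        simp only [norm_interaction]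
        exact norm_pow_le_sum p.2 k
    _ = Fintype.card n * gaussianMoment k := by
        rw [integral_finsetSum _ fun i _ => integrable_abs_pow k i]
        simp [integral_abs_pow, gaussianMoment]

/-- The law of `U D U†` is invariant under unitary conjugation. -/
lemma integral_conj {X : Type*} [NormedAddCommGroup X] [NormedSpace ℝ X]
    (W : Matrix.unitaryGroup n ℂ) (f : Matrix n n ℂ → X) :
    ∫ p, f ((W : Matrix n n ℂ) * interaction p * (W : Matrix n n ℂ)ᴴ) ∂(interactionLaw n) =
      ∫ p, f (interaction p) ∂(interactionLaw n) := by
  let e : Matrix.unitaryGroup n ℂ × (n → ℝ) ≃ᵐ Matrix.unitaryGroup n ℂ × (n → ℝ) :=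
    (MeasurableEquiv.mulLeft W).prodCongr (MeasurableEquiv.refl _)
  have he : MeasurePreserving e (interactionLaw n) (interactionLaw n) :=
    (measurePreserving_mul_left (haarUnitary n) W).prod (MeasurePreserving.id _)
  rw [← he.integral_comp' (g := fun p => f (interaction p))]
  congr 1
  ext p
  have : interaction (e p) =
      (W : Matrix n n ℂ) * interaction p * (W : Matrix n n ℂ)ᴴ := by
    have h1 : (e p).1 = W * p.1 := rfl
    have h2 : (e p).2 = p.2 := rfl
    simp only [interaction, h1, h2, Submonoid.coe_mul, Matrix.conjTranspose_mul, Matrix.mul_assoc]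
  rw [this]

lemma norm_apply_le (A : Matrix n n ℂ) (i j : n) : ‖A i j‖ ≤ ‖A‖ := by
  have h := Matrix.l2_opNorm_mulVec A (EuclideanSpace.single j (1 : ℂ))
  refine le_trans ?_ (h.trans_eq (by simp))
  refine le_trans ?_ (PiLp.norm_apply_le _ i)
  simp

lemma integrable_entry_mul [Nonempty n] (i j k l : n) :
    Integrable (fun p => interaction p i j * interaction p k l) (interactionLaw n) := by
  refine (integrable_norm_pow (n := n) 2).mono' (Continuous.aestronglyMeasurable ?_) ?_
  · exact (continuous_interaction.matrix_elem i j).mul (continuous_interaction.matrix_elem k l)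
  · refine Eventually.of_forall fun p => ?_
    rw [norm_mul, sq]
    gcongr <;> exact norm_apply_le _ _ _

end Law

/-! ### Second moments of the random interaction -/

section Moments

variable {n : Type} [Fintype n] [DecidableEq n]

/-- The second moment `E[G i j * G k l]` of the interaction. -/
def secondMoment (i j k l : n) : ℂ :=
  ∫ p, interaction p i j * interaction p k l ∂(interactionLaw n)

/-- The unitary permutation matrix with rows permuted by `σ`. -/
def permUnitary (σ : Equiv.Perm n) : Matrix.unitaryGroup n ℂ :=
  ⟨σ.permMatrix ℂ, by
    rw [Matrix.mem_unitaryGroup_iff, Matrix.star_eq_conjTranspose, Matrix.conjTranspose_permMatrix,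
      ← Matrix.permMatrix_mul, inv_mul_cancel, Matrix.permMatrix_one]⟩

lemma permMatrix_conj (σ : Equiv.Perm n) (A : Matrix n n ℂ) (i j : n) :
    (σ.permMatrix ℂ * A * (σ.permMatrix ℂ)ᴴ) i j = A (σ i) (σ j) := by
  rw [Matrix.conjTranspose_permMatrix, PEquiv.toMatrix_toPEquiv_mul,
    PEquiv.mul_toMatrix_toPEquiv]
  simp [Equiv.Perm.inv_def]

lemma secondMoment_perm (σ : Equiv.Perm n) (i j k l : n) :
    secondMoment (σ i) (σ j) (σ k) (σ l) = secondMoment i j k l := by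
  have := integral_conj (permUnitary σ) fun A => A i j * A k l
  simpa only [permUnitary, permMatrix_conj, secondMoment] using this

/-- The diagonal unitary matrix with phases `u`. -/
def phaseUnitary (u : n → ℂ) (hu : ∀ i, u i * (starRingEnd ℂ) (u i) = 1) :
    Matrix.unitaryGroup n ℂ :=
  ⟨Matrix.diagonal u, by
    rw [Matrix.mem_unitaryGroup_iff, Matrix.star_eq_conjTranspose,
      Matrix.diagonal_conjTranspose, Matrix.diagonal_mul_diagonal, ← Matrix.diagonal_one]
    congr 1
    ext i
    exact hu i⟩

lemma diagonal_conj (u : n → ℂ) (A : Matrix n n ℂ) (i j : n) :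
    (Matrix.diagonal u * A * (Matrix.diagonal u)ᴴ) i j =
      u i * A i j * (starRingEnd ℂ) (u j) := by
  simp [Matrix.diagonal_conjTranspose]

lemma secondMoment_sq_eq_zero {k l : n} (hkl : k ≠ l) : secondMoment k l k l = 0 := by
  -- The phase `i` on the level `k` changes the sign of the moment.
  let u : n → ℂ := fun i => if i = k then Complex.I else 1
  have hu : ∀ i, u i * (starRingEnd ℂ) (u i) = 1 := by
    intro i
    by_cases h : i = k <;> simp [u, h]
  have := integral_conj (phaseUnitary u hu) fun A => A k l * A k l
  simp only [phaseUnitary, diagonal_conj] at this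
  have e : ∀ p : Matrix.unitaryGroup n ℂ × (n → ℝ),
      u k * interaction p k l * (starRingEnd ℂ) (u l) *
        (u k * interaction p k l * (starRingEnd ℂ) (u l)) =
      -(interaction p k l * interaction p k l) := by
    intro p
    have h1 : u k = Complex.I := by simp [u]
    have h2 : u l = 1 := by simp [u, hkl.symm]
    rw [h1, h2]
    simp only [map_one]
    linear_combination interaction p k l * interaction p k l * Complex.I_mul_I
  simp_rw [e, integral_neg] at this
  change -secondMoment k l k l = secondMoment k l k l at this
  linear_combination (-1 / 2 : ℂ) * this

lemma inv_sqrt_two_mul_self : ((Real.sqrt 2 : ℂ)⁻¹) * ((Real.sqrt 2 : ℂ)⁻¹) = 1 / 2 := by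
  rw [← mul_inv, ← Complex.ofReal_mul, Real.mul_self_sqrt (by norm_num)]
  norm_num

/-- `(1 + s P) / √2` for the matrix `P` that swaps the levels `k` and `l`, and `s = ± i`. -/
def mixUnitary (k l : n) (s : ℂ) (hs : s * s = -1) (hs' : (starRingEnd ℂ) s = -s) :
    Matrix.unitaryGroup n ℂ :=
  ⟨((Real.sqrt 2 : ℂ)⁻¹) • (1 + s • (Equiv.swap k l).permMatrix ℂ), by
    have hP : (Equiv.swap k l).permMatrix ℂ * (Equiv.swap k l).permMatrix ℂ = 1 := by
      rw [← Matrix.permMatrix_mul, Equiv.swap_mul_self, Matrix.permMatrix_one]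
    rw [Matrix.mem_unitaryGroup_iff, Matrix.star_eq_conjTranspose, Matrix.conjTranspose_smul,
      Matrix.conjTranspose_add, Matrix.conjTranspose_smul, Matrix.conjTranspose_permMatrix,
      Equiv.swap_inv, Matrix.conjTranspose_one, RCLike.star_def, hs', map_inv₀,
      Complex.conj_ofReal, Matrix.smul_mul, Matrix.mul_smul, smul_smul,
      inv_sqrt_two_mul_self, Matrix.add_mul,
      Matrix.one_mul, Matrix.mul_add, Matrix.mul_one, Matrix.smul_mul, Matrix.mul_smul, hP,
      smul_smul, mul_neg, hs]
    module⟩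

lemma mixUnitary_conj {k l : n} {s : ℂ} (hs : s * s = -1) (hs' : (starRingEnd ℂ) s = -s)
    (A : Matrix n n ℂ) :
    ((mixUnitary k l s hs hs' : Matrix n n ℂ) * A * (mixUnitary k l s hs hs' : Matrix n n ℂ)ᴴ)
      k k = 1 / 2 * (A k k + A l l + s * (A l k - A k l)) := by
  simp only [mixUnitary]
  rw [Matrix.conjTranspose_smul,
      Matrix.conjTranspose_add, Matrix.conjTranspose_smul, Matrix.conjTranspose_permMatrix,
      Equiv.swap_inv, Matrix.conjTranspose_one, RCLike.star_def, hs', map_inv₀,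
      Complex.conj_ofReal, Matrix.smul_mul, Matrix.mul_smul, Matrix.smul_mul, smul_smul,
      inv_sqrt_two_mul_self,
      Matrix.add_mul, Matrix.one_mul, Matrix.mul_add, Matrix.mul_one, Matrix.smul_mul,
      Matrix.mul_smul, PEquiv.toMatrix_toPEquiv_mul, PEquiv.mul_toMatrix_toPEquiv]
  simp only [Matrix.smul_apply, Matrix.add_apply, Matrix.submatrix_apply, id_eq, smul_eq_mul,
    Equiv.symm_swap, Equiv.swap_apply_left]
  linear_combination (-1 / 2 : ℂ) * A l l * hs

/-- Invariance under the mixing of two levels. -/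
lemma secondMoment_diag_eq {k l : n} (hkl : k ≠ l) :
    secondMoment k k k k = secondMoment k k l l + secondMoment k l l k := by
  have : Nonempty n := ⟨k⟩
  have key : ∀ s : ℂ, s * s = -1 → (starRingEnd ℂ) s = -s →
      ∫ p, (1 / 2 * (interaction p k k + interaction p l l +
        s * (interaction p l k - interaction p k l))) *
        (1 / 2 * (interaction p k k + interaction p l l +
        s * (interaction p l k - interaction p k l))) ∂(interactionLaw n) =
      secondMoment k k k k := by
    intro s hs hs'
    have := integral_conj (mixUnitary k l s hs hs') fun A => A k k * A k k
    simpa only [mixUnitary_conj, secondMoment] using this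
  have hI := key Complex.I (by simp) (by simp)
  have hI' := key (-Complex.I) (by simp) (by simp)
  have ii := fun a b c e : n => integrable_entry_mul (n := n) a b c e
  -- The cross terms cancel between the two signs.
  have hsum : ∫ p, (1 / 2 * (interaction p k k * interaction p k k +
      interaction p l l * interaction p l l) + (interaction p k k * interaction p l l +
      interaction p k l * interaction p l k) -
      1 / 2 * (interaction p l k * interaction p l k + interaction p k l * interaction p k l))
      ∂(interactionLaw n) = secondMoment k k k k + secondMoment k k k k := by
    conv_rhs => rw [← hI]
    conv_rhs => enter [2]; rw [hI, ← hI']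
    rw [← integral_add]
    · congr 1
      ext p
      linear_combination (-1 / 2 : ℂ) * (interaction p l k - interaction p k l) ^ 2 *
        Complex.I_mul_I
    all_goals
    · have hexp : ∀ s : ℂ, Integrable (fun p => (1 / 2 * (interaction p k k + interaction p l l +
          s * (interaction p l k - interaction p k l))) *
          (1 / 2 * (interaction p k k + interaction p l l +
          s * (interaction p l k - interaction p k l)))) (interactionLaw n) := by
        intro s
        have h1 := ((((ii k k k k).add (ii l l l l)).add ((ii k k l l).const_mul 2)).add
          ((((ii k k l k).add (ii l l l k)).sub
            ((ii k k k l).add (ii l l k l))).const_mul (2 * s))).add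
          ((((ii l k l k).add (ii k l k l)).sub ((ii l k k l).const_mul 2)).const_mul (s * s))
        refine (h1.const_mul (1 / 4)).congr (Eventually.of_forall fun p => ?_)
        simp only [Pi.add_apply, Pi.sub_apply]
        ring
      exact hexp _
  rw [integral_sub, integral_add, integral_const_mul, integral_add (ii _ _ _ _) (ii _ _ _ _),
    integral_add (ii _ _ _ _) (ii _ _ _ _), integral_const_mul,
    integral_add (ii _ _ _ _) (ii _ _ _ _)] at hsum
  rotate_left
  · exact ((ii _ _ _ _).add (ii _ _ _ _)).const_mul _
  · exact (ii _ _ _ _).add (ii _ _ _ _)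
  · exact (((ii _ _ _ _).add (ii _ _ _ _)).const_mul _).add ((ii _ _ _ _).add (ii _ _ _ _))
  · exact ((ii _ _ _ _).add (ii _ _ _ _)).const_mul _
  change 1 / 2 * (secondMoment k k k k + secondMoment l l l l) +
    (secondMoment k k l l + secondMoment k l l k) -
    1 / 2 * (secondMoment l k l k + secondMoment k l k l) = _ at hsum
  have hl : secondMoment l l l l = secondMoment k k k k := by
    simpa using secondMoment_perm (Equiv.swap k l) k k k k
  rw [secondMoment_sq_eq_zero hkl, secondMoment_sq_eq_zero hkl.symm, hl] at hsum
  linear_combination -hsum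

lemma exists_perm {n : Type} {k l k' l' : n} (h : k ≠ l) (h' : k' ≠ l') :
    ∃ σ : Equiv.Perm n, σ k = k' ∧ σ l = l' :=
  MulAction.is_two_pretransitive_iff.mp (Equiv.Perm.isMultiplyPretransitive n 2) h h'

lemma sum_diag_sq_gaussian :
    ∫ p, ∑ i, p.2 i * p.2 i ∂(interactionLaw n) = Fintype.card n := by
  have h2 : ∫ x, |x| ^ 2 ∂(gaussianReal 0 1) = 1 := by
    have h := variance_id_gaussianReal (μ := 0) (v := 1)
    rw [variance_eq_integral aemeasurable_id] at h
    simpa using h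
  have : ∀ p : Matrix.unitaryGroup n ℂ × (n → ℝ), ∑ i, p.2 i * p.2 i = ∑ i, |p.2 i| ^ 2 :=
    fun p => Finset.sum_congr rfl fun i _ => by rw [sq_abs, sq]
  simp_rw [this]
  rw [integral_finsetSum _ fun i _ => integrable_abs_pow 2 i]
  simp only [integral_abs_pow, h2]
  simp

lemma diag_sum_sq_gaussian :
    ∫ p, (∑ i, p.2 i) * (∑ i, p.2 i) ∂(interactionLaw n) = Fintype.card n := by
  unfold interactionLaw
  rw [integral_fun_snd (fun D : n → ℝ => (∑ i, D i) * (∑ i, D i)), probReal_univ, one_smul]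
  have hL : ∀ i : n, MemLp (id : ℝ → ℝ) 2 (gaussianReal 0 1) := fun _ => memLp_id_gaussianReal 2
  have hv := variance_sum_pi (ι := n) (μ := fun _ => gaussianReal 0 1) (X := fun _ => id) hL
  simp only [variance_id_gaussianReal] at hv
  have hmean : ∫ D : n → ℝ, (∑ i, D i) ∂(Measure.pi fun _ => gaussianReal 0 1) = 0 := by
    rw [integral_finsetSum]
    · refine Finset.sum_eq_zero fun i _ => ?_
      have h := measurePreserving_eval (fun _ : n => gaussianReal 0 1) i
      have := integral_map (μ := Measure.pi fun _ : n => gaussianReal 0 1) h.measurable.aemeasurable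
        (f := fun x : ℝ => x)
        (Continuous.aestronglyMeasurable (by fun_prop))
      rw [h.map_eq, integral_id_gaussianReal] at this
      exact this.symm
    · intro i _
      exact (measurePreserving_eval (fun _ : n => gaussianReal 0 1) i).integrable_comp_of_integrable
        ((memLp_id_gaussianReal 1).integrable le_rfl)
  rw [variance_eq_integral (by fun_prop)] at hv
  simp only [Finset.sum_apply, id_eq, hmean, sub_zero, sq] at hv
  simpa using hv

lemma trace_interaction (p : Matrix.unitaryGroup n ℂ × (n → ℝ)) :
    ∑ i, interaction p i i = ((∑ i, p.2 i : ℝ) : ℂ) := by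
  have : (interaction p).trace = ∑ i, (p.2 i : ℂ) := by
    rw [interaction, Matrix.trace_mul_comm, ← Matrix.mul_assoc, unitary_conjTranspose_mul,
      Matrix.one_mul, Matrix.trace_diagonal]
  simpa [Matrix.trace] using this

lemma trace_interaction_sq (p : Matrix.unitaryGroup n ℂ × (n → ℝ)) :
    ∑ i, ∑ j, interaction p i j * interaction p j i = ((∑ i, p.2 i * p.2 i : ℝ) : ℂ) := by
  have : (interaction p * interaction p).trace = ∑ i, (p.2 i * p.2 i : ℂ) := by
    set U := (p.1 : Matrix n n ℂ)
    set D := Matrix.diagonal fun i => (p.2 i : ℂ)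
    have e : interaction p * interaction p = U * (D * D * Uᴴ) := by
      calc interaction p * interaction p = U * D * (Uᴴ * U) * D * Uᴴ := by
            simp only [interaction, Matrix.mul_assoc, U, D]
        _ = _ := by
            rw [unitary_conjTranspose_mul, Matrix.mul_one]; simp only [Matrix.mul_assoc]
    rw [e, Matrix.trace_mul_comm, Matrix.mul_assoc, unitary_conjTranspose_mul, Matrix.mul_one,
      Matrix.diagonal_mul_diagonal, Matrix.trace_diagonal]
  simpa [Matrix.trace, Matrix.mul_apply] using this

/-- The variance of an off-diagonal entry of the interaction. Invariance leaves the three moments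
`E[G k k ^ 2] = E[G k k * G l l] + E[|G k l| ^ 2]`, and the traces of `D` and `D ^ 2` determine
them. -/
lemma secondMoment_offdiag {k l : n} (hkl : k ≠ l) :
    secondMoment k l l k = 1 / (Fintype.card n + 1) := by
  have : Nonempty n := ⟨k⟩
  set N : ℂ := (Fintype.card n : ℂ) with hN
  set a := secondMoment k k k k with ha
  set b := secondMoment k k l l with hb
  set c := secondMoment k l l k with hc
  have ea : ∀ i : n, secondMoment i i i i = a := by
    intro i
    simpa using secondMoment_perm (Equiv.swap k i) k k k k
  have eb : ∀ i j : n, i ≠ j → secondMoment i i j j = b := by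
    intro i j hij
    obtain ⟨σ, rfl, rfl⟩ := exists_perm hkl hij
    exact secondMoment_perm σ k k l l
  have ec : ∀ i j : n, i ≠ j → secondMoment i j j i = c := by
    intro i j hij
    obtain ⟨σ, rfl, rfl⟩ := exists_perm hkl hij
    exact secondMoment_perm σ k l l k
  have count : ∀ x y : ℂ, ∀ i : n, ∑ j, (if i = j then x else y) = x + (N - 1) * y := by
    intro x y i
    rw [← Finset.add_sum_erase _ _ (Finset.mem_univ i), if_pos rfl]
    congr 1
    rw [Finset.sum_congr rfl (g := fun _ => y) fun j hj => if_neg (Finset.ne_of_mem_erase hj).symm]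
    rw [Finset.sum_const, Finset.card_erase_of_mem (Finset.mem_univ i), Finset.card_univ,
      nsmul_eq_mul, Nat.cast_sub Fintype.card_pos]
    simp [hN]
  have h1 : N * (a + (N - 1) * b) = N := by
    have e1 : ∫ p, (∑ i, interaction p i i) * (∑ j, interaction p j j) ∂(interactionLaw n) = N := by
      simp_rw [trace_interaction, ← Complex.ofReal_mul]
      rw [integral_complex_ofReal, diag_sum_sq_gaussian]
      simp [hN]
    simp_rw [Finset.sum_mul_sum] at e1
    rw [integral_finsetSum _ fun i _ =>
      integrable_finsetSum _ fun j _ => integrable_entry_mul ..] at e1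
    simp_rw [integral_finsetSum _ fun j _ => integrable_entry_mul ..] at e1
    have e2 : ∀ i j, ∫ p, interaction p i i * interaction p j j ∂(interactionLaw n) =
        if i = j then a else b := by
      intro i j
      by_cases hij : i = j
      · subst hij; rw [if_pos rfl]; exact ea i
      · rw [if_neg hij]; exact eb i j hij
    simp_rw [e2, count] at e1
    rwa [Finset.sum_const, Finset.card_univ, nsmul_eq_mul] at e1
  have h2 : N * (a + (N - 1) * c) = N := by
    have e1 : ∫ p, ∑ i, ∑ j, interaction p i j * interaction p j i ∂(interactionLaw n) = N := by
      simp_rw [trace_interaction_sq]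
      rw [integral_complex_ofReal, sum_diag_sq_gaussian]
      simp [hN]
    rw [integral_finsetSum _ fun i _ =>
      integrable_finsetSum _ fun j _ => integrable_entry_mul ..] at e1
    simp_rw [integral_finsetSum _ fun j _ => integrable_entry_mul ..] at e1
    have e2 : ∀ i j, ∫ p, interaction p i j * interaction p j i ∂(interactionLaw n) =
        if i = j then a else c := by
      intro i j
      by_cases hij : i = j
      · subst hij; rw [if_pos rfl]; exact ea i
      · rw [if_neg hij]; exact ec i j hij
    simp_rw [e2, count] at e1
    rwa [Finset.sum_const, Finset.card_univ, nsmul_eq_mul] at e1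
  have h3 : a = b + c := secondMoment_diag_eq hkl
  have hN0 : N ≠ 0 := by simp [hN]
  have hcard : 2 ≤ Fintype.card n := Fintype.one_lt_card_iff.mpr ⟨k, l, hkl⟩
  have hN1 : N - 1 ≠ 0 := by
    rw [sub_ne_zero, hN]
    exact_mod_cast (by omega : Fintype.card n ≠ 1)
  have hN2 : N + 1 ≠ 0 := by
    rw [hN]
    exact_mod_cast (Nat.succ_ne_zero (Fintype.card n))
  have hbc : b = c := by
    have : N * (N - 1) * (b - c) = 0 := by linear_combination h1 - h2
    simpa [hN0, hN1, sub_eq_zero] using this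
  rw [eq_div_iff hN2]
  have : N * (c * (N + 1) - 1) = 0 := by
    rw [h3, hbc] at h1
    linear_combination h1
  simpa [hN0, sub_eq_zero] using this

/-- Every off-diagonal entry of the interaction has variance `1 / (dim + 1)`. -/
lemma integral_norm_sq_offdiag {k l : n} (hkl : k ≠ l) :
    ∫ p, ‖interaction p k l‖ ^ 2 ∂(interactionLaw n) = 1 / (Fintype.card n + 1) := by
  have h := secondMoment_offdiag hkl
  have e : ∀ p : Matrix.unitaryGroup n ℂ × (n → ℝ),
      interaction p k l * interaction p l k = ((‖interaction p k l‖ ^ 2 : ℝ) : ℂ) := by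
    intro p
    rw [← (interaction_isHermitian p).apply k l, ← Complex.normSq_eq_norm_sq,
      ← Complex.normSq_conj, ← Complex.mul_conj]
    simp [mul_comm]
  simp_rw [secondMoment, e] at h
  rw [integral_complex_ofReal] at h
  refine Complex.ofReal_injective (h.trans ?_)
  push_cast
  rfl

end Moments

/-! ### Perturbation theory for the evolution -/

section Perturbation

open scoped Matrix.Norms.L2Operator

variable {n : Type} [Fintype n] [DecidableEq n]

lemma sum_norm_sq_col_le (A : Matrix n n ℂ) (l : n) : ∑ k, ‖A k l‖ ^ 2 ≤ ‖A‖ ^ 2 := by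
  have h := Matrix.l2_opNorm_mulVec A (EuclideanSpace.single l (1 : ℂ))
  rw [PiLp.norm_single, norm_one, mul_one] at h
  have h2 := pow_le_pow_left₀ (norm_nonneg _) h 2
  rw [EuclideanSpace.norm_sq_eq] at h2
  simpa using h2

/-- The propagator `e^{i s A}`. -/
def propagator (A : Matrix n n ℂ) (s : ℝ) : Matrix n n ℂ :=
  NormedSpace.exp (s • (Complex.I • A))

lemma propagator_zero (A : Matrix n n ℂ) : propagator A 0 = 1 := by
  simp [propagator]

lemma hasDerivAt_propagator (A : Matrix n n ℂ) (s : ℝ) :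
    HasDerivAt (propagator A) (propagator A s * (Complex.I • A)) s :=
  hasDerivAt_exp_smul_const (Complex.I • A) s

lemma hasDerivAt_propagator' (A : Matrix n n ℂ) (s : ℝ) :
    HasDerivAt (propagator A) ((Complex.I • A) * propagator A s) s :=
  hasDerivAt_exp_smul_const' (Complex.I • A) s

lemma conjTranspose_propagator {A : Matrix n n ℂ} (hA : A.IsHermitian) (s : ℝ) :
    (propagator A s)ᴴ = propagator A (-s) := by
  rw [propagator, ← Matrix.exp_conjTranspose, propagator]
  congr 1
  rw [Matrix.conjTranspose_smul, Matrix.conjTranspose_smul, hA.eq]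
  simp

lemma propagator_neg_mul (A : Matrix n n ℂ) (s : ℝ) : propagator A (-s) * propagator A s = 1 := by
  rw [propagator, propagator, ← Matrix.exp_add_of_commute]
  · simp
  · rw [neg_smul]
    exact (Commute.refl _).neg_left

/-- The propagator of a Hermitian matrix as a unitary matrix. -/
def propagatorUnitary {A : Matrix n n ℂ} (hA : A.IsHermitian) (s : ℝ) : Matrix.unitaryGroup n ℂ :=
  ⟨propagator A s, by
    rw [Matrix.mem_unitaryGroup_iff', Matrix.star_eq_conjTranspose, conjTranspose_propagator hA,
      propagator_neg_mul]⟩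

lemma norm_propagator_mul {A : Matrix n n ℂ} (hA : A.IsHermitian) (s : ℝ) (B : Matrix n n ℂ) :
    ‖propagator A s * B‖ = ‖B‖ :=
  CStarRing.norm_coe_unitary_mul (propagatorUnitary hA s) B

lemma norm_mul_propagator {A : Matrix n n ℂ} (hA : A.IsHermitian) (s : ℝ) (B : Matrix n n ℂ) :
    ‖B * propagator A s‖ = ‖B‖ :=
  CStarRing.norm_mul_coe_unitary B (propagatorUnitary hA s)

/-- A diagonal Hamiltonian with real energies. -/
def diagHam (h : n → ℝ) : Matrix n n ℂ := Matrix.diagonal fun k => (h k : ℂ)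

lemma diagHam_isHermitian {n : Type} [DecidableEq n] (h : n → ℝ) : (diagHam h).IsHermitian := by
  unfold diagHam
  rw [Matrix.isHermitian_diagonal_iff]
  intro i
  simp [IsSelfAdjoint]

lemma propagator_diagHam (h : n → ℝ) (s : ℝ) :
    propagator (diagHam h) s = Matrix.diagonal fun k => Complex.exp (Complex.I * (s * h k)) := by
  rw [propagator, diagHam, ← Matrix.diagonal_smul, ← Matrix.diagonal_smul, Matrix.exp_diagonal]
  congr 1
  ext k
  rw [Pi.coe_exp, Complex.exp_eq_exp_ℂ]
  congr 1
  simp only [Pi.smul_apply, Complex.real_smul, smul_eq_mul]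
  ring

/-- The oscillating integral `∫₀ˢ e^{-i w u} du`. -/
def phaseIntegral (w s : ℝ) : ℂ := ∫ u in (0 : ℝ)..s, Complex.exp (Complex.I * (-(u * w) : ℝ))

lemma hasDerivAt_phaseIntegral (w s : ℝ) :
    HasDerivAt (phaseIntegral w) (Complex.exp (Complex.I * (-(s * w) : ℝ))) s := by
  have hc : Continuous fun u : ℝ => Complex.exp (Complex.I * (-(u * w) : ℝ)) := by fun_prop
  exact intervalIntegral.integral_hasDerivAt_right (hc.intervalIntegrable _ _)
    (hc.stronglyMeasurableAtFilter _ _) hc.continuousAt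

lemma norm_phaseIntegral (w : ℝ) {t : ℝ} (ht : 0 ≤ t) :
    ‖phaseIntegral w t‖ = t * |Real.sinc (w * t / 2)| := by
  unfold phaseIntegral
  by_cases hw : w = 0
  · simp [hw, abs_of_nonneg ht]
  by_cases ht0 : t = 0
  · simp [ht0]
  have e : ∀ u : ℝ, Complex.exp (Complex.I * (-(u * w) : ℝ)) =
      Complex.exp ((-Complex.I * w) * u) := by
    intro u; congr 1; push_cast; ring
  have hc : (-Complex.I * w : ℂ) ≠ 0 := by simp [hw]
  simp_rw [e]
  rw [integral_exp_mul_complex hc]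
  have e2 : (-Complex.I * w : ℂ) * t = Complex.I * ((-(t * w) : ℝ) : ℂ) := by push_cast; ring
  rw [e2, Complex.ofReal_zero, mul_zero, Complex.exp_zero, norm_div,
    Complex.norm_exp_I_mul_ofReal_sub_one, Real.sinc_of_ne_zero (by positivity)]
  rw [show -(t * w) / 2 = -(w * t / 2) by ring, Real.sin_neg]
  simp only [norm_mul, norm_neg, Complex.norm_I, one_mul, Complex.norm_real, Real.norm_eq_abs,
    mul_neg, abs_mul, abs_div, abs_of_nonneg ht, abs_two]
  have := abs_pos.mpr hw
  have := lt_of_le_of_ne ht (Ne.symm ht0)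
  field_simp

/-- The propagator of the perturbed Hamiltonian in the interaction picture. -/
def dressed (h : n → ℝ) (α : ℝ) (G : Matrix n n ℂ) (s : ℝ) : Matrix n n ℂ :=
  propagator (diagHam h) (-s) * propagator (diagHam h + (α : ℂ) • G) s

/-- The first-order term of the Dyson series, up to the factor `i α`. -/
def dysonFirst (h : n → ℝ) (G : Matrix n n ℂ) (s : ℝ) : Matrix n n ℂ :=
  ∑ k, ∑ l, phaseIntegral (h k - h l) s • Matrix.single k l (G k l)

lemma dysonFirst_apply (h : n → ℝ) (G : Matrix n n ℂ) (s : ℝ) (k l : n) :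
    dysonFirst h G s k l = phaseIntegral (h k - h l) s * G k l := by
  have e : dysonFirst h G s = Matrix.of fun k l => phaseIntegral (h k - h l) s * G k l := by
    conv_rhs => rw [Matrix.matrix_eq_sum_single (Matrix.of _)]
    simp [dysonFirst, Matrix.smul_single]
  rw [e, Matrix.of_apply]

lemma hasDerivAt_dysonFirst (h : n → ℝ) (G : Matrix n n ℂ) (s : ℝ) :
    HasDerivAt (dysonFirst h G)
      (propagator (diagHam h) (-s) * G * propagator (diagHam h) s) s := by
  have hd : HasDerivAt (dysonFirst h G) (∑ k, ∑ l,
      Complex.exp (Complex.I * (-(s * (h k - h l)) : ℝ)) • Matrix.single k l (G k l)) s :=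
    HasDerivAt.fun_sum fun k _ => HasDerivAt.fun_sum fun l _ =>
      (hasDerivAt_phaseIntegral (h k - h l) s).smul_const _
  convert hd using 1
  conv_lhs => rw [Matrix.matrix_eq_sum_single
    (propagator (diagHam h) (-s) * G * propagator (diagHam h) s)]
  refine Finset.sum_congr rfl fun k _ => Finset.sum_congr rfl fun l _ => ?_
  rw [Matrix.smul_single, propagator_diagHam, propagator_diagHam, Matrix.mul_diagonal,
    Matrix.diagonal_mul, smul_eq_mul]
  congr 1
  have : Complex.exp (Complex.I * (-(s * (h k - h l)) : ℝ)) =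
      Complex.exp (Complex.I * ((-s : ℝ) * h k)) * Complex.exp (Complex.I * (s * h l)) := by
    rw [← Complex.exp_add]; congr 1; push_cast; ring
  rw [this]
  ring

variable {h : n → ℝ} {α t : ℝ} {G : Matrix n n ℂ}

lemma perturbed_isHermitian {n : Type} [DecidableEq n] {h : n → ℝ} {α : ℝ} {G : Matrix n n ℂ}
    (hG : G.IsHermitian) : (diagHam h + (α : ℂ) • G).IsHermitian := by
  refine (diagHam_isHermitian h).add ?_
  rw [Matrix.IsHermitian, Matrix.conjTranspose_smul, hG.eq]
  simp

lemma hasDerivAt_dressed (s : ℝ) : HasDerivAt (dressed h α G)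
    (propagator (diagHam h) (-s) * ((Complex.I * α) • G) *
      propagator (diagHam h + (α : ℂ) • G) s) s := by
  have h1 : HasDerivAt (fun s => propagator (diagHam h) (-s))
      (-(propagator (diagHam h) (-s) * (Complex.I • diagHam h))) s := by
    have := (hasDerivAt_propagator (diagHam h) (-s)).scomp s (hasDerivAt_neg s)
    rw [neg_smul, one_smul] at this
    exact this
  have h2 := h1.mul (hasDerivAt_propagator' (diagHam h + (α : ℂ) • G) s)
  refine h2.congr_deriv ?_
  rw [smul_add, smul_smul, ← Matrix.mul_assoc (propagator (diagHam h) (-s)), ← Matrix.add_mul,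
    Matrix.mul_add]
  congr 1
  abel

lemma norm_dressed_sub_one_le (hG : G.IsHermitian) (hα : 0 ≤ α) {s : ℝ} (hs : s ∈ Set.Icc 0 t) :
    ‖dressed h α G s - 1‖ ≤ α * ‖G‖ * t := by
  have h0 : dressed h α G 0 = 1 := by simp [dressed, propagator_zero]
  have := norm_image_sub_le_of_norm_deriv_le_segment' (f := dressed h α G) (C := α * ‖G‖)
    (a := 0) (b := t) (fun x _ => (hasDerivAt_dressed x).hasDerivWithinAt) (fun x _ => by
      rw [norm_mul_propagator (perturbed_isHermitian hG),
        norm_propagator_mul (diagHam_isHermitian h), norm_smul]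
      simp [abs_of_nonneg hα]) s hs
  rw [h0, sub_zero] at this
  exact this.trans (by gcongr; exact hs.2)

/-- The second-order remainder of the Dyson series: the derivative of the left side is
`i α U₀⁻¹ G U₀ (W - 1)` for the free propagator `U₀` and `W` the dressed one, and `W - 1` is of
first order. -/
lemma norm_dyson_remainder_le (hG : G.IsHermitian) (hα : 0 ≤ α) (ht : 0 ≤ t) :
    ‖dressed h α G t - (Complex.I * α) • dysonFirst h G t - 1‖ ≤ (α * t * ‖G‖) ^ 2 := by
  have h0 : dressed h α G 0 = 1 := by simp [dressed, propagator_zero]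
  have h1 : dysonFirst h G 0 = 0 := by simp [dysonFirst, phaseIntegral]
  have := norm_image_sub_le_of_norm_deriv_le_segment'
    (f := fun s => dressed h α G s - (Complex.I * α) • dysonFirst h G s)
    (f' := fun s => propagator (diagHam h) (-s) * ((Complex.I * α) • G) *
      propagator (diagHam h + (α : ℂ) • G) s -
      (Complex.I * α) • (propagator (diagHam h) (-s) * G * propagator (diagHam h) s))
    (C := α * ‖G‖ * (α * ‖G‖ * t)) (a := 0) (b := t)
    (fun x _ => ((hasDerivAt_dressed x).fun_sub
      ((hasDerivAt_dysonFirst h G x).fun_const_smul _)).hasDerivWithinAt) (fun x hx => by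
      have e : propagator (diagHam h) (-x) * ((Complex.I * α) • G) *
          propagator (diagHam h + (α : ℂ) • G) x -
          (Complex.I * α) • (propagator (diagHam h) (-x) * G * propagator (diagHam h) x) =
          propagator (diagHam h) (-x) * ((Complex.I * α) • G * (propagator (diagHam h) x *
            (dressed h α G x - 1))) := by
        have e1 : propagator (diagHam h) x * dressed h α G x =
            propagator (diagHam h + (α : ℂ) • G) x := by
          have := propagator_neg_mul (diagHam h) (-x)
          rw [neg_neg] at this
          rw [dressed, ← Matrix.mul_assoc, this, Matrix.one_mul]
        rw [Matrix.mul_sub, e1, Matrix.mul_one, Matrix.mul_sub, Matrix.mul_sub]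
        simp only [Matrix.mul_smul, Matrix.smul_mul, Matrix.mul_assoc]
      rw [e, norm_propagator_mul (diagHam_isHermitian h)]
      refine (norm_mul_le _ _).trans ?_
      rw [norm_propagator_mul (diagHam_isHermitian h), norm_smul]
      refine mul_le_mul ?_ (norm_dressed_sub_one_le hG hα ⟨hx.1, hx.2.le⟩) (norm_nonneg _)
        (by positivity)
      simp [abs_of_nonneg hα]) t ⟨ht, le_rfl⟩
  simp only [h0, h1, smul_zero, sub_zero] at this
  exact this.trans_eq (by ring)

lemma abs_norm_add_sq_sub_le (a b : ℂ) :
    |‖a + b‖ ^ 2 - ‖a‖ ^ 2| ≤ 2 * (‖a‖ * ‖b‖) + ‖b‖ ^ 2 := by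
  have h1 : ‖a + b‖ ≤ ‖a‖ + ‖b‖ := norm_add_le a b
  have h2 : ‖a‖ ≤ ‖a + b‖ + ‖b‖ := by simpa using norm_sub_le (a + b) b
  have h3 : ‖b‖ ≤ ‖a + b‖ + ‖a‖ := by simpa using norm_sub_le (a + b) a
  have := norm_nonneg a
  have := norm_nonneg b
  have := norm_nonneg (a + b)
  rw [abs_le]
  constructor
  · rcases le_total ‖a‖ ‖b‖ with h | h
    · nlinarith
    · nlinarith [mul_self_le_mul_self (sub_nonneg.mpr h) (by linarith : ‖a‖ - ‖b‖ ≤ ‖a + b‖)]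
  · nlinarith

/-- Fermi's golden rule with an error bound: the total error of the first-order transition
probabilities out of a level is of third order in `α t ‖G‖`. -/
lemma sum_abs_transition_sub_le (hG : G.IsHermitian) (hα : 0 ≤ α) (ht : 0 ≤ t) (l : n)
    (s : Finset n) (hs : l ∉ s) :
    ∑ k ∈ s, |‖propagator (diagHam h + (α : ℂ) • G) t k l‖ ^ 2 -
      (α * t) ^ 2 * Real.sinc ((h k - h l) * t / 2) ^ 2 * ‖G k l‖ ^ 2| ≤
      2 * (α * t * ‖G‖) ^ 3 + (α * t * ‖G‖) ^ 4 := by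
  set r := dressed h α G t - (Complex.I * α) • dysonFirst h G t - 1 with hr
  have hrn := norm_dyson_remainder_le (h := h) hG hα ht
  rw [← hr] at hrn
  let a : n → ℂ := fun k => Complex.I * α * dysonFirst h G t k l
  have ha : ∀ k, ‖a k‖ ^ 2 =
      (α * t) ^ 2 * Real.sinc ((h k - h l) * t / 2) ^ 2 * ‖G k l‖ ^ 2 := by
    intro k
    simp only [a, dysonFirst_apply, norm_mul, Complex.norm_I, one_mul, Complex.norm_real,
      Real.norm_eq_abs, norm_phaseIntegral _ ht, mul_pow, sq_abs]
    ring
  have hx : 0 ≤ α * t * ‖G‖ := by positivity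
  have ha2 : ∑ k ∈ s, ‖a k‖ ^ 2 ≤ (α * t * ‖G‖) ^ 2 := by
    calc ∑ k ∈ s, ‖a k‖ ^ 2 ≤ ∑ k, ‖a k‖ ^ 2 :=
          Finset.sum_le_univ_sum_of_nonneg fun k => by positivity
      _ ≤ ∑ k, (α * t) ^ 2 * ‖G k l‖ ^ 2 := by
          refine Finset.sum_le_sum fun k _ => ?_
          rw [ha k]
          have h1 : Real.sinc ((h k - h l) * t / 2) ^ 2 ≤ 1 := by
            rw [sq_le_one_iff_abs_le_one]
            exact Real.abs_sinc_le_one _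
          exact mul_le_mul_of_nonneg_right (mul_le_of_le_one_right (by positivity) h1)
            (by positivity)
      _ ≤ (α * t * ‖G‖) ^ 2 := by
          rw [← Finset.mul_sum, mul_pow (α * t)]
          exact mul_le_mul_of_nonneg_left (sum_norm_sq_col_le G l) (by positivity)
  have hb2 : ∑ k ∈ s, ‖r k l‖ ^ 2 ≤ ((α * t * ‖G‖) ^ 2) ^ 2 := by
    calc ∑ k ∈ s, ‖r k l‖ ^ 2 ≤ ∑ k, ‖r k l‖ ^ 2 :=
          Finset.sum_le_univ_sum_of_nonneg fun k => by positivity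
      _ ≤ ‖r‖ ^ 2 := sum_norm_sq_col_le r l
      _ ≤ _ := pow_le_pow_left₀ (norm_nonneg _) hrn 2
  have hcs : ∑ k ∈ s, ‖a k‖ * ‖r k l‖ ≤ (α * t * ‖G‖) ^ 3 := by
    refine le_of_sq_le_sq ?_ (by positivity)
    calc (∑ k ∈ s, ‖a k‖ * ‖r k l‖) ^ 2
        ≤ (∑ k ∈ s, ‖a k‖ ^ 2) * ∑ k ∈ s, ‖r k l‖ ^ 2 := Finset.sum_mul_sq_le_sq_mul_sq _ _ _
      _ ≤ (α * t * ‖G‖) ^ 2 * ((α * t * ‖G‖) ^ 2) ^ 2 := by gcongr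
      _ = _ := by ring
  calc _ ≤ ∑ k ∈ s, (2 * (‖a k‖ * ‖r k l‖) + ‖r k l‖ ^ 2) := by
        refine Finset.sum_le_sum fun k hk => ?_
        have hkl : k ≠ l := fun e => hs (e ▸ hk)
        have e1 : ‖propagator (diagHam h + (α : ℂ) • G) t k l‖ = ‖a k + r k l‖ := by
          have e2 : a k + r k l = dressed h α G t k l := by
            simp [a, hr, Matrix.sub_apply, Matrix.smul_apply, Matrix.one_apply_ne hkl]
          rw [e2, dressed, propagator_diagHam, Matrix.diagonal_mul, norm_mul]
          have : ‖Complex.exp (Complex.I * ((-t : ℝ) * h k))‖ = 1 := by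
            rw [← Complex.ofReal_mul, mul_comm, Complex.norm_exp_ofReal_mul_I]
          rw [this, one_mul]
        rw [e1, ← ha k]
        exact abs_norm_add_sq_sub_le _ _
    _ ≤ _ := by
        rw [Finset.sum_add_distrib, ← Finset.mul_sum]
        have : (α * t * ‖G‖) ^ 4 = ((α * t * ‖G‖) ^ 2) ^ 2 := by ring
        rw [this]
        gcongr

end Perturbation

/-! ### The channel in the eigenbasis -/

section ChannelAnalysis

open scoped Matrix.Norms.L2Operator

lemma evolve_eq {n : Type} [Fintype n] [DecidableEq n] (H : Matrix n n ℂ) (γ α t : ℝ)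
    (X G : Matrix (n × Fin 2) (n × Fin 2) ℂ)
    (hA : (totalHamiltonian H γ + (α : ℂ) • G).IsHermitian) :
    evolve H γ α t X G = propagator (totalHamiltonian H γ + (α : ℂ) • G) t * X *
      (propagator (totalHamiltonian H γ + (α : ℂ) • G) t)ᴴ := by
  rw [conjTranspose_propagator hA, propagator, propagator, evolve]
  have e : ∀ (s : ℝ) (A : Matrix (n × Fin 2) (n × Fin 2) ℂ),
      s • (Complex.I • A) = (Complex.I * (s : ℂ)) • A := by
    intro s A
    rw [← Complex.coe_smul, smul_smul, mul_comm]
  rw [e, e]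
  congr 3
  push_cast
  rw [mul_neg]

lemma totalHamiltonian_isHermitian {n : Type} [Fintype n] [DecidableEq n] {H : Matrix n n ℂ}
    (hH : H.IsHermitian) (γ : ℝ) : (totalHamiltonian H γ).IsHermitian := by
  have hE : (envHamiltonian γ).IsHermitian := by
    ext i j
    fin_cases i <;> fin_cases j <;> simp [envHamiltonian]
  rw [Matrix.IsHermitian, totalHamiltonian, Matrix.conjTranspose_add,
    Matrix.conjTranspose_kronecker, Matrix.conjTranspose_kronecker, hH.eq, hE.eq,
    Matrix.conjTranspose_one, Matrix.conjTranspose_one]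

lemma total_add_isHermitian {n : Type} [Fintype n] [DecidableEq n] {H : Matrix n n ℂ}
    (hH : H.IsHermitian) (γ α : ℝ) {G : Matrix (n × Fin 2) (n × Fin 2) ℂ}
    (hG : G.IsHermitian) : (totalHamiltonian H γ + (α : ℂ) • G).IsHermitian := by
  refine (totalHamiltonian_isHermitian hH γ).add ?_
  rw [Matrix.IsHermitian, Matrix.conjTranspose_smul, hG.eq]
  simp

variable {n : Type} [Fintype n] [DecidableEq n]

lemma integrable_of_norm_le {F : Matrix n n ℂ → ℂ} (hF : Continuous F) {C : ℝ}
    (hC : ∀ p, ‖F (interaction p)‖ ≤ C) :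
    Integrable (fun p => F (interaction p)) (interactionLaw n) :=
  (integrable_const C).mono' (hF.comp continuous_interaction).aestronglyMeasurable
    (Eventually.of_forall hC)

lemma continuous_matrix_exp :
    Continuous (NormedSpace.exp : Matrix n n ℂ → Matrix n n ℂ) :=
  letI : NormedAlgebra ℚ (Matrix n n ℂ) := NormedAlgebra.restrictScalars ℚ ℂ (Matrix n n ℂ)
  NormedSpace.exp_continuous

lemma continuous_propagator (t : ℝ) : Continuous fun A : Matrix n n ℂ => propagator A t :=
  continuous_matrix_exp.comp (by fun_prop)

lemma continuous_evolve (H : Matrix n n ℂ) (γ α t : ℝ) (X : Matrix (n × Fin 2) (n × Fin 2) ℂ) :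
    Continuous (evolve H γ α t X) := by
  unfold evolve
  have h : ∀ c : ℂ, Continuous fun G : Matrix (n × Fin 2) (n × Fin 2) ℂ =>
      NormedSpace.exp (c • (totalHamiltonian H γ + (α : ℂ) • G)) :=
    fun c => continuous_matrix_exp.comp (by fun_prop)
  exact ((h _).matrix_mul continuous_const).matrix_mul (h _)

lemma integrable_evolve {H : Matrix n n ℂ} (hH : H.IsHermitian) (γ α t : ℝ)
    (X : Matrix (n × Fin 2) (n × Fin 2) ℂ) (x y : n × Fin 2) :
    Integrable (fun p => evolve H γ α t X (interaction p) x y) (interactionLaw (n × Fin 2)) := by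
  refine integrable_of_norm_le (F := fun G => evolve H γ α t X G x y)
    ((continuous_evolve H γ α t X).matrix_elem x y) (C := ‖X‖) fun p => ?_
  refine (norm_apply_le _ _ _).trans_eq ?_
  have hA := total_add_isHermitian hH γ α (interaction_isHermitian p)
  rw [evolve_eq _ _ _ _ _ _ hA]
  exact norm_unitary_conj (propagatorUnitary hA t) X

lemma interactionExpectation_conj {F : Matrix n n ℂ → Matrix n n ℂ}
    (hF : ∀ x y, Integrable (fun p => F (interaction p) x y) (interactionLaw n))
    (W : Matrix.unitaryGroup n ℂ) :
    interactionExpectation (fun G => (W : Matrix n n ℂ) *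
      F ((W : Matrix n n ℂ)ᴴ * G * (W : Matrix n n ℂ)) * (W : Matrix n n ℂ)ᴴ) =
      (W : Matrix n n ℂ) * interactionExpectation F * (W : Matrix n n ℂ)ᴴ := by
  ext x y
  simp only [interactionExpectation, Matrix.of_apply]
  have h1 := integral_conj W fun G => ((W : Matrix n n ℂ) *
      F ((W : Matrix n n ℂ)ᴴ * G * (W : Matrix n n ℂ)) * (W : Matrix n n ℂ)ᴴ) x y
  rw [← h1]
  have h2 : ∀ G : Matrix n n ℂ, (W : Matrix n n ℂ)ᴴ * ((W : Matrix n n ℂ) * G *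
      (W : Matrix n n ℂ)ᴴ) * (W : Matrix n n ℂ) = G := by
    intro G
    calc _ = ((W : Matrix n n ℂ)ᴴ * (W : Matrix n n ℂ)) * G *
          ((W : Matrix n n ℂ)ᴴ * (W : Matrix n n ℂ)) := by simp only [Matrix.mul_assoc]
      _ = G := by rw [unitary_conjTranspose_mul, Matrix.one_mul, Matrix.mul_one]
  simp_rw [h2, Matrix.mul_apply, Matrix.of_apply]
  rw [integral_finsetSum]
  · refine Finset.sum_congr rfl fun a _ => ?_
    rw [integral_mul_const]
    congr 1
    rw [integral_finsetSum]
    · simp_rw [integral_const_mul]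
    · exact fun b _ => (hF b a).const_mul _
  · exact fun a _ => (integrable_finsetSum _ fun b _ => (hF b a).const_mul _).mul_const _

/-- `V ⊗ 1` as a unitary matrix. -/
def kronUnitary (V : Matrix.unitaryGroup n ℂ) : Matrix.unitaryGroup (n × Fin 2) ℂ :=
  ⟨(V : Matrix n n ℂ) ⊗ₖ (1 : Matrix (Fin 2) (Fin 2) ℂ), by
    rw [Matrix.mem_unitaryGroup_iff, Matrix.star_eq_conjTranspose, Matrix.conjTranspose_kronecker,
      ← Matrix.mul_kronecker_mul, unitary_mul_conjTranspose, Matrix.conjTranspose_one,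
      Matrix.mul_one, Matrix.one_kronecker_one]⟩

lemma kronUnitary_conj (V : Matrix.unitaryGroup n ℂ) (A : Matrix n n ℂ)
    (B : Matrix (Fin 2) (Fin 2) ℂ) :
    (kronUnitary V : Matrix (n × Fin 2) (n × Fin 2) ℂ) * (A ⊗ₖ B) *
      (kronUnitary V : Matrix (n × Fin 2) (n × Fin 2) ℂ)ᴴ =
      ((V : Matrix n n ℂ) * A * (V : Matrix n n ℂ)ᴴ) ⊗ₖ B := by
  simp only [kronUnitary]
  rw [Matrix.conjTranspose_kronecker, ← Matrix.mul_kronecker_mul, ← Matrix.mul_kronecker_mul,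
    Matrix.conjTranspose_one, Matrix.mul_one, Matrix.one_mul]

lemma traceEnv_conj (V : Matrix.unitaryGroup n ℂ) (Y : Matrix (n × Fin 2) (n × Fin 2) ℂ) :
    traceEnv ((kronUnitary V : Matrix (n × Fin 2) (n × Fin 2) ℂ) * Y *
      (kronUnitary V : Matrix (n × Fin 2) (n × Fin 2) ℂ)ᴴ) =
      (V : Matrix n n ℂ) * traceEnv Y * (V : Matrix n n ℂ)ᴴ := by
  ext i j
  simp only [traceEnv, kronUnitary, Matrix.conjTranspose_kronecker, Matrix.conjTranspose_one,
    Matrix.of_apply, Matrix.mul_apply, Fintype.sum_prod_type, Fin.sum_univ_two,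
    Matrix.kroneckerMap_apply]
  simp only [Matrix.one_apply_eq, Matrix.one_apply_ne (zero_ne_one : (0 : Fin 2) ≠ 1),
    Matrix.one_apply_ne (one_ne_zero : (1 : Fin 2) ≠ 0), mul_one, mul_zero, zero_mul, add_zero,
    zero_add]
  rw [← Finset.sum_add_distrib]
  refine Finset.sum_congr rfl fun a _ => ?_
  rw [← add_mul, ← Finset.sum_add_distrib]
  congr 1
  exact Finset.sum_congr rfl fun b _ => by ring

lemma evolve_conj (H : Matrix n n ℂ) (V : Matrix.unitaryGroup n ℂ) (γ α t : ℝ)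
    (X G : Matrix (n × Fin 2) (n × Fin 2) ℂ) :
    evolve ((V : Matrix n n ℂ) * H * (V : Matrix n n ℂ)ᴴ) γ α t
      ((kronUnitary V : Matrix (n × Fin 2) (n × Fin 2) ℂ) * X *
        (kronUnitary V : Matrix (n × Fin 2) (n × Fin 2) ℂ)ᴴ) G =
    (kronUnitary V : Matrix (n × Fin 2) (n × Fin 2) ℂ) *
      evolve H γ α t X ((kronUnitary V : Matrix (n × Fin 2) (n × Fin 2) ℂ)ᴴ * G *
        (kronUnitary V : Matrix (n × Fin 2) (n × Fin 2) ℂ)) *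
      (kronUnitary V : Matrix (n × Fin 2) (n × Fin 2) ℂ)ᴴ := by
  have htot : totalHamiltonian ((V : Matrix n n ℂ) * H * (V : Matrix n n ℂ)ᴴ) γ =
      (kronUnitary V : Matrix (n × Fin 2) (n × Fin 2) ℂ) * totalHamiltonian H γ *
        (kronUnitary V : Matrix (n × Fin 2) (n × Fin 2) ℂ)ᴴ := by
    rw [totalHamiltonian, totalHamiltonian, Matrix.mul_add, Matrix.add_mul, kronUnitary_conj,
      kronUnitary_conj, Matrix.mul_one, unitary_mul_conjTranspose]
  set W := kronUnitary V
  set w := (W : Matrix (n × Fin 2) (n × Fin 2) ℂ)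
  have hw : w * wᴴ = 1 := unitary_mul_conjTranspose W
  have hw' : wᴴ * w = 1 := unitary_conjTranspose_mul W
  have hc : ∀ c : ℂ, NormedSpace.exp (c • (w * totalHamiltonian H γ * wᴴ + (α : ℂ) • G)) =
      w * NormedSpace.exp (c • (totalHamiltonian H γ + (α : ℂ) • (wᴴ * G * w))) * wᴴ := by
    intro c
    rw [← exp_unitary_conj]
    congr 1
    have hG : w * (wᴴ * G * w) * wᴴ = G := by
      calc _ = (w * wᴴ) * G * (w * wᴴ) := by simp only [Matrix.mul_assoc]
        _ = G := by rw [hw, Matrix.one_mul, Matrix.mul_one]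
    change _ = w * _ * wᴴ
    rw [Matrix.mul_smul, Matrix.smul_mul, Matrix.mul_add, Matrix.add_mul, Matrix.mul_smul,
      Matrix.smul_mul, hG]
  have h3 : ∀ A B C : Matrix (n × Fin 2) (n × Fin 2) ℂ,
      w * A * wᴴ * (w * B * wᴴ) * (w * C * wᴴ) = w * (A * B * C) * wᴴ := by
    intro A B C
    calc _ = w * A * (wᴴ * w) * B * (wᴴ * w) * C * wᴴ := by simp only [Matrix.mul_assoc]
      _ = _ := by rw [hw', Matrix.mul_one, Matrix.mul_one]; simp only [Matrix.mul_assoc]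
  rw [evolve, htot, hc, hc, h3, evolve]

/-- Unitary covariance of the channel, a consequence of that of the interaction. -/
lemma thermalChannel_conj {H : Matrix n n ℂ} (hH : H.IsHermitian) (V : Matrix.unitaryGroup n ℂ)
    (β : ℝ≥0∞) (α t γ : ℝ) (ρ : Matrix n n ℂ) :
    thermalChannel ((V : Matrix n n ℂ) * H * (V : Matrix n n ℂ)ᴴ) β α t γ
      ((V : Matrix n n ℂ) * ρ * (V : Matrix n n ℂ)ᴴ) =
      (V : Matrix n n ℂ) * thermalChannel H β α t γ ρ * (V : Matrix n n ℂ)ᴴ := by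
  rw [thermalChannel, ← kronUnitary_conj]
  have : (evolve ((V : Matrix n n ℂ) * H * (V : Matrix n n ℂ)ᴴ) γ α t
      ((kronUnitary V : Matrix (n × Fin 2) (n × Fin 2) ℂ) *
        (ρ ⊗ₖ thermalState (envHamiltonian γ) β) *
        (kronUnitary V : Matrix (n × Fin 2) (n × Fin 2) ℂ)ᴴ)) = fun G => _ :=
    funext fun G => evolve_conj H V γ α t _ G
  rw [this, interactionExpectation_conj (fun x y => integrable_evolve hH γ α t _ x y),
    traceEnv_conj, thermalChannel]

variable {d : ℕ}

/-- The energies of the system and the environment qubit together. -/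
def jointEnergy (E : Fin d → ℝ) (γ : ℝ) (x : Fin d × Fin 2) : ℝ := E x.1 + ![0, γ] x.2

lemma totalHamiltonian_diagHam (E : Fin d → ℝ) (γ : ℝ) :
    totalHamiltonian (diagHam E) γ = diagHam (jointEnergy E γ) := by
  have e : envHamiltonian γ = Matrix.diagonal fun a => ((![0, γ] : Fin 2 → ℝ) a : ℂ) := by
    ext i j
    fin_cases i <;> fin_cases j <;> simp [envHamiltonian]
  rw [totalHamiltonian, e, diagHam, diagHam, ← Matrix.diagonal_one, ← Matrix.diagonal_one,
    Matrix.diagonal_kronecker_diagonal, Matrix.diagonal_kronecker_diagonal, Matrix.diagonal_add]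
  congr 1
  ext x
  simp [jointEnergy]

/-- The propagator of the system and the environment, for the system Hamiltonian `diag E`. -/
def jointPropagator (E : Fin d → ℝ) (α t γ : ℝ) (G : Matrix (Fin d × Fin 2) (Fin d × Fin 2) ℂ) :
    Matrix (Fin d × Fin 2) (Fin d × Fin 2) ℂ :=
  propagator (diagHam (jointEnergy E γ) + (α : ℂ) • G) t

/-- The probability of the transition `i → j` between system levels under the channel. -/
def levelTransition (E : Fin d → ℝ) (β : ℝ≥0∞) (α t γ : ℝ) (j i : Fin d) : ℝ :=
  ∑ b : Fin 2, ∑ a : Fin 2, envPopulation β γ a *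
    ∫ p, ‖jointPropagator E α t γ (interaction p) (j, b) (i, a)‖ ^ 2
      ∂(interactionLaw (Fin d × Fin 2))

variable {E : Fin d → ℝ} {β : ℝ≥0∞} {α t γ : ℝ}

lemma envPopulation_nonneg (hγ : 0 < γ) (β : ℝ≥0∞) (a : Fin 2) : 0 ≤ envPopulation β γ a := by
  rw [envPopulation_eq hγ]
  exact gibbsWeight_nonneg _ _ _

lemma sum_envPopulation (hγ : 0 < γ) (β : ℝ≥0∞) : ∑ a, envPopulation β γ a = 1 := by
  simp_rw [envPopulation_eq hγ]
  exact sum_gibbsWeight _ _ (by norm_num)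

lemma levelTransition_nonneg (hγ : 0 < γ) (j i : Fin d) : 0 ≤ levelTransition E β α t γ j i :=
  Finset.sum_nonneg fun _ _ => Finset.sum_nonneg fun a _ =>
    mul_nonneg (envPopulation_nonneg hγ β a) (integral_nonneg fun _ => by positivity)

lemma sum_norm_sq_unitary_col (U : Matrix.unitaryGroup n ℂ) (l : n) :
    ∑ k, ‖(U : Matrix n n ℂ) k l‖ ^ 2 = 1 := by
  have h := congrFun (congrFun (unitary_conjTranspose_mul U) l) l
  simp only [Matrix.mul_apply, Matrix.conjTranspose_apply, Matrix.one_apply_eq,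
    RCLike.star_def, ← Complex.normSq_eq_conj_mul_self, Complex.normSq_eq_norm_sq] at h
  exact_mod_cast h

lemma continuous_jointPropagator : Continuous (jointPropagator E α t γ) :=
  (continuous_propagator t).comp (by fun_prop)

lemma integrable_transition (x y : Fin d × Fin 2) :
    Integrable (fun p => ‖jointPropagator E α t γ (interaction p) x y‖ ^ 2)
      (interactionLaw (Fin d × Fin 2)) := by
  refine (integrable_const (1 : ℝ)).mono' (Continuous.aestronglyMeasurable
    (((continuous_jointPropagator.comp continuous_interaction).matrix_elem x y).norm.pow 2))
    (Eventually.of_forall fun p => ?_)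
  rw [Real.norm_of_nonneg (by positivity)]
  refine le_trans ?_ (sum_norm_sq_unitary_col (propagatorUnitary
    (perturbed_isHermitian (h := jointEnergy E γ) (α := α) (interaction_isHermitian p)) t) y).le
  exact Finset.single_le_sum (f := fun k => ‖jointPropagator E α t γ (interaction p) k y‖ ^ 2)
    (fun _ _ => by positivity) (Finset.mem_univ x)

lemma sum_levelTransition (hγ : 0 < γ) (i : Fin d) :
    ∑ j, levelTransition E β α t γ j i = 1 := by
  have h : ∀ a : Fin 2, ∑ j : Fin d, ∑ b : Fin 2,
      ∫ p, ‖jointPropagator E α t γ (interaction p) (j, b) (i, a)‖ ^ 2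
        ∂(interactionLaw (Fin d × Fin 2)) = 1 := by
    intro a
    rw [← Fintype.sum_prod_type (f := fun x : Fin d × Fin 2 =>
      ∫ p, ‖jointPropagator E α t γ (interaction p) x (i, a)‖ ^ 2
        ∂(interactionLaw (Fin d × Fin 2))),
      ← integral_finsetSum _ fun x _ => integrable_transition x _]
    have : ∀ p : Matrix.unitaryGroup (Fin d × Fin 2) ℂ × (Fin d × Fin 2 → ℝ),
        ∑ x, ‖jointPropagator E α t γ (interaction p) x (i, a)‖ ^ 2 = 1 := fun p =>
      sum_norm_sq_unitary_col (propagatorUnitary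
        (perturbed_isHermitian (h := jointEnergy E γ) (α := α) (interaction_isHermitian p)) t)
        (i, a)
    simp [this]
  unfold levelTransition
  calc _ = ∑ a : Fin 2, envPopulation β γ a * ∑ j : Fin d, ∑ b : Fin 2,
      ∫ p, ‖jointPropagator E α t γ (interaction p) (j, b) (i, a)‖ ^ 2
        ∂(interactionLaw (Fin d × Fin 2)) := by
        simp_rw [Finset.mul_sum]
        rw [Finset.sum_comm (s := (Finset.univ : Finset (Fin 2)))
          (t := (Finset.univ : Finset (Fin d)))]
        refine Finset.sum_congr rfl fun j _ => ?_
        rw [Finset.sum_comm]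
    _ = 1 := by simp_rw [h, mul_one]; exact sum_envPopulation hγ β

/-- The channel maps diagonal states to diagonal states, by covariance under diagonal unitary
matrices, and acts on the populations by the transition probabilities. -/
lemma thermalChannel_diagonal (hγ : 0 < γ) (v : Fin d → ℂ) :
    thermalChannel (diagHam E) β α t γ (Matrix.diagonal v) =
      Matrix.diagonal (complexify (Matrix.of (levelTransition E β α t γ)) *ᵥ v) := by
  ext i j
  by_cases hij : i = j
  · subst hij
    rw [Matrix.diagonal_apply_eq, thermalChannel, thermalState_env hγ,
      Matrix.diagonal_kronecker_diagonal]
    simp only [traceEnv, interactionExpectation, Matrix.of_apply, Matrix.mulVec, dotProduct,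
      complexify_apply]
    have key : ∀ (b : Fin 2) (p : Matrix.unitaryGroup (Fin d × Fin 2) ℂ × (Fin d × Fin 2 → ℝ)),
        evolve (diagHam E) γ α t (Matrix.diagonal fun x : Fin d × Fin 2 =>
          v x.1 * (envPopulation β γ x.2 : ℂ)) (interaction p) (i, b) (i, b) =
        ∑ x : Fin d × Fin 2, v x.1 * (envPopulation β γ x.2 : ℂ) *
          ((‖jointPropagator E α t γ (interaction p) (i, b) x‖ ^ 2 : ℝ) : ℂ) := by
      intro b p
      have hA := total_add_isHermitian (diagHam_isHermitian E) γ α (interaction_isHermitian p)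
      rw [evolve_eq _ _ _ _ _ _ hA, totalHamiltonian_diagHam, Matrix.mul_apply]
      refine Finset.sum_congr rfl fun x _ => ?_
      rw [Matrix.mul_diagonal, Matrix.conjTranspose_apply, ← Complex.normSq_eq_norm_sq,
        ← Complex.mul_conj, RCLike.star_def]
      simp only [jointPropagator]
      ring
    simp_rw [key]
    have hint : ∀ (b : Fin 2), ∫ p, ∑ x : Fin d × Fin 2, v x.1 * (envPopulation β γ x.2 : ℂ) *
          ((‖jointPropagator E α t γ (interaction p) (i, b) x‖ ^ 2 : ℝ) : ℂ)
            ∂(interactionLaw (Fin d × Fin 2)) =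
        ∑ k : Fin d, ∑ a : Fin 2, v k * (envPopulation β γ a : ℂ) *
          ((∫ p, ‖jointPropagator E α t γ (interaction p) (i, b) (k, a)‖ ^ 2
            ∂(interactionLaw (Fin d × Fin 2)) : ℝ) : ℂ) := by
      intro b
      rw [integral_finsetSum _ fun x _ => (integrable_transition _ _).ofReal.const_mul _,
        Fintype.sum_prod_type]
      simp_rw [integral_const_mul, integral_complex_ofReal]
    simp_rw [hint, levelTransition]
    rw [Finset.sum_comm]
    refine Finset.sum_congr rfl fun k _ => ?_
    push_cast
    rw [Finset.sum_mul]
    refine Finset.sum_congr rfl fun b _ => ?_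
    rw [Finset.sum_mul]
    refine Finset.sum_congr rfl fun a _ => ?_
    ring
  · rw [Matrix.diagonal_apply_ne _ hij]
    -- A sign on the level `i` preserves the Hamiltonian and the input and negates the entry.
    let u : Fin d → ℂ := fun k => if k = i then -1 else 1
    have hu : ∀ k, u k * (starRingEnd ℂ) (u k) = 1 := by
      intro k
      by_cases h : k = i <;> simp [u, h]
    have hdiag : ∀ w : Fin d → ℂ, Matrix.diagonal u * Matrix.diagonal w * (Matrix.diagonal u)ᴴ =
        Matrix.diagonal w := by
      intro w
      rw [Matrix.diagonal_conjTranspose, Matrix.diagonal_mul_diagonal,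
        Matrix.diagonal_mul_diagonal]
      congr 1
      ext k
      have := hu k
      simp only [Pi.star_apply, RCLike.star_def]
      linear_combination w k * this
    have h := thermalChannel_conj (diagHam_isHermitian E) (phaseUnitary u hu) β α t γ
      (Matrix.diagonal v)
    simp only [phaseUnitary] at h
    rw [diagHam, hdiag, hdiag] at h
    have h2 := congrFun (congrFun h i) j
    rw [diagonal_conj] at h2
    have h3 : u i = -1 := by simp [u]
    have h4 : u j = 1 := by simp [u, Ne.symm hij]
    rw [h3, h4, map_one, mul_one, neg_one_mul] at h2
    rw [diagHam]
    linear_combination (1 / 2 : ℂ) * h2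

end ChannelAnalysis

/-! ### Comparison of the channel with the second-order transition probabilities -/

section GoldenRule

open scoped Matrix.Norms.L2Operator

variable {d : ℕ} {E : Fin d → ℝ} {β : ℝ≥0∞} {α t γ : ℝ}

/-- The transition probability to second order in the coupling, on and off resonance. -/
def secondOrder (E : Fin d → ℝ) (β : ℝ≥0∞) (α t γ : ℝ) (j i : Fin d) : ℝ :=
  alphaTildeSq d α t * ∑ b : Fin 2, ∑ a : Fin 2, envPopulation β γ a *
    Real.sinc ((jointEnergy E γ (j, b) - jointEnergy E γ (i, a)) * t / 2) ^ 2

lemma alphaTildeSq_eq (d : ℕ) (α t : ℝ) : alphaTildeSq d α t = (α * t) ^ 2 / (2 * d + 1) := by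
  rw [alphaTildeSq, div_pow, Real.sq_sqrt (by positivity)]

/-- The error of the second-order transition probabilities out of a level. -/
def dysonError (d : ℕ) (x : ℝ) : ℝ :=
  2 * d * (2 * x ^ 3 * gaussianMoment 3 + x ^ 4 * gaussianMoment 4)

lemma integrable_norm_sq_entry (x y : Fin d × Fin 2) :
    Integrable (fun p => ‖interaction p x y‖ ^ 2) (interactionLaw (Fin d × Fin 2)) := by
  have : Nonempty (Fin d × Fin 2) := ⟨x⟩
  refine (integrable_norm_pow (n := Fin d × Fin 2) 2).mono' (Continuous.aestronglyMeasurable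
    ((continuous_interaction.matrix_elem x y).norm.pow 2)) (Eventually.of_forall fun p => ?_)
  rw [Real.norm_of_nonneg (by positivity)]
  gcongr
  exact norm_apply_le _ _ _

lemma sum_abs_levelTransition_sub_le (hγ : 0 < γ) (hα : 0 ≤ α) (ht : 0 ≤ t) (i : Fin d) :
    ∑ j ∈ Finset.univ.erase i, |levelTransition E β α t γ j i - secondOrder E β α t γ j i| ≤
      dysonError d (α * t) := by
  let s : (Fin d × Fin 2) → (Fin d × Fin 2) → ℝ := fun x y =>
    (α * t) ^ 2 * Real.sinc ((jointEnergy E γ x - jointEnergy E γ y) * t / 2) ^ 2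
  let f : (Fin d × Fin 2) → (Fin d × Fin 2) → Matrix.unitaryGroup (Fin d × Fin 2) ℂ ×
      (Fin d × Fin 2 → ℝ) → ℝ := fun x y p =>
    ‖jointPropagator E α t γ (interaction p) x y‖ ^ 2 - s x y * ‖interaction p x y‖ ^ 2
  have hf : ∀ x y, Integrable (f x y) (interactionLaw (Fin d × Fin 2)) := fun x y =>
    (integrable_transition x y).sub ((integrable_norm_sq_entry x y).const_mul _)
  have hne : Nonempty (Fin d × Fin 2) := ⟨(i, 0)⟩
  have h1 : ∀ j ∈ Finset.univ.erase i,
      |levelTransition E β α t γ j i - secondOrder E β α t γ j i| ≤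
      ∑ a : Fin 2, envPopulation β γ a * ∑ b : Fin 2,
        ∫ p, |f (j, b) (i, a) p| ∂(interactionLaw (Fin d × Fin 2)) := by
    intro j hj
    have hji : j ≠ i := Finset.ne_of_mem_erase hj
    have e : levelTransition E β α t γ j i - secondOrder E β α t γ j i =
        ∑ a : Fin 2, envPopulation β γ a * ∑ b : Fin 2,
          ∫ p, f (j, b) (i, a) p ∂(interactionLaw (Fin d × Fin 2)) := by
      have hint : ∀ a b, ∫ p, f (j, b) (i, a) p ∂(interactionLaw (Fin d × Fin 2)) =
          (∫ p, ‖jointPropagator E α t γ (interaction p) (j, b) (i, a)‖ ^ 2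
            ∂(interactionLaw (Fin d × Fin 2))) - s (j, b) (i, a) * (1 / (2 * d + 1)) := by
        intro a b
        rw [integral_sub (integrable_transition _ _) ((integrable_norm_sq_entry _ _).const_mul _),
          integral_const_mul, integral_norm_sq_offdiag (by simp [hji])]
        simp [mul_comm]
      simp_rw [hint]
      rw [levelTransition, secondOrder, alphaTildeSq_eq, Finset.mul_sum,
        ← Finset.sum_sub_distrib]
      simp_rw [Finset.mul_sum]
      conv_rhs => rw [Finset.sum_comm]
      refine Finset.sum_congr rfl fun b _ => ?_
      rw [← Finset.sum_sub_distrib]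
      refine Finset.sum_congr rfl fun a _ => ?_
      simp only [s]
      ring
    rw [e]
    refine (Finset.abs_sum_le_sum_abs _ _).trans (Finset.sum_le_sum fun a _ => ?_)
    rw [abs_mul, abs_of_nonneg (envPopulation_nonneg hγ β a)]
    refine mul_le_mul_of_nonneg_left ?_ (envPopulation_nonneg hγ β a)
    exact (Finset.abs_sum_le_sum_abs _ _).trans
      (Finset.sum_le_sum fun b _ => abs_integral_le_integral_abs)
  have h2 : ∀ a : Fin 2, ∑ j ∈ Finset.univ.erase i, ∑ b : Fin 2,
      ∫ p, |f (j, b) (i, a) p| ∂(interactionLaw (Fin d × Fin 2)) ≤ dysonError d (α * t) := by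
    intro a
    rw [← Finset.sum_product (s := Finset.univ.erase i) (t := (Finset.univ : Finset (Fin 2)))
      (f := fun x => ∫ p, |f x (i, a) p| ∂(interactionLaw (Fin d × Fin 2))),
      ← integral_finsetSum _ fun x _ => (hf x (i, a)).abs]
    have hn3 := integrable_norm_pow (n := Fin d × Fin 2) 3
    have hn4 := integrable_norm_pow (n := Fin d × Fin 2) 4
    have m3 := integral_norm_pow_le (n := Fin d × Fin 2) 3
    have m4 := integral_norm_pow_le (n := Fin d × Fin 2) 4
    have hcard : (Fintype.card (Fin d × Fin 2) : ℝ) = 2 * d := by simp [mul_comm]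
    rw [hcard] at m3 m4
    calc _ ≤ ∫ p, (2 * (α * t) ^ 3 * ‖interaction p‖ ^ 3 + (α * t) ^ 4 * ‖interaction p‖ ^ 4)
          ∂(interactionLaw (Fin d × Fin 2)) := by
          refine integral_mono (integrable_finsetSum _ fun x _ => (hf x (i, a)).abs)
            ((hn3.const_mul _).add (hn4.const_mul _)) fun p => ?_
          have := sum_abs_transition_sub_le (h := jointEnergy E γ) (interaction_isHermitian p)
            hα ht (i, a) (Finset.univ.erase i ×ˢ Finset.univ) (by simp)
          refine this.trans_eq ?_
          ring
      _ = 2 * (α * t) ^ 3 * ∫ p, ‖interaction p‖ ^ 3 ∂(interactionLaw (Fin d × Fin 2)) +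
          (α * t) ^ 4 * ∫ p, ‖interaction p‖ ^ 4 ∂(interactionLaw (Fin d × Fin 2)) := by
          rw [integral_add (hn3.const_mul _) (hn4.const_mul _), integral_const_mul,
            integral_const_mul]
      _ ≤ 2 * (α * t) ^ 3 * (2 * d * gaussianMoment 3) +
          (α * t) ^ 4 * (2 * d * gaussianMoment 4) := by gcongr
      _ = dysonError d (α * t) := by rw [dysonError]; ring
  calc _ ≤ ∑ j ∈ Finset.univ.erase i, ∑ a : Fin 2, envPopulation β γ a * ∑ b : Fin 2,
        ∫ p, |f (j, b) (i, a) p| ∂(interactionLaw (Fin d × Fin 2)) := Finset.sum_le_sum h1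
    _ = ∑ a : Fin 2, envPopulation β γ a * ∑ j ∈ Finset.univ.erase i, ∑ b : Fin 2,
        ∫ p, |f (j, b) (i, a) p| ∂(interactionLaw (Fin d × Fin 2)) := by
        rw [Finset.sum_comm]
        simp_rw [Finset.mul_sum]
    _ ≤ ∑ a : Fin 2, envPopulation β γ a * dysonError d (α * t) :=
        Finset.sum_le_sum fun a _ => mul_le_mul_of_nonneg_left (h2 a) (envPopulation_nonneg hγ β a)
    _ = dysonError d (α * t) := by rw [← Finset.sum_mul, sum_envPopulation hγ, one_mul]

end GoldenRule

/-! ### Resonances -/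

section Resonance

variable {d : ℕ} {E : Fin d → ℝ} {β : ℝ≥0∞} {α t γ : ℝ}

lemma pos_of_two_le (hd : 2 ≤ d) : 0 < d := two_pos.trans_le hd

lemma deltaMin_isLeast (hE : StrictMono E) (hd : 2 ≤ d) :
    IsLeast {x | ∃ i j k l, gap E i j ≠ gap E k l ∧ x = |gap E i j - gap E k l|}
      (deltaMin E) := by
  have hfin : {x | ∃ i j k l, gap E i j ≠ gap E k l ∧
      x = |gap E i j - gap E k l|}.Finite := by
    refine (Set.finite_range fun q : Fin d × Fin d × Fin d × Fin d =>
      |gap E q.1 q.2.1 - gap E q.2.2.1 q.2.2.2|).subset ?_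
    rintro x ⟨i, j, k, l, -, rfl⟩
    exact ⟨(i, j, k, l), rfl⟩
  have hlt : E ⟨0, pos_of_two_le hd⟩ < E ⟨1, by omega⟩ := hE (by simp [Fin.lt_def])
  refine ⟨Set.Nonempty.csInf_mem ⟨_, ⟨1, by omega⟩, ⟨0, pos_of_two_le hd⟩,
    ⟨0, pos_of_two_le hd⟩, ⟨0, pos_of_two_le hd⟩, ?_, rfl⟩ hfin, fun x hx => csInf_le hfin.bddBelow hx⟩
  simp only [gap, sub_self]
  exact (sub_pos.mpr hlt).ne'

lemma deltaMin_pos (hE : StrictMono E) (hd : 2 ≤ d) : 0 < deltaMin E := by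
  obtain ⟨i, j, k, l, h, e⟩ := (deltaMin_isLeast hE hd).1
  rw [e]
  exact abs_pos.mpr (sub_ne_zero.mpr h)

lemma deltaMin_le (hE : StrictMono E) (hd : 2 ≤ d) {i j k l : Fin d}
    (h : gap E i j ≠ gap E k l) : deltaMin E ≤ |gap E i j - gap E k l| :=
  (deltaMin_isLeast hE hd).2 ⟨i, j, k, l, h, rfl⟩

lemma mem_gapSet {x : ℝ} : x ∈ gapSet E ↔ ∃ k l, l < k ∧ gap E k l = x := by
  simp [gapSet]

lemma pos_of_mem_gapSet (hE : StrictMono E) (hγ : γ ∈ gapSet E) : 0 < γ := by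
  obtain ⟨k, l, hkl, rfl⟩ := mem_gapSet.mp hγ
  exact sub_pos.mpr (hE hkl)

lemma abs_gap_sub_lt_iff (hE : StrictMono E) (hd : 2 ≤ d) (hγ : γ ∈ gapSet E) (i j : Fin d) :
    |gap E i j - γ| < deltaMin E ↔ gap E i j = γ := by
  obtain ⟨k, l, -, rfl⟩ := mem_gapSet.mp hγ
  constructor
  · intro h
    by_contra hne
    exact absurd (deltaMin_le hE hd hne) (not_le.mpr h)
  · intro h
    rw [h, sub_self, abs_zero]
    exact deltaMin_pos hE hd

lemma abs_gap_add_lt_iff (hE : StrictMono E) (hd : 2 ≤ d) (hγ : γ ∈ gapSet E) (i j : Fin d) :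
    |gap E i j + γ| < deltaMin E ↔ gap E j i = γ := by
  rw [← abs_gap_sub_lt_iff hE hd hγ j i, ← abs_neg]
  simp only [gap]
  ring_nf

lemma sinc_sq_le {x δ : ℝ} (hδ : 0 < δ) (ht : 0 < t) (hx : δ ≤ |x|) :
    Real.sinc (x * t / 2) ^ 2 ≤ 4 / (δ * t) ^ 2 := by
  have hx0 : 0 < |x| := hδ.trans_le hx
  have hne : x * t / 2 ≠ 0 := by
    have := abs_pos.mp hx0
    positivity
  rw [Real.sinc_of_ne_zero hne, div_pow]
  calc Real.sin (x * t / 2) ^ 2 / (x * t / 2) ^ 2 ≤ 1 / (x * t / 2) ^ 2 := by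
        gcongr
        exact Real.sin_sq_le_one _
    _ = 4 / (|x| * t) ^ 2 := by
        rw [mul_pow, sq_abs, div_pow, mul_pow]
        field_simp
        norm_num
    _ ≤ 4 / (δ * t) ^ 2 := by gcongr

/-- The off-resonant part of a second-order transition probability. -/
lemma abs_secondOrder_sub_le (hE : StrictMono E) (hd : 2 ≤ d) (hγ : γ ∈ gapSet E) (ht : 0 < t)
    {i j : Fin d} (hij : j ≠ i) :
    |secondOrder E β α t γ j i - onWeight E β α t γ j i| ≤
      alphaTildeSq d α t * (8 / (deltaMin E * t) ^ 2) := by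
  have hγ0 := pos_of_mem_gapSet hE hγ
  have hδ := deltaMin_pos hE hd
  have q0 := envPopulation_nonneg hγ0 β 0
  have q1 := envPopulation_nonneg hγ0 β 1
  have qs := sum_envPopulation hγ0 β
  rw [Fin.sum_univ_two] at qs
  have hB : 0 ≤ 4 / (deltaMin E * t) ^ 2 := by positivity
  have hA : 0 ≤ alphaTildeSq d α t := sq_nonneg _
  have hgap : deltaMin E ≤ |gap E i j| := by
    have hne : gap E i j ≠ gap E i i := by
      simp only [gap, ne_eq, sub_right_inj]
      exact fun h => hij (hE.injective h)
    have := deltaMin_le hE hd hne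
    simpa [gap] using this
  have e0 := sinc_sq_le hδ ht hgap
  have s00 : (jointEnergy E γ (j, 0) - jointEnergy E γ (i, 0)) * t / 2 = -(gap E i j * t / 2) := by
    simp only [jointEnergy, gap, Matrix.cons_val_zero]; ring
  have s11 : (jointEnergy E γ (j, 1) - jointEnergy E γ (i, 1)) * t / 2 = -(gap E i j * t / 2) := by
    simp only [jointEnergy, gap, Matrix.cons_val_one]; ring
  have s10 : (jointEnergy E γ (j, 1) - jointEnergy E γ (i, 0)) * t / 2 =
      -((gap E i j - γ) * t / 2) := by
    simp only [jointEnergy, gap, Matrix.cons_val_one, Matrix.cons_val_zero]; ring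
  have s01 : (jointEnergy E γ (j, 0) - jointEnergy E γ (i, 1)) * t / 2 =
      -((gap E i j + γ) * t / 2) := by
    simp only [jointEnergy, gap, Matrix.cons_val_one, Matrix.cons_val_zero]; ring
  set x0 := Real.sinc (gap E i j * t / 2) ^ 2
  have hx0 : 0 ≤ x0 := sq_nonneg _
  -- Each resonance indicator removes a term or leaves one that is off resonance.
  have aux : ∀ (P : Prop) [Decidable P] (q x : ℝ), 0 ≤ q → (¬ P → x ≤ 4 / (deltaMin E * t) ^ 2) →
      0 ≤ x → 0 ≤ q * x - (if P then q * x else 0) ∧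
        q * x - (if P then q * x else 0) ≤ q * (4 / (deltaMin E * t) ^ 2) := by
    intro P _ q x hq hx hx0
    split_ifs with h
    · simp [mul_nonneg hq hB]
    · simpa using ⟨mul_nonneg hq hx0, mul_le_mul_of_nonneg_left (hx h) hq⟩
  classical
  obtain ⟨a1, a2⟩ := aux (|gap E i j - γ| < deltaMin E) (envPopulation β γ 0)
    (Real.sinc ((gap E i j - γ) * t / 2) ^ 2) q0
    (fun h => sinc_sq_le hδ ht (not_lt.mp h)) (sq_nonneg _)
  obtain ⟨b1, b2⟩ := aux (|gap E i j + γ| < deltaMin E) (envPopulation β γ 1)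
    (Real.sinc ((gap E i j + γ) * t / 2) ^ 2) q1
    (fun h => sinc_sq_le hδ ht (not_lt.mp h)) (sq_nonneg _)
  rw [secondOrder, onWeight, ← mul_sub, abs_mul, abs_of_nonneg hA]
  refine mul_le_mul_of_nonneg_left ?_ hA
  simp only [Fin.sum_univ_two, s00, s11, s10, s01, Real.sinc_neg]
  have h8 : 8 / (deltaMin E * t) ^ 2 = 2 * (4 / (deltaMin E * t) ^ 2) := by ring
  rw [h8]
  have c1 : envPopulation β γ 0 * x0 + envPopulation β γ 1 * x0 = x0 := by
    rw [← add_mul, qs, one_mul]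
  have c2 : envPopulation β γ 0 * (4 / (deltaMin E * t) ^ 2) +
    envPopulation β γ 1 * (4 / (deltaMin E * t) ^ 2) = 4 / (deltaMin E * t) ^ 2 := by
    rw [← add_mul, qs, one_mul]
  rw [abs_le]
  constructor <;> linarith

/-- The total distance, over the transitions out of a level, of the channel from the on-resonance
chain. -/
lemma sum_abs_levelTransition_sub_onWeight_le (hE : StrictMono E) (hd : 2 ≤ d)
    (hγ : γ ∈ gapSet E) (hα : 0 ≤ α) (ht : 0 < t) (i : Fin d) :
    ∑ j ∈ Finset.univ.erase i, |levelTransition E β α t γ j i - onWeight E β α t γ j i| ≤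
      dysonError d (α * t) + 4 * (α / deltaMin E) ^ 2 := by
  have hδ := deltaMin_pos hE hd
  calc _ ≤ ∑ j ∈ Finset.univ.erase i,
        (|levelTransition E β α t γ j i - secondOrder E β α t γ j i| +
          alphaTildeSq d α t * (8 / (deltaMin E * t) ^ 2)) := by
        refine Finset.sum_le_sum fun j hj => ?_
        refine (abs_sub_le _ (secondOrder E β α t γ j i) _).trans ?_
        gcongr
        exact abs_secondOrder_sub_le hE hd hγ ht (Finset.ne_of_mem_erase hj)
    _ ≤ dysonError d (α * t) + d * (alphaTildeSq d α t * (8 / (deltaMin E * t) ^ 2)) := by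
        rw [Finset.sum_add_distrib, Finset.sum_const, nsmul_eq_mul]
        refine add_le_add
          (sum_abs_levelTransition_sub_le (pos_of_mem_gapSet hE hγ) hα ht.le i) ?_
        refine mul_le_mul_of_nonneg_right ?_ (mul_nonneg (sq_nonneg _) (by positivity))
        exact_mod_cast (Finset.card_le_univ _).trans_eq (Fintype.card_fin d)
    _ ≤ dysonError d (α * t) + 4 * (α / deltaMin E) ^ 2 := by
        refine add_le_add le_rfl ?_
        have : d * (alphaTildeSq d α t * (8 / (deltaMin E * t) ^ 2)) =
            (2 * d / (2 * d + 1)) * (4 * (α / deltaMin E) ^ 2) := by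
          rw [alphaTildeSq_eq]
          field_simp
          ring
        rw [this]
        refine mul_le_of_le_one_left (by positivity) ?_
        rw [div_le_one (by positivity)]
        linarith

end Resonance

/-! ### The on-resonance chain -/

section OnResonance

variable {d : ℕ} {E : Fin d → ℝ} {β : ℝ≥0∞} {α t : ℝ}

/-- The rescaled rate of the on-resonance transition `i → j`: downward transitions are driven by
the environment qubit in its ground state, upward ones by its excited state. -/
def rate (E : Fin d → ℝ) (β : ℝ≥0∞) (j i : Fin d) : ℝ :=
  if j < i then gapMultiplicity E (gap E i j) * envPopulation β (gap E i j) 0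
  else if i < j then gapMultiplicity E (gap E j i) * envPopulation β (gap E j i) 1 else 0

/-- The generator with rates `rate E β`, which is the rescaled transition matrix
(`rescaledMatrix_eq`). -/
def rateMatrix (E : Fin d → ℝ) (β : ℝ≥0∞) : Matrix (Fin d) (Fin d) ℝ :=
  Matrix.of fun j i => if j = i then -∑ k ∈ Finset.univ.erase i, rate E β k i else rate E β j i

lemma gap_pos (hE : StrictMono E) {i j : Fin d} (h : j < i) : 0 < gap E i j :=
  sub_pos.mpr (hE h)

lemma gap_mem_gapSet_iff (hE : StrictMono E) (i j : Fin d) : gap E i j ∈ gapSet E ↔ j < i := by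
  constructor
  · intro h
    exact hE.lt_iff_lt.mp (sub_pos.mp (pos_of_mem_gapSet hE h))
  · intro h
    exact mem_gapSet.mpr ⟨i, j, h, rfl⟩

lemma card_pairs (d : ℕ) :
    (Finset.univ.filter fun p : Fin d × Fin d => p.2 < p.1).card = d.choose 2 := by
  have h : (Finset.univ.filter fun p : Fin d × Fin d => p.2 < p.1).card =
      ∑ i : Fin d, (i : ℕ) := by
    rw [Finset.card_filter, Fintype.sum_prod_type]
    refine Finset.sum_congr rfl fun i _ => ?_
    rw [← Finset.card_filter, ← Fin.card_Iio i]
    congr 1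
    ext j
    simp
  rw [h, Fin.sum_univ_eq_sum_range (fun i => i) d, Finset.sum_range_id, Nat.choose_two_right]

lemma sum_gapMultiplicity (E : Fin d → ℝ) :
    ∑ x ∈ gapSet E, gapMultiplicity E x = d.choose 2 := by
  classical
  rw [← card_pairs, gapSet, Finset.card_eq_sum_card_image fun p : Fin d × Fin d => gap E p.1 p.2]
  refine Finset.sum_congr (by congr) fun x _ => ?_
  rw [gapMultiplicity, Finset.filter_filter]

lemma gapMultiplicity_le (E : Fin d → ℝ) (x : ℝ) : gapMultiplicity E x ≤ d.choose 2 := by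
  rw [← card_pairs, gapMultiplicity]
  refine Finset.card_le_card fun p hp => ?_
  simp only [Finset.mem_filter, Finset.mem_univ, true_and] at hp ⊢
  exact hp.1

lemma one_le_gapMultiplicity {i j : Fin d} (h : j < i) :
    1 ≤ gapMultiplicity E (gap E i j) := by
  rw [gapMultiplicity, Nat.succ_le_iff, Finset.card_pos]
  exact ⟨(i, j), by simp [h]⟩

lemma choose_two_pos (hd : 2 ≤ d) : (0 : ℝ) < d.choose 2 := by
  exact_mod_cast Nat.choose_pos hd

lemma sum_gap_weights (hd : 2 ≤ d) (E : Fin d → ℝ) :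
    ∑ x ∈ gapSet E, (gapMultiplicity E x : ℝ) / (d.choose 2 : ℝ) = 1 := by
  rw [← Finset.sum_div, ← Nat.cast_sum, sum_gapMultiplicity]
  exact div_self (choose_two_pos hd).ne'

lemma onWeight_eq (hE : StrictMono E) (hd : 2 ≤ d) {γ : ℝ} (hγ : γ ∈ gapSet E) (j i : Fin d) :
    onWeight E β α t γ j i = alphaTildeSq d α t *
      ((if gap E i j = γ then envPopulation β γ 0 else 0) +
        (if gap E j i = γ then envPopulation β γ 1 else 0)) := by
  classical
  rw [onWeight]
  congr 2
  · by_cases h : gap E i j = γ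
    · rw [if_pos ((abs_gap_sub_lt_iff hE hd hγ i j).mpr h), if_pos h]
      simp [h]
    · rw [if_neg (fun h' => h ((abs_gap_sub_lt_iff hE hd hγ i j).mp h')), if_neg h]
  · by_cases h : gap E j i = γ
    · rw [if_pos ((abs_gap_add_lt_iff hE hd hγ i j).mpr h), if_pos h]
      have : gap E i j + γ = 0 := by rw [← h]; simp [gap]
      simp [this]
    · rw [if_neg (fun h' => h ((abs_gap_add_lt_iff hE hd hγ i j).mp h')), if_neg h]

lemma gapExpectation_onWeight (hE : StrictMono E) (hd : 2 ≤ d) (j i : Fin d) :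
    gapExpectation E (fun γ => onWeight E β α t γ j i) =
      alphaTildeSq d α t / d.choose 2 * rate E β j i := by
  have e : ∀ x ∈ gapSet E, ((gapMultiplicity E x : ℝ) / (d.choose 2 : ℝ)) • onWeight E β α t x j i =
      alphaTildeSq d α t / d.choose 2 *
        ((if gap E i j = x then gapMultiplicity E x * envPopulation β x 0 else 0) +
          (if gap E j i = x then gapMultiplicity E x * envPopulation β x 1 else 0)) := by
    intro x hx
    rw [onWeight_eq hE hd hx, smul_eq_mul]
    split_ifs <;> ring
  rw [gapExpectation, Finset.sum_congr rfl e, ← Finset.mul_sum, Finset.sum_add_distrib,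
    Finset.sum_ite_eq, Finset.sum_ite_eq]
  congr 1
  simp only [gap_mem_gapSet_iff hE, rate]
  rcases lt_trichotomy j i with h | h | h
  · simp [h, h.not_gt]
  · simp [h]
  · simp [h, h.not_gt]

lemma gapExpectation_apply {M : ℝ → Matrix (Fin d) (Fin d) ℝ} (j i : Fin d) :
    gapExpectation E M j i = gapExpectation E fun γ => M γ j i := by
  simp [gapExpectation, Matrix.sum_apply]

lemma averagedOnMatrix_eq (hE : StrictMono E) (hd : 2 ≤ d) :
    averagedOnMatrix E β α t = (alphaTildeSq d α t / d.choose 2) • rateMatrix E β := by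
  ext j i
  rw [averagedOnMatrix, gapExpectation_apply, Matrix.smul_apply, rateMatrix, Matrix.of_apply,
    smul_eq_mul]
  simp only [onMatrix, Matrix.of_apply]
  split_ifs with h
  · rw [mul_neg, Finset.mul_sum]
    simp_rw [← gapExpectation_onWeight (α := α) (t := t) hE hd]
    simp only [gapExpectation, smul_neg, Finset.sum_neg_distrib, Finset.smul_sum]
    rw [Finset.sum_comm]
  · exact gapExpectation_onWeight hE hd j i

lemma alphaTildeSq_pos (hα : 0 < α) (ht : 0 < t) : 0 < alphaTildeSq d α t := by
  rw [alphaTildeSq_eq]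
  positivity

lemma rescaledMatrix_eq (hE : StrictMono E) (hd : 2 ≤ d) (hα : 0 < α) (ht : 0 < t) :
    rescaledMatrix E β α t = rateMatrix E β := by
  have h1 := alphaTildeSq_pos (d := d) hα ht
  have h2 := choose_two_pos hd
  rw [rescaledMatrix, averagedOnMatrix_eq hE hd, smul_smul, div_mul_div_comm, mul_comm,
    div_self (by positivity), one_smul]

lemma envPopulation_le_one {γ : ℝ} (hγ : 0 < γ) (β : ℝ≥0∞) (m : Fin 2) :
    envPopulation β γ m ≤ 1 := by
  rw [← sum_envPopulation hγ β]
  exact Finset.single_le_sum (fun a _ => envPopulation_nonneg hγ β a) (Finset.mem_univ m)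

lemma rate_nonneg (hE : StrictMono E) (j i : Fin d) : 0 ≤ rate E β j i := by
  rw [rate]
  split_ifs with h1 h2
  · exact mul_nonneg (Nat.cast_nonneg _) (envPopulation_nonneg (gap_pos hE h1) _ _)
  · exact mul_nonneg (Nat.cast_nonneg _) (envPopulation_nonneg (gap_pos hE h2) _ _)
  · exact le_rfl

lemma rate_le (hE : StrictMono E) (j i : Fin d) : rate E β j i ≤ d.choose 2 := by
  have h : ∀ x : ℝ, 0 < x → ∀ m, gapMultiplicity E x * envPopulation β x m ≤ d.choose 2 := by
    intro x hx m
    refine (mul_le_of_le_one_right (Nat.cast_nonneg _) (envPopulation_le_one hx β m)).trans ?_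
    exact_mod_cast gapMultiplicity_le E x
  rw [rate]
  split_ifs with h1 h2
  · exact h _ (gap_pos hE h1) _
  · exact h _ (gap_pos hE h2) _
  · positivity

lemma half_le_envPopulation_zero {γ : ℝ} (hγ : 0 < γ) (β : ℝ≥0∞) :
    1 / 2 ≤ envPopulation β γ 0 := by
  rw [envPopulation_eq hγ, gibbsWeight]
  split_ifs
  · norm_num
  · exact absurd rfl ‹_›
  · have h : Real.exp (-β.toReal * γ) ≤ 1 := by
      rw [Real.exp_le_one_iff, neg_mul, neg_nonpos]
      positivity
    simp only [gibbsReal, Fin.sum_univ_two, Matrix.cons_val_zero, Matrix.cons_val_one, mul_zero,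
      Real.exp_zero]
    exact one_div_le_one_div_of_le (by positivity) (by linarith)

lemma rateMatrix_apply_ne {j i : Fin d} (h : j ≠ i) : rateMatrix E β j i = rate E β j i := by
  simp [rateMatrix, h]

lemma rateMatrix_apply_self (i : Fin d) :
    rateMatrix E β i i = -∑ k ∈ Finset.univ.erase i, rate E β k i := by
  simp [rateMatrix]

lemma sum_rateMatrix (i : Fin d) : ∑ j, rateMatrix E β j i = 0 := by
  rw [← Finset.add_sum_erase _ _ (Finset.mem_univ i), rateMatrix_apply_self,
    Finset.sum_congr rfl fun j hj => rateMatrix_apply_ne (Finset.ne_of_mem_erase hj),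
    neg_add_cancel]

/-- Every level decays to the ground state on resonance, at a rate at least `1 / 2` at every
temperature. -/
lemma rateMatrix_isDoeblin (hE : StrictMono E) (hd : 2 ≤ d) (β : ℝ≥0∞) :
    IsDoeblin (rateMatrix E β) ⟨0, pos_of_two_le hd⟩ (1 / 2) ((d - 1) * d.choose 2) where
  sum_col := sum_rateMatrix
  nonneg i j h := by rw [rateMatrix_apply_ne h]; exact rate_nonneg hE _ _
  exit_le i := by
    rw [rateMatrix_apply_self, neg_neg]
    refine (Finset.sum_le_card_nsmul _ _ _ fun k _ => rate_le hE k i).trans_eq ?_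
    rw [Finset.card_erase_of_mem (Finset.mem_univ i), Finset.card_univ, Fintype.card_fin,
      nsmul_eq_mul, Nat.cast_sub (by omega)]
    simp
  pos := by norm_num
  le_rate i hi := by
    have hlt : (⟨0, pos_of_two_le hd⟩ : Fin d) < i :=
      Fin.lt_def.mpr (Nat.pos_of_ne_zero fun h => hi (Fin.ext h))
    rw [rateMatrix_apply_ne hi.symm, rate, if_pos hlt]
    have h1 : (1 : ℝ) ≤ gapMultiplicity E (gap E i ⟨0, pos_of_two_le hd⟩) := by
      exact_mod_cast one_le_gapMultiplicity hlt
    have h2 := half_le_envPopulation_zero (gap_pos hE hlt) β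
    nlinarith
  bound_nonneg := by
    have : (2 : ℝ) ≤ d := by exact_mod_cast hd
    have := choose_two_pos hd
    nlinarith

lemma bound_le (hd : 2 ≤ d) : 2 * (((d : ℝ) - 1) * d.choose 2) + 1 / 2 ≤ (d : ℝ) ^ 3 := by
  have : (2 : ℝ) ≤ d := by exact_mod_cast hd
  rw [Nat.cast_choose_two]
  nlinarith [mul_nonneg (by linarith : (0 : ℝ) ≤ d) (by linarith : (0 : ℝ) ≤ d - 2)]

/-- Detailed balance between the Gibbs weights. -/
lemma detailedBalance (hE : StrictMono E) (β : ℝ≥0∞) (i j : Fin d) :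
    rateMatrix E β j i * gibbsWeight E β i = rateMatrix E β i j * gibbsWeight E β j := by
  have key : ∀ i j : Fin d, j < i →
      rateMatrix E β j i * gibbsWeight E β i = rateMatrix E β i j * gibbsWeight E β j := by
    intro i j h
    rw [rateMatrix_apply_ne h.ne, rateMatrix_apply_ne h.ne', rate, rate, if_pos h,
      if_neg h.not_gt, if_pos h, envPopulation_eq (gap_pos hE h), envPopulation_eq (gap_pos hE h)]
    by_cases hβ : β = ⊤
    · have hi : (i : ℕ) ≠ 0 := by
        have := Fin.lt_def.mp h
        omega
      simp [gibbsWeight, hβ, hi]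
    · simp only [gibbsWeight, hβ, if_false, gibbsReal, Fin.sum_univ_two, Matrix.cons_val_zero,
        Matrix.cons_val_one, mul_zero, Real.exp_zero]
      have : Real.exp (-β.toReal * E i) =
          Real.exp (-β.toReal * gap E i j) * Real.exp (-β.toReal * E j) := by
        rw [← Real.exp_add]; congr 1; simp only [gap]; ring
      rw [this]
      ring
  rcases lt_trichotomy j i with h | h | h
  · exact key i j h
  · rw [h]
  · exact (key j i h).symm

lemma rateMatrix_mulVec_gibbsWeight (hE : StrictMono E) (β : ℝ≥0∞) :
    complexify (rateMatrix E β) *ᵥ (fun i => (gibbsWeight E β i : ℂ)) = 0 := by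
  ext j
  have h : ∑ i, rateMatrix E β j i * gibbsWeight E β i = 0 := by
    simp_rw [detailedBalance hE β _ j]
    rw [← Finset.sum_mul, sum_rateMatrix, zero_mul]
  simp only [Matrix.mulVec, dotProduct, complexify_apply, Pi.zero_apply]
  exact_mod_cast h

lemma envPopulation_top {γ : ℝ} (hγ : 0 < γ) :
    envPopulation ⊤ γ 0 = 1 ∧ envPopulation ⊤ γ 1 = 0 := by
  rw [envPopulation_eq hγ, envPopulation_eq hγ]
  simp [gibbsWeight]

lemma rateMatrix_top_isUpperTriangular (hE : StrictMono E) :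
    (rateMatrix E ⊤).IsUpperTriangular := by
  intro j i hij
  have hij' : i < j := hij
  rw [rateMatrix_apply_ne hij'.ne', rate, if_neg hij'.not_gt, if_pos hij',
    (envPopulation_top (gap_pos hE hij')).2, mul_zero]

lemma rateMatrix_realSpectrum (hE : StrictMono E) (β : ℝ≥0∞) :
    IsDoeblin.RealSpectrum (rateMatrix E β) := by
  by_cases hβ : β = ⊤
  · subst hβ
    exact IsDoeblin.realSpectrum_of_upper (rateMatrix_top_isUpperTriangular hE)
  · exact IsDoeblin.realSpectrum_of_detailedBalance (fun i => gibbsWeight_pos E hβ i)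
      (detailedBalance hE β)

lemma rateMatrix_top_diag (hE : StrictMono E) (i : Fin d) :
    rateMatrix E ⊤ i i = -∑ j ∈ Finset.Iio i, (gapMultiplicity E (gap E i j) : ℝ) := by
  rw [rateMatrix_apply_self]
  congr 1
  rw [← Finset.sum_subset (s₁ := Finset.Iio i)]
  · refine Finset.sum_congr rfl fun j hj => ?_
    have h := Finset.mem_Iio.mp hj
    rw [rate, if_pos h, (envPopulation_top (gap_pos hE h)).1, mul_one]
  · intro j hj
    simp [(Finset.mem_Iio.mp hj).ne]
  · intro j hj hj'
    have h1 : ¬ j < i := fun h => hj' (Finset.mem_Iio.mpr h)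
    have h2 : i < j := lt_of_le_of_ne (not_lt.mp h1) (Finset.ne_of_mem_erase hj).symm
    rw [rate, if_neg h1, if_pos h2, (envPopulation_top (gap_pos hE h2)).2, mul_zero]

lemma one_le_sum_gapMultiplicity {i : Fin d} (hi : 0 < (i : ℕ)) :
    1 ≤ ∑ j ∈ Finset.Iio i, (gapMultiplicity E (gap E i j) : ℝ) := by
  have hd : 0 < d := i.pos
  have h0 : (⟨0, hd⟩ : Fin d) < i := Fin.lt_def.mpr hi
  refine le_trans ?_ (Finset.single_le_sum (f := fun j => (gapMultiplicity E (gap E i j) : ℝ))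
    (fun j _ => Nat.cast_nonneg _) (Finset.mem_Iio.mpr h0))
  exact_mod_cast one_le_gapMultiplicity h0

/-- At zero temperature the generator is triangular, so its eigenvalues are the exit rates. -/
lemma isLeast_spectralGap_top (hE : StrictMono E) (hd : 2 ≤ d) :
    IsLeast {s : ℝ | ∃ i : Fin d, 0 < (i : ℕ) ∧
      s = ∑ j ∈ Finset.Iio i, (gapMultiplicity E (gap E i j) : ℝ)}
      (spectralGap (rateMatrix E ⊤)) := by
  have h := rateMatrix_isDoeblin hE hd ⊤
  have hset : {s : ℝ | ∃ i : Fin d, 0 < (i : ℕ) ∧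
      s = ∑ j ∈ Finset.Iio i, (gapMultiplicity E (gap E i j) : ℝ)} =
      {x | ∃ μ ∈ nonzeroSpectrum (rateMatrix E ⊤), x = ‖μ‖} := by
    ext s
    simp only [Set.mem_ofPred_eq, IsDoeblin.mem_nonzeroSpectrum_of_upper h
      (rateMatrix_top_isUpperTriangular hE)]
    have hnorm : ∀ i : Fin d, ‖((rateMatrix E ⊤ i i : ℝ) : ℂ)‖ =
        ∑ j ∈ Finset.Iio i, (gapMultiplicity E (gap E i j) : ℝ) := by
      intro i
      rw [Complex.norm_real, rateMatrix_top_diag hE, norm_neg, Real.norm_of_nonneg]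
      exact Finset.sum_nonneg fun _ _ => Nat.cast_nonneg _
    constructor
    · rintro ⟨i, hi, rfl⟩
      refine ⟨_, ⟨?_, i, rfl⟩, (hnorm i).symm⟩
      rw [← norm_pos_iff, hnorm]
      linarith [one_le_sum_gapMultiplicity (E := E) hi]
    · rintro ⟨_, ⟨h0, i, rfl⟩, rfl⟩
      refine ⟨i, Nat.pos_of_ne_zero fun hi => h0 ?_, hnorm i⟩
      rw [← norm_eq_zero, hnorm]
      have : Finset.Iio i = ∅ := by
        ext j
        simp [Fin.lt_def, hi]
      rw [this, Finset.sum_empty]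
  rw [hset]
  exact h.spectralGap_isLeast hd

lemma tendsto_envPopulation {γ : ℝ} (hγ : 0 < γ) (m : Fin 2) :
    Tendsto (fun b : ℝ≥0 => envPopulation (b : ℝ≥0∞) γ m) atTop (𝓝 (envPopulation ⊤ γ m)) := by
  simp_rw [envPopulation_eq hγ]
  refine ((tendsto_gibbsReal (strictMono_qubit hγ) m).comp
    (NNReal.tendsto_coe_atTop.mpr tendsto_id)).congr fun b => ?_
  simp [gibbsWeight]

lemma tendsto_rateMatrix (hE : StrictMono E) :
    Tendsto (fun b : ℝ≥0 => rateMatrix E (b : ℝ≥0∞)) atTop (𝓝 (rateMatrix E ⊤)) := by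
  have hrate : ∀ j i, Tendsto (fun b : ℝ≥0 => rate E (b : ℝ≥0∞) j i) atTop (𝓝 (rate E ⊤ j i)) := by
    intro j i
    simp only [rate]
    split_ifs with h1 h2
    · exact (tendsto_envPopulation (gap_pos hE h1) 0).const_mul _
    · exact (tendsto_envPopulation (gap_pos hE h2) 1).const_mul _
    · exact tendsto_const_nhds
  refine tendsto_pi_nhds.mpr fun j => tendsto_pi_nhds.mpr fun i => ?_
  simp only [rateMatrix, Matrix.of_apply]
  split_ifs
  · exact (tendsto_finsetSum _ fun k _ => hrate k i).neg
  · exact hrate j i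

end OnResonance

/-! ### Accumulation of errors -/

section Accumulation

variable {d : ℕ}

/-- A column-stochastic matrix. -/
structure IsStochastic (Q : Matrix (Fin d) (Fin d) ℝ) : Prop where
  nonneg : ∀ i j, 0 ≤ Q i j
  sum_col : ∀ j, ∑ i, Q i j = 1

lemma IsStochastic.l1_mulVec_le {Q : Matrix (Fin d) (Fin d) ℝ} (hQ : IsStochastic Q)
    (v : Fin d → ℂ) : l1 (complexify Q *ᵥ v) ≤ l1 v :=
  (ThermalPrep.l1_mulVec_le hQ.nonneg hQ.sum_col v).trans_eq (one_mul _)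

lemma IsStochastic.l1_pow_mulVec_le {Q : Matrix (Fin d) (Fin d) ℝ} (hQ : IsStochastic Q)
    (n : ℕ) (v : Fin d → ℂ) : l1 ((complexify Q ^ n) *ᵥ v) ≤ l1 v := by
  induction n with
  | zero => simp
  | succ n ih =>
    rw [pow_succ', ← Matrix.mulVec_mulVec]
    exact (hQ.l1_mulVec_le _).trans ih

lemma l1_mulVec_le_of_col {M : Matrix (Fin d) (Fin d) ℂ} {e : ℝ}
    (h : ∀ i, ∑ j, ‖M j i‖ ≤ e) (v : Fin d → ℂ) : l1 (M *ᵥ v) ≤ e * l1 v := by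
  calc l1 (M *ᵥ v) ≤ ∑ j, ∑ i, ‖M j i‖ * ‖v i‖ := by
        refine Finset.sum_le_sum fun j _ => ?_
        rw [Matrix.mulVec, dotProduct]
        exact (norm_sum_le _ _).trans_eq (Finset.sum_congr rfl fun i _ => norm_mul _ _)
    _ = ∑ i, (∑ j, ‖M j i‖) * ‖v i‖ := by
        rw [Finset.sum_comm]; simp_rw [Finset.sum_mul]
    _ ≤ ∑ i, e * ‖v i‖ := Finset.sum_le_sum fun i _ =>
        mul_le_mul_of_nonneg_right (h i) (norm_nonneg _)
    _ = e * l1 v := by rw [l1, Finset.mul_sum]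

/-- Column sums agree, so the diagonal entries contribute no more than the others. -/
lemma sum_abs_sub_le {Q P : Matrix (Fin d) (Fin d) ℝ} (i : Fin d)
    (hs : ∑ j, Q j i = ∑ j, P j i) {e : ℝ}
    (h : ∑ j ∈ Finset.univ.erase i, |Q j i - P j i| ≤ e) :
    ∑ j, |Q j i - P j i| ≤ 2 * e := by
  rw [← Finset.add_sum_erase _ _ (Finset.mem_univ i)]
  have h0 : ∑ j, (Q j i - P j i) = 0 := by rw [Finset.sum_sub_distrib, hs, sub_self]
  rw [← Finset.add_sum_erase _ _ (Finset.mem_univ i)] at h0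
  have h1 : |Q i i - P i i| ≤ ∑ j ∈ Finset.univ.erase i, |Q j i - P j i| := by
    rw [eq_neg_of_add_eq_zero_left h0, abs_neg]
    exact Finset.abs_sum_le_sum_abs _ _
  linarith

/-- Errors of the steps of two stochastic dynamics add up. -/
lemma l1_pow_sub_pow_le {Q P : Matrix (Fin d) (Fin d) ℝ} (hQ : IsStochastic Q)
    (hP : ∀ v : Fin d → ℂ, l1 (complexify P *ᵥ v) ≤ l1 v) {e : ℝ} (he : 0 ≤ e)
    (h : ∀ i, ∑ j, |Q j i - P j i| ≤ e) (n : ℕ) (v : Fin d → ℂ) :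
    l1 ((complexify Q ^ n) *ᵥ v - (complexify P ^ n) *ᵥ v) ≤ n * e * l1 v := by
  induction n with
  | zero => simp [l1]
  | succ n ih =>
    have e1 : (complexify Q ^ (n + 1)) *ᵥ v - (complexify P ^ (n + 1)) *ᵥ v =
        (complexify Q - complexify P) *ᵥ ((complexify Q ^ n) *ᵥ v) +
          complexify P *ᵥ ((complexify Q ^ n) *ᵥ v - (complexify P ^ n) *ᵥ v) := by
      rw [pow_succ', pow_succ', ← Matrix.mulVec_mulVec, ← Matrix.mulVec_mulVec,
        Matrix.sub_mulVec, Matrix.mulVec_sub]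
      abel
    have h1 : l1 ((complexify Q - complexify P) *ᵥ ((complexify Q ^ n) *ᵥ v)) ≤ e * l1 v := by
      refine (l1_mulVec_le_of_col (e := e) (fun i => ?_) _).trans
        (mul_le_mul_of_nonneg_left (hQ.l1_pow_mulVec_le n v) he)
      refine le_of_eq_of_le ?_ (h i)
      refine Finset.sum_congr rfl fun j _ => ?_
      rw [Matrix.sub_apply, complexify_apply, complexify_apply, ← Complex.ofReal_sub,
        Complex.norm_real, Real.norm_eq_abs]
    rw [e1]
    refine (l1_add_le _ _).trans ?_
    have h2 := (hP ((complexify Q ^ n) *ᵥ v - (complexify P ^ n) *ᵥ v)).trans ih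
    push_cast
    linarith

end Accumulation

/-! ### The averaged channel on populations -/

section Averaged

variable {d : ℕ} {E : Fin d → ℝ} {β : ℝ≥0∞} {α t : ℝ}

/-- The averaged transition matrix of the channel. -/
def averagedTransition (E : Fin d → ℝ) (β : ℝ≥0∞) (α t : ℝ) : Matrix (Fin d) (Fin d) ℝ :=
  gapExpectation E fun γ => Matrix.of (levelTransition E β α t γ)

lemma averagedChannel_conjDiag (hE : StrictMono E) (V : Matrix.unitaryGroup (Fin d) ℂ)
    (v : Fin d → ℂ) :
    averagedChannel (conjDiag V fun i => (E i : ℂ)) E β α t (conjDiag V v) =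
      conjDiag V (complexify (averagedTransition E β α t) *ᵥ v) := by
  have h : ∀ γ ∈ gapSet E, thermalChannel (conjDiag V fun i => (E i : ℂ)) β α t γ (conjDiag V v) =
      conjDiag V (complexify (Matrix.of (levelTransition E β α t γ)) *ᵥ v) := by
    intro γ hγ
    have := thermalChannel_conj (diagHam_isHermitian E) V β α t γ (Matrix.diagonal v)
    rw [thermalChannel_diagonal (pos_of_mem_gapSet hE hγ)] at this
    exact this
  have hlin : ∀ w : ℝ → ℝ, ∑ x ∈ gapSet E, w x •
      conjDiag V (complexify (Matrix.of (levelTransition E β α t x)) *ᵥ v) =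
      conjDiag V
        (complexify (∑ x ∈ gapSet E, w x • Matrix.of (levelTransition E β α t x)) *ᵥ v) := by
    intro w
    induction gapSet E using Finset.induction_on with
    | empty =>
      simp only [Finset.sum_empty]
      have : complexify (0 : Matrix (Fin d) (Fin d) ℝ) = 0 := by ext; simp
      rw [this, Matrix.zero_mulVec, conjDiag]
      simp
    | insert a s ha ih =>
      rw [Finset.sum_insert ha, Finset.sum_insert ha, ih, ← Complex.coe_smul, smul_conjDiag,
        conjDiag_add, ← Matrix.smul_mulVec, ← Matrix.add_mulVec]
      congr 2
      ext i j
      simp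
  rw [averagedChannel, gapExpectation, Finset.sum_congr rfl fun x hx => by rw [h x hx], hlin]
  rfl

lemma averagedChannel_iterate (hE : StrictMono E) (V : Matrix.unitaryGroup (Fin d) ℂ)
    (v : Fin d → ℂ) (n : ℕ) :
    (averagedChannel (conjDiag V fun i => (E i : ℂ)) E β α t)^[n] (conjDiag V v) =
      conjDiag V ((complexify (averagedTransition E β α t) ^ n) *ᵥ v) := by
  induction n with
  | zero => simp
  | succ n ih =>
    rw [Function.iterate_succ_apply', ih, averagedChannel_conjDiag hE, pow_succ',
      ← Matrix.mulVec_mulVec]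

lemma averagedTransition_isStochastic (hE : StrictMono E) (hd : 2 ≤ d) :
    IsStochastic (averagedTransition E β α t) where
  nonneg i j := by
    rw [averagedTransition, gapExpectation_apply, gapExpectation]
    exact Finset.sum_nonneg fun x hx => smul_nonneg (by positivity)
      (levelTransition_nonneg (pos_of_mem_gapSet hE hx) _ _)
  sum_col j := by
    simp_rw [averagedTransition, gapExpectation_apply, gapExpectation, smul_eq_mul, Matrix.of_apply]
    rw [Finset.sum_comm]
    simp_rw [← Finset.mul_sum]
    rw [Finset.sum_congr rfl fun x hx => by
      rw [sum_levelTransition (pos_of_mem_gapSet hE hx), mul_one]]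
    exact sum_gap_weights hd E

lemma sum_abs_averaged_sub_le (hE : StrictMono E) (hd : 2 ≤ d) (hα : 0 ≤ α) (ht : 0 < t)
    (i : Fin d) :
    ∑ j, |averagedTransition E β α t j i - (1 + averagedOnMatrix E β α t) j i| ≤
      2 * (dysonError d (α * t) + 4 * (α / deltaMin E) ^ 2) := by
  refine sum_abs_sub_le i ?_ ?_
  · rw [(averagedTransition_isStochastic hE hd).sum_col, averagedOnMatrix_eq hE hd]
    simp only [Matrix.add_apply, Finset.sum_add_distrib, Matrix.smul_apply, smul_eq_mul,
      ← Finset.mul_sum, sum_rateMatrix, mul_zero, add_zero, Matrix.one_apply]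
    simp
  · have h : ∀ j ∈ Finset.univ.erase i,
        |averagedTransition E β α t j i - (1 + averagedOnMatrix E β α t) j i| ≤
        ∑ x ∈ gapSet E, ((gapMultiplicity E x : ℝ) / (d.choose 2 : ℝ)) *
          |levelTransition E β α t x j i - onWeight E β α t x j i| := by
      intro j hj
      have hji := Finset.ne_of_mem_erase hj
      rw [Matrix.add_apply, Matrix.one_apply_ne hji, zero_add, averagedTransition,
        averagedOnMatrix, gapExpectation_apply, gapExpectation_apply, gapExpectation,
        gapExpectation, ← Finset.sum_sub_distrib]
      refine (Finset.abs_sum_le_sum_abs _ _).trans (Finset.sum_le_sum fun x _ => ?_)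
      rw [← smul_sub, smul_eq_mul, abs_mul, abs_of_nonneg (by positivity), Matrix.of_apply,
        onMatrix, Matrix.of_apply, if_neg hji]
    refine (Finset.sum_le_sum h).trans ?_
    rw [Finset.sum_comm]
    simp_rw [← Finset.mul_sum]
    calc _ ≤ ∑ x ∈ gapSet E, ((gapMultiplicity E x : ℝ) / (d.choose 2 : ℝ)) *
          (dysonError d (α * t) + 4 * (α / deltaMin E) ^ 2) :=
          Finset.sum_le_sum fun x hx => mul_le_mul_of_nonneg_left
            (sum_abs_levelTransition_sub_onWeight_le hE hd hx hα ht i) (by positivity)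
      _ = _ := by rw [← Finset.sum_mul, sum_gap_weights hd, one_mul]

lemma conjDiag_eq_sum (V : Matrix.unitaryGroup (Fin d) ℂ) (v : Fin d → ℂ) :
    conjDiag V v = ∑ j, v j • eigenprojection V j := by
  have h : ∀ s : Finset (Fin d), ∑ j ∈ s, v j • eigenprojection V j =
      conjDiag V (∑ j ∈ s, Pi.single j (v j)) := by
    intro s
    induction s using Finset.induction_on with
    | empty => simp [conjDiag]
    | insert a s ha ih =>
      rw [Finset.sum_insert ha, Finset.sum_insert ha, ih, eigenprojection_eq, smul_conjDiag,
        conjDiag_add, ← Pi.single_smul]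
      simp
  rw [h, Finset.univ_sum_single]

lemma averagedOnMap_conjDiag (V : Matrix.unitaryGroup (Fin d) ℂ) (v : Fin d → ℂ) :
    averagedOnMap V E β α t (conjDiag V v) =
      conjDiag V (complexify (averagedOnMatrix E β α t) *ᵥ v) := by
  rw [averagedOnMap, conjDiag_apply_col, conjDiag_eq_sum V (_ *ᵥ v), Finset.sum_comm]
  refine Finset.sum_congr rfl fun j _ => ?_
  rw [← Finset.sum_smul]
  congr 1
  simp [Matrix.mulVec, dotProduct]

/-- The thermal state is the only stationary state of the on-resonance chain. -/
lemma fixedPoint_iff (hE : StrictMono E) (hd : 2 ≤ d) (hα : 0 < α) (ht : 0 < t)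
    (V : Matrix.unitaryGroup (Fin d) ℂ) {σ : Matrix (Fin d) (Fin d) ℂ} (hσ : IsState σ)
    (hc : Commute σ (conjDiag V fun i => (E i : ℂ))) :
    σ + averagedOnMap V E β α t σ = σ ↔
      σ = thermalState (conjDiag V fun i => (E i : ℂ)) β := by
  obtain ⟨v, rfl⟩ := exists_conjDiag_of_commute V hE hc
  have hs := ((isState_conjDiag_iff V v).mp hσ).2
  have h := rateMatrix_isDoeblin hE hd β
  have hk : alphaTildeSq d α t / d.choose 2 ≠ 0 :=
    (div_pos (alphaTildeSq_pos hα ht) (choose_two_pos hd)).ne'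
  have hm : ∀ w, complexify (averagedOnMatrix E β α t) *ᵥ w =
      ((alphaTildeSq d α t / d.choose 2 : ℝ) : ℂ) • (complexify (rateMatrix E β) *ᵥ w) := by
    intro w
    rw [averagedOnMatrix_eq hE hd, ← Matrix.smul_mulVec]
    congr 1
    ext i j
    simp
  have hπ := rateMatrix_mulVec_gibbsWeight hE β
  rw [thermalState_conjDiag V hE, (conjDiag_injective V).eq_iff, averagedOnMap_conjDiag,
    add_eq_left, hm]
  constructor
  · intro h0
    have h00 : conjDiag V (0 : Fin d → ℂ) = 0 := by simp [conjDiag]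
    rw [← h00, (conjDiag_injective V).eq_iff, smul_eq_zero] at h0
    have h1 := h0.resolve_left (by exact_mod_cast hk)
    refine sub_eq_zero.mp (h.eq_zero_of_mulVec_eq_zero (v := v - fun i => (gibbsWeight E β i : ℂ))
      ?_ ?_)
    · rw [Matrix.mulVec_sub, h1, hπ, sub_zero]
    · have := sum_gibbsWeight E β (by omega)
      simp only [Pi.sub_apply, Finset.sum_sub_distrib, hs]
      rw [← Complex.ofReal_sum, this]
      simp
  · rintro rfl
    rw [hπ, smul_zero]
    simp [conjDiag]

lemma l1_eq_one {v : Fin d → ℂ} (h0 : ∀ i, 0 ≤ v i) (h1 : ∑ i, v i = 1) : l1 v = 1 := by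
  have : ∀ i, (‖v i‖ : ℂ) = v i := fun i => by
    simpa using RCLike.norm_of_nonneg' (h0 i)
  have h2 : ((l1 v : ℝ) : ℂ) = 1 := by
    rw [l1, Complex.ofReal_sum, ← h1]
    exact Finset.sum_congr rfl fun i _ => this i
  exact_mod_cast h2

/-- The distance of the iterated channel to the thermal state: mixing of the on-resonance chain
plus the accumulated deviation of the channel from it. -/
lemma traceNorm_iterate_le (hE : StrictMono E) (hd : 2 ≤ d) (hα : 0 < α) (ht : 0 < t)
    (hsmall : alphaTildeSq d α t / d.choose 2 * (d : ℝ) ^ 3 ≤ 1)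
    (V : Matrix.unitaryGroup (Fin d) ℂ) {ρ : Matrix (Fin d) (Fin d) ℂ} (hρ : IsState ρ)
    (hc : Commute ρ (conjDiag V fun i => (E i : ℂ))) (n : ℕ) :
    traceNorm (thermalState (conjDiag V fun i => (E i : ℂ)) β -
      (averagedChannel (conjDiag V fun i => (E i : ℂ)) E β α t)^[n] ρ) ≤
      2 * ((4 / (alphaTildeSq d α t / d.choose 2 * spectralGap (rateMatrix E β))) ^ (d - 1) *
        (1 - alphaTildeSq d α t / d.choose 2 * spectralGap (rateMatrix E β) / 2) ^ n) +
      n * (2 * (dysonError d (α * t) + 4 * (α / deltaMin E) ^ 2)) := by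
  obtain ⟨v, rfl⟩ := exists_conjDiag_of_commute V hE hc
  obtain ⟨hv0, hv1⟩ := (isState_conjDiag_iff V v).mp hρ
  have hl := l1_eq_one hv0 hv1
  have h := rateMatrix_isDoeblin hE hd β
  set κ := alphaTildeSq d α t / d.choose 2 with hκ
  have hκ0 : 0 < κ := div_pos (alphaTildeSq_pos hα ht) (choose_two_pos hd)
  have hκB : κ * (2 * (((d : ℝ) - 1) * d.choose 2) + 1 / 2) ≤ 1 :=
    (mul_le_mul_of_nonneg_left (bound_le hd) hκ0.le).trans hsmall
  have hBn := h.bound_nonneg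
  set π : Fin d → ℂ := fun i => (gibbsWeight E β i : ℂ) with hπ
  have hP : complexify (1 + averagedOnMatrix E β α t) =
      1 + (κ : ℂ) • complexify (rateMatrix E β) := by
    rw [averagedOnMatrix_eq hE hd]
    ext i j
    by_cases hij : i = j <;> simp [hij, hκ]
  have hPπ : ∀ n : ℕ, ((1 + (κ : ℂ) • complexify (rateMatrix E β)) ^ n) *ᵥ π = π := by
    intro n
    induction n with
    | zero => simp
    | succ n ih =>
      rw [pow_succ, ← Matrix.mulVec_mulVec, Matrix.add_mulVec, Matrix.smul_mulVec,
        rateMatrix_mulVec_gibbsWeight hE β, smul_zero, add_zero, Matrix.one_mulVec, ih]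
  have hπs : ∑ i, π i = 1 := by
    rw [hπ, ← Complex.ofReal_sum, sum_gibbsWeight E β (by omega), Complex.ofReal_one]
  have hπ0 : ∀ i, 0 ≤ π i := fun i => by
    simpa [hπ] using gibbsWeight_nonneg E β i
  rw [thermalState_conjDiag V hE, averagedChannel_iterate hE, conjDiag_sub, traceNorm_conjDiag]
  have e : π - (complexify (averagedTransition E β α t) ^ n) *ᵥ v =
      ((1 + (κ : ℂ) • complexify (rateMatrix E β)) ^ n) *ᵥ (π - v) +
      (-1 : ℂ) • ((complexify (averagedTransition E β α t) ^ n) *ᵥ v -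
        (complexify (1 + averagedOnMatrix E β α t) ^ n) *ᵥ v) := by
    rw [Matrix.mulVec_sub, hPπ, hP]
    module
  have he : 0 ≤ 2 * (dysonError d (α * t) + 4 * (α / deltaMin E) ^ 2) := by
    have h3 := gaussianMoment_nonneg 3
    have h4 := gaussianMoment_nonneg 4
    rw [dysonError]
    positivity
  rw [e]
  refine (l1_add_le _ _).trans (add_le_add ?_ ?_)
  · have hsum : ∑ i, (π - v) i = 0 := by
      simp [Finset.sum_sub_distrib, hπs, hv1]
    refine (h.l1_pow_le hd (rateMatrix_realSpectrum hE β) hκ0 hκB hsum n).trans ?_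
    have hl2 : l1 (π - v) ≤ 2 := by
      have h1 := l1_add_le π ((-1 : ℂ) • v)
      rw [l1_smul, l1_eq_one hπ0 hπs, hl] at h1
      have h2 : π - v = π + (-1 : ℂ) • v := by module
      rw [h2]
      refine h1.trans ?_
      norm_num
    have h5 := mul_le_mul_of_nonneg_left (h.spectralGap_le hd) hκ0.le
    have h6 := mul_pos hκ0 (h.pos.trans_le (h.le_spectralGap hd))
    rw [mul_comm 2]
    refine mul_le_mul_of_nonneg_left hl2 (mul_nonneg (by positivity) (pow_nonneg (by linarith) _))
  · rw [l1_smul, norm_neg, norm_one, one_mul]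
    refine (l1_pow_sub_pow_le (averagedTransition_isStochastic hE hd) ?_ he
      (fun i => sum_abs_averaged_sub_le hE hd hα.le ht i) n v).trans_eq (by rw [hl, mul_one])
    intro w
    rw [hP]
    refine h.l1_one_add_mulVec_le hκ0.le ?_ w
    nlinarith

end Averaged

/-! ### Parameters -/

section Parameters

variable {d : ℕ} {δ ε lam : ℝ}

lemma rpow_three_halves {x : ℝ} (hx : 0 < x) : x ^ (3 / 2 : ℝ) = x * x ^ (1 / 2 : ℝ) := by
  rw [show (3 / 2 : ℝ) = 1 + 1 / 2 by norm_num, Real.rpow_add hx, Real.rpow_one]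

lemma rpow_half_mul_self {x : ℝ} (hx : 0 < x) : x ^ (1 / 2 : ℝ) * x ^ (1 / 2 : ℝ) = x := by
  rw [← Real.rpow_add hx]
  norm_num

lemma couplingParam_pos (hd : 2 ≤ d) (hδ : 0 < δ) (hε : 0 < ε) (hl : 0 < lam) :
    0 < couplingParam d δ ε lam := by
  have : (0 : ℝ) < d := by exact_mod_cast (by omega : 0 < d)
  unfold couplingParam
  positivity

lemma timeParam_pos (hd : 2 ≤ d) (hδ : 0 < δ) (hε : 0 < ε) (hl : 0 < lam) :
    0 < timeParam d δ ε lam := by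
  have : (0 : ℝ) < d := by exact_mod_cast (by omega : 0 < d)
  unfold timeParam
  positivity

lemma coupling_mul_time (hd : 2 ≤ d) (hδ : 0 < δ) (hε : 0 < ε) (hl : 0 < lam) :
    couplingParam d δ ε lam * timeParam d δ ε lam = ε * lam / (d : ℝ) ^ 5 := by
  have : (0 : ℝ) < d := by exact_mod_cast (by omega : 0 < d)
  have h1 : 0 < ε ^ (1 / 2 : ℝ) := Real.rpow_pos_of_pos hε _
  have h2 : 0 < lam ^ (1 / 2 : ℝ) := Real.rpow_pos_of_pos hl _
  rw [couplingParam, timeParam, rpow_three_halves hε, rpow_three_halves hl]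
  field_simp

lemma coupling_div_sq (hδ : 0 < δ) (hε : 0 < ε) (hl : 0 < lam) :
    (couplingParam d δ ε lam / δ) ^ 2 = ε ^ 3 * lam ^ 3 / (d : ℝ) ^ 14 := by
  have e : couplingParam d δ ε lam / δ =
      ε * ε ^ (1 / 2 : ℝ) * (lam * lam ^ (1 / 2 : ℝ)) / (d : ℝ) ^ 7 := by
    rw [couplingParam, rpow_three_halves hε, rpow_three_halves hl]
    field_simp
  rw [e]
  calc _ = ε ^ 2 * (ε ^ (1 / 2 : ℝ) * ε ^ (1 / 2 : ℝ)) *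
        (lam ^ 2 * (lam ^ (1 / 2 : ℝ) * lam ^ (1 / 2 : ℝ))) / (d : ℝ) ^ 14 := by ring
    _ = _ := by rw [rpow_half_mul_self hε, rpow_half_mul_self hl]; ring

lemma one_le_logFactor (d : ℕ) (ε lam : ℝ) : 1 ≤ logFactor d ε lam := by
  have : 0 ≤ Real.log d := Real.log_natCast_nonneg d
  have h1 := abs_nonneg (Real.log ε)
  have h2 := abs_nonneg (Real.log lam)
  unfold logFactor
  linarith

/-- The gap is at most `d ^ 3`, so the number of steps is large and rounding up is harmless. -/
lemma stepsParam_le (hd : 2 ≤ d) (hε : 0 < ε) (hε2 : ε ≤ 2) (hl : 0 < lam)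
    (hl3 : lam ≤ (d : ℝ) ^ 3) :
    (stepsParam 40 1 d ε lam : ℝ) ≤ 80 * ((d : ℝ) ^ 14 / (ε ^ 2 * lam ^ 3)) *
      logFactor d ε lam ^ 1 := by
  have hd2 : (2 : ℝ) ≤ d := by exact_mod_cast hd
  have hlf := one_le_logFactor d ε lam
  have hX : 1 ≤ (d : ℝ) ^ 14 / (ε ^ 2 * lam ^ 3) := by
    rw [le_div_iff₀ (by positivity), one_mul]
    calc ε ^ 2 * lam ^ 3 ≤ 2 ^ 2 * ((d : ℝ) ^ 3) ^ 3 := by gcongr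
      _ ≤ (d : ℝ) ^ 2 * ((d : ℝ) ^ 3) ^ 3 := by gcongr
      _ = (d : ℝ) ^ 11 := by ring
      _ ≤ (d : ℝ) ^ 14 := pow_le_pow_right₀ (by linarith) (by norm_num)
  have hY : 1 ≤ (d : ℝ) ^ 14 / (ε ^ 2 * lam ^ 3) * logFactor d ε lam ^ 1 := by
    rw [pow_one]; nlinarith
  have := (Nat.ceil_lt_add_one (a := 40 * ((d : ℝ) ^ 14 / (ε ^ 2 * lam ^ 3)) *
    logFactor d ε lam ^ 1) (by nlinarith)).le
  unfold stepsParam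
  linarith

lemma log_ratio_le (hd : 2 ≤ d) (hε : 0 < ε) (hl : 0 < lam) :
    Real.log (4 * (d : ℝ) ^ 13 / (ε ^ 2 * lam ^ 3)) ≤ 13 * logFactor d ε lam := by
  have hd0 : (0 : ℝ) < d := by exact_mod_cast (by omega : 0 < d)
  rw [Real.log_div (by positivity) (by positivity), Real.log_mul (by norm_num) (by positivity),
    Real.log_mul (by positivity) (by positivity), Real.log_pow, Real.log_pow, Real.log_pow]
  have h4 : Real.log 4 ≤ 4 - 1 := Real.log_le_sub_one_of_pos (by norm_num)
  have h1 := neg_abs_le (Real.log ε)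
  have h2 := neg_abs_le (Real.log lam)
  have h3 : 0 ≤ Real.log d := Real.log_natCast_nonneg d
  have h5 := abs_nonneg (Real.log ε)
  have h6 := abs_nonneg (Real.log lam)
  unfold logFactor
  push_cast
  linarith

/-- After `n ≥ (2 / g) ((d - 1) log (4 / g) + log (1 / ε))` steps the chain has mixed. With
`log (4 / g)` at most `13` logarithmic factors, `40 d` factors divided by `g` are enough. -/
lemma mixing_le {g : ℝ} (hd : 2 ≤ d) (hε : 0 < ε) (hl : 0 < lam)
    (hg : ε ^ 2 * lam ^ 3 / (d : ℝ) ^ 13 ≤ g) (hg1 : g ≤ 1) :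
    (4 / g) ^ (d - 1) * (1 - g / 2) ^ stepsParam 40 1 d ε lam ≤ ε := by
  have hd0 : (0 : ℝ) < d := by exact_mod_cast (by omega : 0 < d)
  have hd2 : (2 : ℝ) ≤ d := by exact_mod_cast hd
  have hg0 : 0 < g := lt_of_lt_of_le (by positivity) hg
  set n := stepsParam 40 1 d ε lam with hn
  have hlf := one_le_logFactor d ε lam
  have hlog : Real.log (4 / g) ≤ 13 * logFactor d ε lam := by
    refine le_trans (Real.log_le_log (by positivity) ?_) (log_ratio_le hd hε hl)
    calc 4 / g ≤ 4 / (ε ^ 2 * lam ^ 3 / (d : ℝ) ^ 13) := by gcongr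
      _ = 4 * (d : ℝ) ^ 13 / (ε ^ 2 * lam ^ 3) := by field_simp
  have hng : 40 * d * logFactor d ε lam ≤ n * g := by
    have h1 : 40 * ((d : ℝ) ^ 14 / (ε ^ 2 * lam ^ 3)) * logFactor d ε lam ^ 1 ≤ n :=
      Nat.le_ceil _
    calc 40 * d * logFactor d ε lam = 40 * ((d : ℝ) ^ 14 / (ε ^ 2 * lam ^ 3)) *
          logFactor d ε lam ^ 1 * (ε ^ 2 * lam ^ 3 / (d : ℝ) ^ 13) := by
          field_simp
      _ ≤ n * g := by gcongr
  have hε1 : -Real.log ε ≤ logFactor d ε lam := by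
    have h1 := neg_le_abs (Real.log ε)
    have h2 := abs_nonneg (Real.log lam)
    have h3 : 0 ≤ Real.log d := Real.log_natCast_nonneg d
    unfold logFactor
    linarith
  have hexp : (4 / g) ^ (d - 1) * (1 - g / 2) ^ n ≤
      Real.exp ((d - 1) * Real.log (4 / g) + n * (-(g / 2))) := by
    rw [Real.exp_add]
    have e1 : (4 / g) ^ (d - 1) = Real.exp ((d - 1) * Real.log (4 / g)) := by
      rw [← Real.exp_log (show 0 < (4 / g) ^ (d - 1) by positivity), Real.log_pow,
        Nat.cast_sub (by omega), Nat.cast_one]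
    have e2 : (1 - g / 2) ^ n ≤ Real.exp (n * (-(g / 2))) := by
      rw [Real.exp_nat_mul]
      refine pow_le_pow_left₀ (by linarith) ?_ n
      have := Real.add_one_le_exp (-(g / 2))
      linarith
    rw [← e1]
    gcongr
  refine hexp.trans ?_
  refine le_trans (Real.exp_le_exp.2 ?_) (Real.exp_log hε).le
  have h1 : ((d : ℝ) - 1) * Real.log (4 / g) ≤ (d - 1) * (13 * logFactor d ε lam) :=
    mul_le_mul_of_nonneg_left hlog (by linarith)
  have h2 : logFactor d ε lam ≤ d * logFactor d ε lam :=
    le_mul_of_one_le_left (by linarith) (by linarith)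
  linarith

lemma dysonError_le {x : ℝ} (hx : 0 ≤ x) (hx1 : x ≤ 1) :
    dysonError d x ≤ (4 * gaussianMoment 3 + 2 * gaussianMoment 4) * (d * x ^ 3) := by
  have h3 := gaussianMoment_nonneg 3
  have h4 := gaussianMoment_nonneg 4
  have hx4 : x ^ 4 ≤ x ^ 3 := pow_le_pow_of_le_one hx hx1 (by norm_num)
  calc dysonError d x ≤ 2 * d * (2 * x ^ 3 * gaussianMoment 3 + x ^ 3 * gaussianMoment 4) := by
        unfold dysonError
        gcongr
    _ = _ := by ring

/-- The constant in the error of one step. -/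
def stepConstant : ℝ := 4 * gaussianMoment 3 + 2 * gaussianMoment 4 + 4

lemma stepConstant_pos : 0 < stepConstant := by
  have h3 := gaussianMoment_nonneg 3
  have h4 := gaussianMoment_nonneg 4
  unfold stepConstant
  linarith

variable {E : Fin d → ℝ}

lemma rateMatrix_gap_bounds (hE : StrictMono E) (hd : 2 ≤ d) (β : ℝ≥0∞) :
    0 < spectralGap (rateMatrix E β) ∧ spectralGap (rateMatrix E β) ≤ (d : ℝ) ^ 3 := by
  have h := rateMatrix_isDoeblin hE hd β
  exact ⟨h.pos.trans_le (h.le_spectralGap hd), (h.spectralGap_le hd).trans (bound_le hd)⟩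

/-- With the prescribed parameters mixing leaves a distance `2 ε`, and each of the
`O(d ^ 14 / (ε ^ 2 λ ^ 3))` steps, up to a logarithm, deviates by `O(ε ^ 3 λ ^ 3 / d ^ 14)`. -/
lemma traceNorm_final_le (hE : StrictMono E) (hd : 2 ≤ d) (β : ℝ≥0∞)
    (hε : 0 < ε) (hε2 : ε ≤ 2) (V : Matrix.unitaryGroup (Fin d) ℂ)
    {ρ : Matrix (Fin d) (Fin d) ℂ} (hρ : IsState ρ)
    (hc : Commute ρ (conjDiag V fun i => (E i : ℂ))) :
    traceNorm (thermalState (conjDiag V fun i => (E i : ℂ)) β -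
      (averagedChannel (conjDiag V fun i => (E i : ℂ)) E β
        (couplingParam d (deltaMin E) ε (spectralGap (rateMatrix E β)))
        (timeParam d (deltaMin E) ε (spectralGap (rateMatrix E β))))^[
          stepsParam 40 1 d ε (spectralGap (rateMatrix E β))] ρ) ≤
      (2 + 160 * stepConstant) * ε * logFactor d ε (spectralGap (rateMatrix E β)) ^ 1 := by
  obtain ⟨hl, hl3⟩ := rateMatrix_gap_bounds hE hd β
  set lam := spectralGap (rateMatrix E β) with hlam
  have hδ := deltaMin_pos hE hd
  set δ := deltaMin E with hδd
  have hα := couplingParam_pos hd hδ hε hl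
  have ht := timeParam_pos hd hδ hε hl
  have hprod := coupling_mul_time hd hδ hε hl
  have hdiv := coupling_div_sq (d := d) hδ hε hl
  set α := couplingParam d δ ε lam
  set t := timeParam d δ ε lam
  have hd0 : (0 : ℝ) < d := by exact_mod_cast (by omega : 0 < d)
  have hd2 : (2 : ℝ) ≤ d := by exact_mod_cast hd
  have hx0 : 0 ≤ α * t := by positivity
  have hx : α * t ≤ 2 / (d : ℝ) ^ 2 := by
    rw [hprod, div_le_div_iff₀ (by positivity) (by positivity)]
    calc ε * lam * (d : ℝ) ^ 2 ≤ 2 * (d : ℝ) ^ 3 * (d : ℝ) ^ 2 := by gcongr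
      _ = 2 * (d : ℝ) ^ 5 := by ring
  have hx1 : α * t ≤ 1 := hx.trans (by rw [div_le_one (by positivity)]; nlinarith)
  have hch : (d.choose 2 : ℝ) = d * (d - 1) / 2 := Nat.cast_choose_two ℝ d
  have hch1 : 1 ≤ (d.choose 2 : ℝ) := by exact_mod_cast Nat.choose_pos hd
  set κ := alphaTildeSq d α t / d.choose 2 with hκ
  have hsmall : κ * (d : ℝ) ^ 3 ≤ 1 := by
    have h1 : κ ≤ (2 / (d : ℝ) ^ 2) ^ 2 / (2 * d + 1) / 1 := by
      rw [hκ, alphaTildeSq_eq]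
      gcongr
    calc κ * (d : ℝ) ^ 3 ≤ ((2 : ℝ) / (d : ℝ) ^ 2) ^ 2 / (2 * (d : ℝ) + 1) / 1 * (d : ℝ) ^ 3 :=
          mul_le_mul_of_nonneg_right h1 (by positivity)
      _ = 4 / ((d : ℝ) * (2 * d + 1)) := by field_simp; norm_num
      _ ≤ 1 := by rw [div_le_one (by positivity)]; nlinarith
  have hκ0 : 0 < κ := div_pos (alphaTildeSq_pos hα ht) (by linarith)
  have hg1 : κ * lam ≤ 1 := (mul_le_mul_of_nonneg_left hl3 hκ0.le).trans hsmall
  have hg : ε ^ 2 * lam ^ 3 / (d : ℝ) ^ 13 ≤ κ * lam := by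
    have h1 : (2 * (d : ℝ) + 1) * d.choose 2 ≤ (d : ℝ) ^ 3 := by
      rw [hch]
      nlinarith
    have h2 : κ * lam = ε ^ 2 * lam ^ 3 / ((d : ℝ) ^ 10 * ((2 * d + 1) * d.choose 2)) := by
      rw [hκ, alphaTildeSq_eq, hprod]
      field_simp
    rw [h2]
    refine div_le_div_of_nonneg_left (by positivity) (by positivity) ?_
    calc (d : ℝ) ^ 10 * ((2 * d + 1) * d.choose 2) ≤ (d : ℝ) ^ 10 * (d : ℝ) ^ 3 := by gcongr
      _ = (d : ℝ) ^ 13 := by ring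
  have hmix := mixing_le hd hε hl hg hg1
  have hlf := one_le_logFactor d ε lam
  have hsteps := stepsParam_le hd hε hε2 hl hl3
  set n := stepsParam 40 1 d ε lam
  have herr : dysonError d (α * t) + 4 * (α / δ) ^ 2 ≤
      stepConstant * (ε ^ 3 * lam ^ 3 / (d : ℝ) ^ 14) := by
    have h1 := dysonError_le (d := d) hx0 hx1
    have h2 : d * (α * t) ^ 3 = ε ^ 3 * lam ^ 3 / (d : ℝ) ^ 14 := by
      rw [hprod]
      field_simp
    rw [h2] at h1
    rw [hdiv, stepConstant]
    linarith
  have hc0 := stepConstant_pos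
  calc _ ≤ 2 * ((4 / (κ * lam)) ^ (d - 1) * (1 - κ * lam / 2) ^ n) +
        n * (2 * (dysonError d (α * t) + 4 * (α / δ) ^ 2)) :=
        traceNorm_iterate_le hE hd hα ht hsmall V hρ hc n
    _ ≤ 2 * ε + n * (2 * (stepConstant * (ε ^ 3 * lam ^ 3 / (d : ℝ) ^ 14))) := by gcongr
    _ ≤ 2 * ε + 80 * ((d : ℝ) ^ 14 / (ε ^ 2 * lam ^ 3)) * logFactor d ε lam ^ 1 *
        (2 * (stepConstant * (ε ^ 3 * lam ^ 3 / (d : ℝ) ^ 14))) := by gcongr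
    _ = 2 * ε * 1 + 160 * stepConstant * ε * logFactor d ε lam := by
        rw [pow_one]
        field_simp
        ring
    _ ≤ 2 * ε * logFactor d ε lam + 160 * stepConstant * ε * logFactor d ε lam := by gcongr
    _ = _ := by ring

end Parameters

end ThermalPrep

end

open ThermalPrep in
theorem mainTheorem2 :
    ∃ (c C : ℝ) (k : ℕ), 0 < c ∧ 0 < C ∧
    ∀ (d : ℕ) (hd : 2 ≤ d) (H : Matrix (Fin d) (Fin d) ℂ) (E : Fin d → ℝ)
      (V : Matrix.unitaryGroup (Fin d) ℂ),
      StrictMono E →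
      H = (V : Matrix (Fin d) (Fin d) ℂ) * Matrix.diagonal (fun i => (E i : ℂ)) *
        (V : Matrix (Fin d) (Fin d) ℂ)ᴴ →
    ∃ lam : ℝ≥0∞ → ℝ,
      (∀ β : ℝ≥0∞,
        -- `lam β` is the spectral gap of the rescaled transition matrix for all `α`, `t`
        0 < lam β ∧
        (∀ α t : ℝ, 0 < α → 0 < t → spectralGap (rescaledMatrix E β α t) = lam β) ∧
        -- the thermal state is the unique fixed point of the on-resonance dynamics
        (∀ α t : ℝ, 0 < α → 0 < t →
          IsState (thermalState H β) ∧ Commute (thermalState H β) H ∧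
          ∀ σ : Matrix (Fin d) (Fin d) ℂ, IsState σ → Commute σ H →
            (σ + averagedOnMap V E β α t σ = σ ↔ σ = thermalState H β)) ∧
        -- error and total simulation time
        (∀ ε : ℝ, 0 < ε → ε ≤ 2 →
          (stepsParam c k d ε (lam β) : ℝ) ≤
            C * ((d : ℝ) ^ 14 / (ε ^ 2 * lam β ^ 3)) * logFactor d ε (lam β) ^ k ∧
          (stepsParam c k d ε (lam β) : ℝ) * timeParam d (deltaMin E) ε (lam β) ≤
            C * ((d : ℝ) ^ 16 / (deltaMin E * ε ^ (5 / 2 : ℝ) * lam β ^ (7 / 2 : ℝ))) *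
              logFactor d ε (lam β) ^ k ∧
          ∀ ρ : Matrix (Fin d) (Fin d) ℂ, IsState ρ → Commute ρ H →
            traceNorm (thermalState H β -
              (averagedChannel H E β (couplingParam d (deltaMin E) ε (lam β))
                (timeParam d (deltaMin E) ε (lam β)))^[stepsParam c k d ε (lam β)] ρ) ≤
              C * ε * logFactor d ε (lam β) ^ k)) ∧
      -- the ground state limit
      Tendsto (gibbsState H) atTop (𝓝 (thermalState H ⊤)) ∧
      thermalState H ⊤ = eigenprojection V ⟨0, by omega⟩ ∧
      (∃ m : ℝ,
        IsLeast {s : ℝ | ∃ i : Fin d, 0 < (i : ℕ) ∧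
          s = ∑ j ∈ Finset.Iio i, (gapMultiplicity E (gap E i j) : ℝ)} m ∧
        Tendsto (fun b : ℝ≥0 => lam (b : ℝ≥0∞)) atTop (𝓝 m) ∧ lam ⊤ = m ∧ 1 ≤ m) := by
  have hc0 := stepConstant_pos
  -- `C` dominates the constant `80` of the number of steps and that of the trace distance.
  refine ⟨40, 2 + 160 * stepConstant + 80, 1, by norm_num, by linarith, ?_⟩
  intro d hd H E V hE hH
  have hH' : H = conjDiag V fun i => (E i : ℂ) := hH
  subst hH'
  have hd0 : (0 : ℝ) < d := by exact_mod_cast (by omega : 0 < d)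
  have hδ := deltaMin_pos hE hd
  refine ⟨fun β => spectralGap (rateMatrix E β), fun β => ?_, ?_, ?_, ?_⟩
  · obtain ⟨hl, hl3⟩ := rateMatrix_gap_bounds hE hd β
    refine ⟨hl, fun α t hα ht => by rw [rescaledMatrix_eq hE hd hα ht],
      fun α t hα ht => ⟨?_, ?_, fun σ hσ hc => fixedPoint_iff hE hd hα ht V hσ hc⟩,
      fun ε hε hε2 => ?_⟩
    · rw [thermalState_conjDiag V hE, isState_conjDiag_iff]
      refine ⟨fun i => by simpa using gibbsWeight_nonneg E β i, ?_⟩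
      rw [← Complex.ofReal_sum, sum_gibbsWeight E β (by omega), Complex.ofReal_one]
    · rw [thermalState_conjDiag V hE, Commute, SemiconjBy, conjDiag_mul, conjDiag_mul, mul_comm]
    · have hlf := one_le_logFactor d ε (spectralGap (rateMatrix E β))
      have hsteps := stepsParam_le hd hε hε2 hl hl3
      set lam := spectralGap (rateMatrix E β)
      refine ⟨hsteps.trans ?_, ?_, fun ρ hρ hc =>
        (traceNorm_final_le hE hd β hε hε2 V hρ hc).trans ?_⟩
      · gcongr
        linarith
      · have ht := timeParam_pos hd hδ hε hl
        have e5 : ε ^ (5 / 2 : ℝ) = ε ^ 2 * ε ^ (1 / 2 : ℝ) := by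
          rw [show (5 / 2 : ℝ) = (2 : ℕ) + 1 / 2 by norm_num, Real.rpow_add hε, Real.rpow_natCast]
        have e7 : lam ^ (7 / 2 : ℝ) = lam ^ 3 * lam ^ (1 / 2 : ℝ) := by
          rw [show (7 / 2 : ℝ) = (3 : ℕ) + 1 / 2 by norm_num, Real.rpow_add hl, Real.rpow_natCast]
        have h1 : 0 < ε ^ (1 / 2 : ℝ) := Real.rpow_pos_of_pos hε _
        have h2 : 0 < lam ^ (1 / 2 : ℝ) := Real.rpow_pos_of_pos hl _
        calc _ ≤ 80 * ((d : ℝ) ^ 14 / (ε ^ 2 * lam ^ 3)) * logFactor d ε lam ^ 1 *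
              timeParam d (deltaMin E) ε lam := by gcongr
          _ = 80 * ((d : ℝ) ^ 16 / (deltaMin E * ε ^ (5 / 2 : ℝ) * lam ^ (7 / 2 : ℝ))) *
              logFactor d ε lam ^ 1 := by
              rw [timeParam, e5, e7]
              field_simp
          _ ≤ _ := by
              gcongr
              linarith
      · have h0 : 0 ≤ ε * logFactor d ε lam ^ 1 := by positivity
        linarith
  · rw [thermalState_conjDiag V hE]
    exact tendsto_gibbsState V hE
  · rw [thermalState_conjDiag V hE, eigenprojection_eq]
    congr 1
    ext i
    by_cases hi : i = ⟨0, by omega⟩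
    · subst hi
      simp [gibbsWeight]
    · have : (i : ℕ) ≠ 0 := fun h => hi (Fin.ext h)
      simp [gibbsWeight, hi, this]
  · have hleast := isLeast_spectralGap_top hE hd
    refine ⟨_, hleast, ?_, rfl, ?_⟩
    · exact IsDoeblin.tendsto_spectralGap hd (rateMatrix_isDoeblin hE hd ⊤)
        (fun b => rateMatrix_isDoeblin hE hd b) (tendsto_rateMatrix hE)
    · obtain ⟨i, hi, e⟩ := hleast.1
      rw [e]
      exact one_le_sum_gapMultiplicity hi
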